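/- Let $\mathbf F$ be a finite field with $q$ elements. Let $\mathbf V=\mathbf V_0\oplus\mathbf V_1$, where $\mathbf V_0$ and $\mathbf V_1$ are the $\mathbf F$-vector spaces with bases $e_1,e_2,\dots$ and $f_1,f_2,\dots$, with the pairing $\mathbf V_0\times\mathbf V_1\to\mathbf F$, $\langle e_i,f_j\rangle=\delta_{ij}$. Let $G$ (the Levi infinite general linear group) be the group of linear automorphisms of $\mathbf V$ preserving the grading and the pairing, with the topology in which the pointwise stabilizers $G(A)$ of finite subsets $A\subset\mathbf V$ form a neighborhood basis of the identity. An embedding of $\mathbf Z/2$-graded spaces with such a pairing is an injective linear map preserving gradings and pairings. Let $V_{a,b,c}$ be the space of graded dimension $(a+b\,|\,a+c)$ whose pairing is perfect on an $(a|a)$-dimensional piece and vanishes on the complementary $(b|c)$-dimensional piece, and let $X_{a,b,c}$ be the $G$-set of embeddings $V_{a,b,c}\to\mathbf V$. Let $\mathscr E$ be either the class of all open subgroups of $G$ or the class $\mathscr E(\mathbf V)$ of the subgroups $G(A)$. A (finitary, $\mathscr E$-smooth) $\hat G$-set is a set with an action of some $U\in\mathscr E$ having finitely many orbits and all stabilizers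 in $\mathscr E$; maps and isomorphisms of $\hat G$-sets need only be equivariant for some smaller subgroup in $\mathscr E$. A measure (relative to $\mathscr E$) valued in a commutative ring $k$ assigns to each such $\hat G$-set $X$ an element $\mu(X)\in k$ such that: $\mu(X)=\mu(Y)$ if $X\cong Y$; $\mu(X)=1$ if $X$ is a singleton; $\mu(X\amalg Y)=\mu(X)+\mu(Y)$; $\mu(X^g)=\mu(X)$, where $X^g$ is $X$ with the action twisted by conjugation by $g\in G$; and $\mu(Y)=\mu(X)\mu(F)$ if $Y\to X$ is a map of transitive $U$-sets with $U\in\mathscr E$, and $F$ is its fiber over a point. The ring $\Theta(G;\mathscr E)$ is the quotient of the polynomial ring over $\mathbf Z$ on the symbols $[X]$ by the ideal generated by these equations. Write $\Theta(G)$ when $\mathscr E$ consists of all open subgroups, and $\Theta(G;\mathbf V)$ when $\mathscr E=\mathscr E(\mathbf V)$; put $x_{a,b,c}=[X_{a,b,c}]\in\Theta(G;\mathbf V)$. Finally let $$P_{a,b,c}(t)=q^{-(a+b)(a+c)}\,t^a\prod_{i=0}^{a+b+c-1}(t-q^i)\in\mathbf Z[1/q][t].$$ **Theorem.** (i) For all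 $a,b,c,\ell\ge 0$, $P_{a,b,c}(q^\ell)$ is the number of embeddings $V_{a,b,c}\to V_{\ell,0,0}$. (ii) There is a unique ring homomorphism $\phi\colon\Theta(G;\mathbf V)\to\mathbf Z[1/q][t]$ with $\phi(x_{a,b,c})=P_{a,b,c}(t)$ for all $a,b,c$, and it induces an isomorphism $\Theta(G;\mathbf V)[1/q]\cong\mathbf Z[1/q][t]$. (iii) $\phi$ induces an isomorphism of $\mathbf Q$-algebras $\phi_{\mathbf Q}\colon\Theta(G)\otimes\mathbf Q\to\mathbf Q[t]$; that is, there is such an isomorphism with $\phi_{\mathbf Q}([X]\otimes 1)=\phi([X])$ for every $\mathscr E(\mathbf V)$-smooth finitary $\hat G$-set $X$. (iv) Let $k$ be a field of characteristic $0$. For $\tau\in k$ the rule $\mu_\tau(X)=\phi_{\mathbf Q}([X]\otimes 1)(\tau)$ is a $k$-valued measure on $G$ (relative to all open subgroups), every $k$-valued measure on $G$ is equal to $\mu_\tau$ for exactly one $\tau\in k$, and $\mu_\tau$ is the unique $k$-valued measure $\mu$ on $G$ with $\mu(X_{0,1,0})=\tau-1$. -/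

import Mathlib

open scoped TensorProduct Polynomial

universe u v

/-! ## Measures relative to a class of open subgroups

Throughout, `E` is a set of subgroups of `G`; it is used below for the class of all open subgroups
of a permutation group and for the class of pointwise stabilizers of finite sets. -/

/-- A finitary `E`-smooth `Ĝ`-set: a set with an action of some group of definition `grp ∈ E`,
all of whose stabilizers belong to `E` and which has finitely many orbits. -/
structure HatSet {G : Type u} [Group G] (E : Set (Subgroup G)) where
  grp : Subgroup G
  grp_mem : grp ∈ E
  carrier : Type u
  [act : MulAction grp carrier]
  smooth : ∀ x : carrier, (MulAction.stabilizer grp x).map grp.subtype ∈ E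
  finitary : Finite (MulAction.orbitRel.Quotient grp carrier)

attribute [instance] HatSet.act

namespace HatSet

variable {G : Type u} [Group G] {E : Set (Subgroup G)}

/-- The function `f` commutes with the actions of the subgroup `W` of both groups of definition. -/
def EquivariantOn (W : Subgroup G) {X Y : HatSet E} (f : X.carrier → Y.carrier) : Prop :=
  W ≤ X.grp ∧ W ≤ Y.grp ∧
    ∀ (w : G) (hX : w ∈ X.grp) (hY : w ∈ Y.grp), w ∈ W →
      ∀ x : X.carrier, f ((⟨w, hX⟩ : X.grp) • x) = (⟨w, hY⟩ : Y.grp) • f x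

/-- Maps of `Ĝ`-sets: functions equivariant for some sufficiently small group of definition. -/
def IsHatMap {X Y : HatSet E} (f : X.carrier → Y.carrier) : Prop :=
  ∃ W ∈ E, EquivariantOn W f

/-- `X ≅ Y` as `Ĝ`-sets. -/
def Iso (X Y : HatSet E) : Prop :=
  ∃ f : X.carrier ≃ Y.carrier, IsHatMap (X := X) (Y := Y) f

/-- `X` is a singleton. -/
def IsSingleton (X : HatSet E) : Prop :=
  ∃ x : X.carrier, ∀ y, y = x

/-- `Z` is the disjoint union `X ⨿ Y`. -/
def IsCoprod (Z X Y : HatSet E) : Prop :=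
  ∃ f : X.carrier ⊕ Y.carrier ≃ Z.carrier,
    IsHatMap (X := X) (Y := Z) (fun x => f (Sum.inl x)) ∧
    IsHatMap (X := Y) (Y := Z) (fun y => f (Sum.inr y))

/-- `Y` is `X` with the action twisted by `g`: its group of definition is `g U g⁻¹`, where `U` is
that of `X`, and `g u g⁻¹` acts on `Y` as `u` does on `X`. -/
def IsTwist (g : G) (X Y : HatSet E) : Prop :=
  (∀ u : G, u ∈ X.grp ↔ g * u * g⁻¹ ∈ Y.grp) ∧
    ∃ f : X.carrier ≃ Y.carrier,
      ∀ (u : G) (hX : u ∈ X.grp) (hY : g * u * g⁻¹ ∈ Y.grp) (x : X.carrier),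
        f ((⟨u, hX⟩ : X.grp) • x) = (⟨g * u * g⁻¹, hY⟩ : Y.grp) • f x

/-- `X` is a transitive set for its group of definition. -/
def IsTransitive (X : HatSet E) : Prop :=
  Nonempty X.carrier ∧ MulAction.IsPretransitive X.grp X.carrier

/-- There is a map `Y → X` of transitive `U`-sets, for a common group of definition `U`,
such that `F` is its fiber over some point `x` of `X`. -/
def IsFiber (F Y X : HatSet E) : Prop :=
  Y.grp = X.grp ∧ Y.IsTransitive ∧ X.IsTransitive ∧
    ∃ f : Y.carrier → X.carrier, EquivariantOn X.grp f ∧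
      ∃ (x : X.carrier) (j : F.carrier → Y.carrier),
        IsHatMap j ∧ Function.Injective j ∧ Set.range j = f ⁻¹' {x}

/-- An `E`-smooth `Ĝ`-set is `E'`-smooth for every larger class `E'`. -/
def ofSubset {E' : Set (Subgroup G)} (h : E ⊆ E') (X : HatSet E) : HatSet E' where
  grp := X.grp
  grp_mem := h X.grp_mem
  carrier := X.carrier
  smooth x := h (X.smooth x)
  finitary := X.finitary

end HatSet

/-- A measure on `G`, relative to `E`, valued in `k`. -/
structure IsMeasure {G : Type u} [Group G] {E : Set (Subgroup G)} {k : Type v} [CommRing k]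
    (μ : HatSet E → k) : Prop where
  iso : ∀ X Y : HatSet E, X.Iso Y → μ X = μ Y
  singleton : ∀ X : HatSet E, X.IsSingleton → μ X = 1
  coprod : ∀ Z X Y : HatSet E, Z.IsCoprod X Y → μ Z = μ X + μ Y
  twist : ∀ (g : G) (X Y : HatSet E), X.IsTwist g Y → μ Y = μ X
  fiber : ∀ F Y X : HatSet E, F.IsFiber Y X → μ Y = μ X * μ F

/-- The equations expressing the axioms of a measure, among polynomials in symbols `[X]`. -/
inductive MeasureRel {G : Type u} [Group G] (E : Set (Subgroup G)) :
    MvPolynomial (HatSet E) ℤ → Prop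
  | iso (X Y : HatSet E) (h : X.Iso Y) :
      MeasureRel E (MvPolynomial.X X - MvPolynomial.X Y)
  | singleton (X : HatSet E) (h : X.IsSingleton) :
      MeasureRel E (MvPolynomial.X X - 1)
  | coprod (Z X Y : HatSet E) (h : Z.IsCoprod X Y) :
      MeasureRel E (MvPolynomial.X Z - (MvPolynomial.X X + MvPolynomial.X Y))
  | twist (g : G) (X Y : HatSet E) (h : X.IsTwist g Y) :
      MeasureRel E (MvPolynomial.X Y - MvPolynomial.X X)
  | fiber (F Y X : HatSet E) (h : F.IsFiber Y X) :
      MeasureRel E (MvPolynomial.X Y - MvPolynomial.X X * MvPolynomial.X F)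

/-- The ring `Θ(G; E)` carrying the universal measure. -/
abbrev Theta {G : Type u} [Group G] (E : Set (Subgroup G)) : Type (u + 1) :=
  MvPolynomial (HatSet E) ℤ ⧸ Ideal.span {r | MeasureRel E r}

/-- The class `[X]` in `Θ(G; E)`. -/
noncomputable def Theta.cls {G : Type u} [Group G] {E : Set (Subgroup G)} (X : HatSet E) :
    Theta E :=
  Ideal.Quotient.mk _ (MvPolynomial.X X)

/-! ## Permutation groups -/

/-- The class `𝓔(Ω)` of the groups `G(A)`, the pointwise stabilizers of finite subsets `A ⊆ Ω`. -/
def pointStabilizers (G : Type u) [Group G] (Ω : Type u) [MulAction G Ω] : Set (Subgroup G) :=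
  {U | ∃ A : Finset Ω, U = fixingSubgroup G (A : Set Ω)}

/-- The class of all open subgroups of `G`, for the topology in which the groups `G(A)`
form a neighborhood basis of the identity. -/
def openSubgroups (G : Type u) [Group G] (Ω : Type u) [MulAction G Ω] : Set (Subgroup G) :=
  {U | ∃ A : Finset Ω, fixingSubgroup G (A : Set Ω) ≤ U}

theorem pointStabilizers_subset_openSubgroups (G : Type u) [Group G] (Ω : Type u)
    [MulAction G Ω] : pointStabilizers G Ω ⊆ openSubgroups G Ω := by
  rintro U ⟨A, rfl⟩
  exact ⟨A, le_rfl⟩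

/-! ## Graded spaces with a pairing -/

/-- A `ℤ/2`-graded vector space with a bilinear pairing between its two homogeneous pieces. -/
structure PairedSpace (F : Type u) [Field F] where
  even : Type u
  odd : Type u
  [evenGroup : AddCommGroup even]
  [oddGroup : AddCommGroup odd]
  [evenModule : Module F even]
  [oddModule : Module F odd]
  form : even →ₗ[F] odd →ₗ[F] F

attribute [instance] PairedSpace.evenGroup PairedSpace.oddGroup
  PairedSpace.evenModule PairedSpace.oddModule

namespace PairedSpace

variable {F : Type u} [Field F]

/-- An embedding: an injective linear map that respects the gradings and the pairings. -/
@[ext] structure Emb (V W : PairedSpace F) where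
  even : V.even →ₗ[F] W.even
  odd : V.odd →ₗ[F] W.odd
  even_injective : Function.Injective even
  odd_injective : Function.Injective odd
  form_eq : ∀ x y, W.form (even x) (odd y) = V.form x y

/-- The automorphism group of a graded space with pairing. -/
def aut (V : PairedSpace F) : Subgroup ((V.even ≃ₗ[F] V.even) × (V.odd ≃ₗ[F] V.odd)) where
  carrier := {g | ∀ x y, V.form (g.1 x) (g.2 y) = V.form x y}
  one_mem' _ _ := rfl
  mul_mem' {g h} hg hh x y := (hg (h.1 x) (h.2 y)).trans (hh x y)
  inv_mem' {g} hg x y := by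
    have := hg (g.1⁻¹ x) (g.2⁻¹ y)
    simpa [← LinearEquiv.mul_apply] using this.symm

/-- The underlying set of the space `V₀ ⊕ V₁`. -/
abbrev total (V : PairedSpace F) : Type u := V.even × V.odd

instance (V : PairedSpace F) : MulAction V.aut V.total where
  smul g x := (g.1.1 x.1, g.1.2 x.2)
  one_smul _ := rfl
  mul_smul _ _ _ := rfl

instance (V W : PairedSpace F) : MulAction W.aut (Emb V W) where
  smul g i :=
    { even := g.1.1.toLinearMap ∘ₗ i.even
      odd := g.1.2.toLinearMap ∘ₗ i.odd
      even_injective := g.1.1.injective.comp i.even_injective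
      odd_injective := g.1.2.injective.comp i.odd_injective
      form_eq := fun x y => (g.2 (i.even x) (i.odd y)).trans (i.form_eq x y) }
  one_smul _ := rfl
  mul_smul _ _ _ := rfl

variable (F)

/-- The space `V_{a,b,c}` of dimension `(a+b | a+c)`: the pairing is perfect on the
`(a | a)` piece and vanishes on the rest. -/
def std (a b c : ℕ) : PairedSpace F where
  even := Fin a ⊕ Fin b → F
  odd := Fin a ⊕ Fin c → F
  form := ∑ i : Fin a, (LinearMap.mul F F).compl₁₂
    (LinearMap.proj (Sum.inl i)) (LinearMap.proj (Sum.inl i))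

/-- The pairing on `F^(ℕ) × F^(ℕ)` with `⟨e_i, f_j⟩ = δ_{ij}` for the standard bases. -/
noncomputable def infForm : (ℕ →₀ F) →ₗ[F] (ℕ →₀ F) →ₗ[F] F :=
  Finsupp.linearCombination F (fun i : ℕ => (Finsupp.lapply i : (ℕ →₀ F) →ₗ[F] F))

/-- The space `𝐕` with bases `e_i` (even) and `f_i` (odd), `i ∈ ℕ`, and `⟨e_i, f_j⟩ = δ_{ij}`. -/
noncomputable def inf : PairedSpace F where
  even := ℕ →₀ F
  odd := ℕ →₀ F
  form := infForm F

end PairedSpace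

/-! ## The infinite general linear group -/

/-- The Levi infinite general linear group over `F`, acting on `𝐕`. -/
abbrev GLinf (F : Type u) [Field F] : Type u := (PairedSpace.inf F).aut

namespace GLinf

variable {F : Type u} [Field F]

/-- `GLinf F` with `𝐕` unfolded: the pairs of automorphisms of `F^(ℕ)` preserving the pairing. -/
abbrev InfAut (F : Type u) [Field F] : Type u :=
  ({ carrier := {g | ∀ x y, PairedSpace.infForm F (g.1 x) (g.2 y) = PairedSpace.infForm F x y}
     one_mem' := fun _ _ => rfl
     mul_mem' := fun {_ h} hg hh x y => (hg (h.1 x) (h.2 y)).trans (hh x y)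
     inv_mem' := (PairedSpace.inf F).aut.inv_mem' } :
    Subgroup (((ℕ →₀ F) ≃ₗ[F] (ℕ →₀ F)) × ((ℕ →₀ F) ≃ₗ[F] (ℕ →₀ F))))

theorem form_single_left (n : ℕ) (y : ℕ →₀ F) :
    PairedSpace.infForm F (Finsupp.single n (1 : F)) y = y n := by
  simp [PairedSpace.infForm]

theorem form_single_right (n : ℕ) (x : ℕ →₀ F) :
    PairedSpace.infForm F x (Finsupp.single n (1 : F)) = x n := by
  simp only [PairedSpace.infForm, Finsupp.linearCombination_apply, Finsupp.sum,
    LinearMap.sum_apply, LinearMap.smul_apply, Finsupp.lapply_apply, smul_eq_mul]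
  rw [Finset.sum_eq_single n]
  · simp
  · intro b _ hb
    simp [Finsupp.single_apply, hb.symm]
  · intro h
    simp [Finsupp.notMem_support_iff.mp h]

theorem form_eq_zero (N : ℕ) (x y : ℕ →₀ F) (hx : ∀ k, N ≤ k → x k = 0)
    (hy : ∀ k, k < N → y k = 0) : PairedSpace.infForm F x y = 0 := by
  simp only [PairedSpace.infForm, Finsupp.linearCombination_apply, Finsupp.sum,
    LinearMap.sum_apply, LinearMap.smul_apply, Finsupp.lapply_apply, smul_eq_mul]
  refine Finset.sum_eq_zero fun k _ => ?_
  rcases lt_or_ge k N with h | h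
  · simp [hy k h]
  · simp [hx k h]

theorem form_eq_zero' (N : ℕ) (x y : ℕ →₀ F) (hx : ∀ k, k < N → x k = 0)
    (hy : ∀ k, N ≤ k → y k = 0) : PairedSpace.infForm F x y = 0 := by
  simp only [PairedSpace.infForm, Finsupp.linearCombination_apply, Finsupp.sum,
    LinearMap.sum_apply, LinearMap.smul_apply, Finsupp.lapply_apply, smul_eq_mul]
  refine Finset.sum_eq_zero fun k _ => ?_
  rcases lt_or_ge k N with h | h
  · simp [hx k h]
  · simp [hy k h]

/-- The involution `x ↦ x + ⟨x, δ⟩ d`, `y ↦ y + ⟨d, y⟩ δ` when `⟨d, δ⟩ = -2`. -/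
theorem exists_reflection (d δ : ℕ →₀ F) (h : PairedSpace.infForm F d δ = -2) :
    ∃ g : InfAut F,
      (∀ x : ℕ →₀ F, g.1.1 x = x + PairedSpace.infForm F x δ • d) ∧
      (∀ y : ℕ →₀ F, g.1.2 y = y + PairedSpace.infForm F d y • δ) := by
  let B : (ℕ →₀ F) →ₗ[F] (ℕ →₀ F) →ₗ[F] F := PairedSpace.infForm F
  have hB : B d δ = -2 := h
  let p : (ℕ →₀ F) →ₗ[F] (ℕ →₀ F) := LinearMap.id + (B.flip δ).smulRight d
  let r : (ℕ →₀ F) →ₗ[F] (ℕ →₀ F) := LinearMap.id + (B d).smulRight δ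
  have hp (x) : p x = x + B x δ • d := rfl
  have hr (y) : r y = y + B d y • δ := rfl
  have hpp : Function.Involutive p := by
    intro x
    rw [hp, hp]
    simp only [map_add, map_smul, LinearMap.add_apply, LinearMap.smul_apply, hB, smul_eq_mul]
    module
  have hrr : Function.Involutive r := by
    intro y
    rw [hr, hr]
    simp only [map_add, map_smul, hB, smul_eq_mul]
    module
  let g : ((ℕ →₀ F) ≃ₗ[F] (ℕ →₀ F)) × ((ℕ →₀ F) ≃ₗ[F] (ℕ →₀ F)) :=
    (LinearEquiv.ofInvolutive p hpp, LinearEquiv.ofInvolutive r hrr)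
  refine ⟨⟨g, ?_⟩, hp, hr⟩
  intro x y
  change B (p x) (r y) = B x y
  rw [hp, hr]
  simp only [map_add, map_smul, LinearMap.add_apply, LinearMap.smul_apply, hB, smul_eq_mul]
  ring

/-- Two hyperbolic pairs, orthogonal to each other and to the first `N` basis vectors, are
exchanged by an element of the group that fixes the first `N` basis vectors. -/
theorem exists_swap (N : ℕ) (x y x' y' : ℕ →₀ F)
    (hx : ∀ k, k < N → x k = 0) (hy : ∀ k, k < N → y k = 0)
    (hx' : ∀ k, k < N → x' k = 0) (hy' : ∀ k, k < N → y' k = 0)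
    (h : PairedSpace.infForm F x y = 1) (h' : PairedSpace.infForm F x' y' = 1)
    (h₁ : PairedSpace.infForm F x y' = 0) (h₂ : PairedSpace.infForm F x' y = 0) :
    ∃ g : InfAut F, g.1.1 x = x' ∧ g.1.2 y = y' ∧
      (∀ z : ℕ →₀ F, (∀ k, N ≤ k → z k = 0) → g.1.1 z = z) ∧
      (∀ z : ℕ →₀ F, (∀ k, N ≤ k → z k = 0) → g.1.2 z = z) := by
  let B : (ℕ →₀ F) →ₗ[F] (ℕ →₀ F) →ₗ[F] F := PairedSpace.infForm F
  have e : B x y = 1 := h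
  have e' : B x' y' = 1 := h'
  have e₁ : B x y' = 0 := h₁
  have e₂ : B x' y = 0 := h₂
  have hd : B (x' - x) (y - y') = -2 := by
    simp only [map_sub, LinearMap.sub_apply, e, e', e₁, e₂]
    norm_num
  obtain ⟨g, hg, hg'⟩ := exists_reflection (x' - x) (y - y') hd
  refine ⟨g, ?_, ?_, fun z hz => ?_, fun z hz => ?_⟩
  · refine (hg x).trans ?_
    change x + B x (y - y') • (x' - x) = x'
    simp [e, e₁]
  · refine (hg' y).trans ?_
    change y + B (x' - x) y • (y - y') = y'
    simp [e, e₂]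
  · refine (hg z).trans ?_
    rw [form_eq_zero N z _ hz]
    · simp
    · intro k hk
      simp [hy k hk, hy' k hk]
  · refine (hg' z).trans ?_
    rw [form_eq_zero' N _ z _ hz]
    · simp
    · intro k hk
      simp [hx k hk, hx' k hk]

/-- A hyperbolic pair orthogonal to the first `N` basis vectors can be moved to `(e_N, f_N)`
fixing the first `N` basis vectors. -/
theorem exists_move (N : ℕ) (x y : ℕ →₀ F)
    (hx : ∀ k, k < N → x k = 0) (hy : ∀ k, k < N → y k = 0)
    (h : PairedSpace.infForm F x y = 1) :
    ∃ g : InfAut F, g.1.1 x = Finsupp.single N (1 : F) ∧ g.1.2 y = Finsupp.single N (1 : F) ∧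
      (∀ z : ℕ →₀ F, (∀ k, N ≤ k → z k = 0) → g.1.1 z = z) ∧
      (∀ z : ℕ →₀ F, (∀ k, N ≤ k → z k = 0) → g.1.2 z = z) := by
  classical
  obtain ⟨M, hM⟩ := Infinite.exists_notMem_finset (x.support ∪ y.support ∪ Finset.range (N + 1))
  simp only [Finset.mem_union, Finsupp.mem_support_iff, Finset.mem_range, not_or, not_not,
    not_lt] at hM
  obtain ⟨⟨hMx, hMy⟩, hMN⟩ := hM
  have hs (K : ℕ) (hK : N ≤ K) : ∀ k, k < N → (Finsupp.single K (1 : F)) k = 0 := by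
    intro k hk
    simp [Finsupp.single_apply, show K ≠ k by omega]
  obtain ⟨g, g1, g2, g3, g4⟩ := exists_swap N x y (Finsupp.single M 1) (Finsupp.single M 1)
    hx hy (hs M (by omega)) (hs M (by omega)) h (by rw [form_single_left]; simp)
    (by rw [form_single_right, hMx]) (by rw [form_single_left, hMy])
  obtain ⟨h, h1, h2, h3, h4⟩ := exists_swap N (Finsupp.single M (1 : F)) (Finsupp.single M 1)
    (Finsupp.single N 1) (Finsupp.single N 1)
    (hs M (by omega)) (hs M (by omega)) (hs N le_rfl) (hs N le_rfl)
    (by rw [form_single_left]; simp) (by rw [form_single_left]; simp)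
    (by rw [form_single_left]; simp [Finsupp.single_apply]; omega)
    (by rw [form_single_left]; simp [Finsupp.single_apply]; omega)
  refine ⟨h * g, ?_, ?_, fun z hz => ?_, fun z hz => ?_⟩
  · exact (congrArg h.1.1 g1).trans h1
  · exact (congrArg h.1.2 g2).trans h2
  · exact (congrArg h.1.1 (g3 z hz)).trans (h3 z hz)
  · exact (congrArg h.1.2 (g4 z hz)).trans (h4 z hz)

theorem exists_split (N : ℕ) (x : ℕ →₀ F) :
    ∃ z w : ℕ →₀ F, x = z + w ∧ (∀ k, N ≤ k → z k = 0) ∧ (∀ k, k < N → w k = 0) := by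
  refine ⟨x.filter (· < N), x.filter (fun k => ¬ k < N),
    (Finsupp.filter_add_filter_not x _).symm, fun k hk => ?_, fun k hk => ?_⟩
  · simp [Finsupp.filter_apply]; omega
  · simp [Finsupp.filter_apply]; omega

theorem exists_even (N : ℕ) (x : ℕ →₀ F) :
    ∃ g : InfAut F, (∀ k, N + 1 ≤ k → g.1.1 x k = 0) ∧
      (∀ z : ℕ →₀ F, (∀ k, N ≤ k → z k = 0) → g.1.1 z = z) ∧
      (∀ z : ℕ →₀ F, (∀ k, N ≤ k → z k = 0) → g.1.2 z = z) := by
  obtain ⟨z, w, rfl, hz, hw⟩ := exists_split N x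
  by_cases h0 : w = 0
  · refine ⟨1, fun k hk => ?_, fun _ _ => rfl, fun _ _ => rfl⟩
    subst h0
    change (z + 0) k = 0
    simp [hz k (by omega)]
  obtain ⟨k, hk⟩ := Finsupp.ne_iff.mp h0
  have hkN : N ≤ k := by
    by_contra hc
    exact hk (hw k (by omega))
  have hk' : w k ≠ 0 := hk
  obtain ⟨g, g1, -, g3, g4⟩ := exists_move N w ((w k)⁻¹ • Finsupp.single k (1 : F)) hw
    (fun j hj => by simp [Finsupp.single_apply, show k ≠ j by omega])
    ((((PairedSpace.infForm F w).map_smul (w k)⁻¹ (Finsupp.single k (1 : F)))).trans (by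
      rw [form_single_right]; exact inv_mul_cancel₀ hk'))
  refine ⟨g, fun j hj => ?_, g3, g4⟩
  have : g.1.1 (z + w) = z + Finsupp.single N (1 : F) :=
    (map_add g.1.1 z w).trans (congrArg₂ (fun a b : ℕ →₀ F => a + b) (g3 z hz) g1)
  rw [show (g.1.1 (z + w)) = z + Finsupp.single N (1 : F) from this]
  simp [hz j (by omega), Finsupp.single_apply, show N ≠ j by omega]

theorem exists_odd (N : ℕ) (y : ℕ →₀ F) :
    ∃ g : InfAut F, (∀ k, N + 1 ≤ k → (g.1.2 y) k = 0) ∧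
      (∀ z : ℕ →₀ F, (∀ k, N ≤ k → z k = 0) → g.1.1 z = z) ∧
      (∀ z : ℕ →₀ F, (∀ k, N ≤ k → z k = 0) → g.1.2 z = z) := by
  obtain ⟨z, w, rfl, hz, hw⟩ := exists_split N y
  by_cases h0 : w = 0
  · refine ⟨1, fun k hk => ?_, fun _ _ => rfl, fun _ _ => rfl⟩
    subst h0
    change (z + 0) k = 0
    simp [hz k (by omega)]
  obtain ⟨k, hk⟩ := Finsupp.ne_iff.mp h0
  have hkN : N ≤ k := by
    by_contra hc
    exact hk (hw k (by omega))
  have hk' : w k ≠ 0 := hk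
  obtain ⟨g, -, g1, g3, g4⟩ := exists_move N ((w k)⁻¹ • Finsupp.single k (1 : F)) w
    (fun j hj => by simp [Finsupp.single_apply, show k ≠ j by omega]) hw
    (((((PairedSpace.infForm F).flip w).map_smul (w k)⁻¹ (Finsupp.single k (1 : F)))).trans (by
      rw [LinearMap.flip_apply, form_single_left]; exact inv_mul_cancel₀ hk'))
  refine ⟨g, fun j hj => ?_, g3, g4⟩
  have : g.1.2 (z + w) = z + Finsupp.single N (1 : F) :=
    (map_add g.1.2 z w).trans (congrArg₂ (fun a b : ℕ →₀ F => a + b) (g4 z hz) g1)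
  rw [show (g.1.2 (z + w)) = z + Finsupp.single N (1 : F) from this]
  simp [hz j (by omega), Finsupp.single_apply, show N ≠ j by omega]

/-- Every finite subset of `𝐕` can be moved into the span of finitely many basis vectors, whose
number depends only on its cardinality. -/
theorem exists_bounded (S : Finset ((ℕ →₀ F) × (ℕ →₀ F))) :
    ∃ g : InfAut F, ∀ p ∈ S,
      (∀ k, 2 * S.card ≤ k → (g.1.1 p.1) k = 0) ∧
      (∀ k, 2 * S.card ≤ k → (g.1.2 p.2) k = 0) := by
  classical
  induction S using Finset.induction_on with
  | empty => exact ⟨1, by simp⟩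
  | insert p S hp ih =>
    obtain ⟨g, hg⟩ := ih
    obtain ⟨h, h1, h2, h3⟩ := exists_even (2 * S.card) (g.1.1 p.1)
    obtain ⟨l, l1, l2, l3⟩ := exists_odd (2 * S.card + 1) (h.1.2 (g.1.2 p.2))
    rw [Finset.card_insert_of_notMem hp]
    refine ⟨l * (h * g), fun r hr => ?_⟩
    rcases Finset.mem_insert.mp hr with rfl | hr
    · constructor
      · intro k hk
        have : l.1.1 (h.1.1 (g.1.1 r.1)) = h.1.1 (g.1.1 r.1) := l2 _ h1
        change (l.1.1 (h.1.1 (g.1.1 r.1))) k = 0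
        rw [this]
        exact h1 k (by omega)
      · intro k hk
        exact l1 k (by omega)
    · obtain ⟨r1, r2⟩ := hg r hr
      constructor
      · intro k hk
        have e1 : h.1.1 (g.1.1 r.1) = g.1.1 r.1 := h2 _ r1
        have e2 : l.1.1 (g.1.1 r.1) = g.1.1 r.1 := l2 _ (fun k hk => r1 k (by omega))
        change (l.1.1 (h.1.1 (g.1.1 r.1))) k = 0
        rw [e1, e2]
        exact r1 k (by omega)
      · intro k hk
        have e1 : h.1.2 (g.1.2 r.2) = g.1.2 r.2 := h3 _ r2
        have e2 : l.1.2 (g.1.2 r.2) = g.1.2 r.2 := l3 _ (fun k hk => r2 k (by omega))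
        change (l.1.2 (h.1.2 (g.1.2 r.2))) k = 0
        rw [e1, e2]
        exact r2 k (by omega)

/-- The action of `G` on the set of embeddings `V_{a,b,c} → 𝐕` has finitely many orbits. -/
theorem finitary_emb [Finite F] (a b c : ℕ) :
    Finite (MulAction.orbitRel.Quotient (⊤ : Subgroup (GLinf F))
      (PairedSpace.Emb (PairedSpace.std F a b c) (PairedSpace.inf F))) := by
  classical
  have : Finite (PairedSpace.std F a b c).even := inferInstanceAs (Finite (Fin a ⊕ Fin b → F))
  have : Finite (PairedSpace.std F a b c).odd := inferInstanceAs (Finite (Fin a ⊕ Fin c → F))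
  have := Fintype.ofFinite (PairedSpace.std F a b c).even
  have := Fintype.ofFinite (PairedSpace.std F a b c).odd
  let I := (PairedSpace.std F a b c).even × (PairedSpace.std F a b c).odd
  let N := 2 * Fintype.card I
  let E := PairedSpace.Emb (PairedSpace.std F a b c) (PairedSpace.inf F)
  let ev (i : E) (x) : ℕ →₀ F := i.even x
  let od (i : E) (x) : ℕ →₀ F := i.odd x
  let T := {i : E // (∀ x k, N ≤ k → ev i x k = 0) ∧ ∀ x k, N ≤ k → od i x k = 0}
  have hT : Finite T := by
    refine Finite.of_injective (β := ((PairedSpace.std F a b c).even → Fin N → F) ×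
      ((PairedSpace.std F a b c).odd → Fin N → F))
      (fun i => (fun x k => ev i.1 x k, fun x k => od i.1 x k)) ?_
    rintro ⟨i, hi, hi'⟩ ⟨j, hj, hj'⟩ h
    obtain ⟨h1, h2⟩ := Prod.mk.inj h
    refine Subtype.ext (PairedSpace.Emb.ext (LinearMap.ext fun x => ?_) (LinearMap.ext fun x => ?_))
    · refine Finsupp.ext (f := ev i x) (g := ev j x) fun k => ?_
      rcases lt_or_ge k N with hk | hk
      · exact congrFun (congrFun h1 x) ⟨k, hk⟩
      · exact (hi x k hk).trans (hj x k hk).symm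
    · refine Finsupp.ext (f := od i x) (g := od j x) fun k => ?_
      rcases lt_or_ge k N with hk | hk
      · exact congrFun (congrFun h2 x) ⟨k, hk⟩
      · exact (hi' x k hk).trans (hj' x k hk).symm
  refine Finite.of_surjective (α := T) (fun i => Quotient.mk _ i.1) ?_
  intro o
  induction o using Quotient.inductionOn with
  | h i =>
    let S : Finset ((ℕ →₀ F) × (ℕ →₀ F)) :=
      Finset.univ.image fun p : I => (ev i p.1, od i p.2)
    have hS : 2 * S.card ≤ N := Nat.mul_le_mul_left 2 Finset.card_image_le
    obtain ⟨g, hg⟩ := exists_bounded S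
    have hmem (p : I) : (ev i p.1, od i p.2) ∈ S := Finset.mem_image_of_mem _ (Finset.mem_univ p)
    let g' : GLinf F := g
    refine ⟨⟨g' • i, fun x k hk => ?_, fun x k hk => ?_⟩, ?_⟩
    · exact (hg _ (hmem (x, 0))).1 k (hS.trans hk)
    · exact (hg _ (hmem (0, x))).2 k (hS.trans hk)
    · exact Quotient.sound ⟨⟨g', Subgroup.mem_top _⟩, rfl⟩

/-- The class `𝓔(𝐕)`. -/
abbrev pointClass (F : Type u) [Field F] : Set (Subgroup (GLinf F)) :=
  pointStabilizers (GLinf F) (PairedSpace.inf F).total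

/-- The class of all open subgroups of `G`. -/
abbrev openClass (F : Type u) [Field F] : Set (Subgroup (GLinf F)) :=
  openSubgroups (GLinf F) (PairedSpace.inf F).total

theorem pointClass_subset_openClass (F : Type u) [Field F] : pointClass F ⊆ openClass F :=
  pointStabilizers_subset_openSubgroups _ _

/-- The `G`-set `X_{a,b,c}` of embeddings `V_{a,b,c} → 𝐕`. -/
noncomputable def embSet (F : Type u) [Field F] [Finite F] (a b c : ℕ) : HatSet (pointClass F) where
  grp := ⊤
  grp_mem := ⟨∅, by simp⟩
  carrier := PairedSpace.Emb (PairedSpace.std F a b c) (PairedSpace.inf F)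
  smooth i := by
    classical
    have : Finite (PairedSpace.std F a b c).even := inferInstanceAs (Finite (Fin a ⊕ Fin b → F))
    have : Finite (PairedSpace.std F a b c).odd := inferInstanceAs (Finite (Fin a ⊕ Fin c → F))
    have := Fintype.ofFinite (PairedSpace.std F a b c).even
    have := Fintype.ofFinite (PairedSpace.std F a b c).odd
    refine ⟨Finset.univ.image fun p : (PairedSpace.std F a b c).even ×
      (PairedSpace.std F a b c).odd => (i.even p.1, i.odd p.2), ?_⟩
    ext g
    simp only [Subgroup.mem_map, MulAction.mem_stabilizer_iff, mem_fixingSubgroup_iff,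
      Finset.coe_image, Finset.coe_univ, Set.image_univ, Set.mem_range, Subgroup.coe_subtype]
    constructor
    · rintro ⟨h, hh, rfl⟩ _ ⟨p, rfl⟩
      have h1 := LinearMap.congr_fun (congrArg PairedSpace.Emb.even hh) p.1
      have h2 := LinearMap.congr_fun (congrArg PairedSpace.Emb.odd hh) p.2
      exact Prod.ext h1 h2
    · intro h
      refine ⟨⟨g, Subgroup.mem_top g⟩, ?_, rfl⟩
      refine PairedSpace.Emb.ext (LinearMap.ext fun x => ?_) (LinearMap.ext fun x => ?_)
      · exact congrArg Prod.fst (h _ ⟨(x, 0), rfl⟩)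
      · exact congrArg Prod.snd (h _ ⟨(0, x), rfl⟩)
  finitary := finitary_emb a b c

end GLinf

/-! ## The polynomials `P_{a,b,c}` -/

/-- The ring `ℤ[1/q]`. -/
abbrev ZInv (q : ℕ) : Type := Localization.Away (q : ℤ)

/-- The inverse of `q` in `ℤ[1/q]`. -/
noncomputable def ZInv.inv (q : ℕ) : ZInv q := IsLocalization.Away.invSelf (q : ℤ)

/-- The inclusion of `ℤ[1/q]` into `ℚ`, for `q ≠ 0`. -/
noncomputable def ZInv.toRat (q : ℕ) (hq : q ≠ 0) : ZInv q →+* ℚ :=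
  IsLocalization.Away.lift (g := Int.castRingHom ℚ) (q : ℤ)
    (by simpa using hq)

/-- `P_{a,b,c}(t) = q^{-(a+b)(a+c)} t^a ∏_{i=0}^{a+b+c-1} (t - q^i)`. -/
noncomputable def countPoly (q a b c : ℕ) : (ZInv q)[X] :=
  Polynomial.C (ZInv.inv q ^ ((a + b) * (a + c))) * Polynomial.X ^ a *
    ∏ i ∈ Finset.range (a + b + c), (Polynomial.X - Polynomial.C ((q : ZInv q) ^ i))

/-! A measure relative to `𝓔(𝐕)` is rigid: once `q` is invertible, it is determined by its value on
`X_{0,1,0}`. Each transitive set is `G(A)/G(B)` for finite-dimensional graded subspaces `A ≤ B`, and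
by the fiber axiom it suffices to add one vector `x` at a time. By Witt's extension theorem
(`exists_fix_act_eq`), the orbit of `x` under `G(A)` consists of the vectors outside `A` that pair
with `A` as `x` does. All vectors pairing with `A` as `x` does form a translate of an orthogonal
complement, and `q ^ d` such translates fill one homogeneous piece of `𝐕`, where `d` is the
dimension of `A` on the other side. So the measure of the orbit is `q ^ (-d)` times that of the
homogeneous piece, minus a finite count (`measure_alikeSet_zero`, `measure_quot_line`). The two
pieces of `𝐕` have the same measure, because a hyperbolic pair can be chosen in either order
(`measure_side_eq`), and the even piece is `X_{0,1,0}` with a point added. Hence `measure_mem`: all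
values lie in the subring generated by `1/q` and `μ(X_{0,1,0})`.

Existence comes from counting. For a smooth `X`, let `N_X(n)` be the number of points fixed by the
pointwise stabilizer of the span of the first `n` basis vectors on each side. Every measure axiom
holds for `N_X(n)` when `n` is large, so `X ↦ N_X` is a measure in the ring of germs of sequences at
infinity (`isMeasure_counting`), even relative to all open subgroups. The fixed points of
`X_{a,b,c}` are the embeddings in `V_{n,0,0}`, and there are `P_{a,b,c}(q ^ n)` of them
(`card_emb_std`).

The two halves meet in `ℤ[1/q][t] → Θ(G; 𝐕)[1/q] → germs`, where `t ↦ 1 + [X_{0,1,0}]`. The first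
map is onto by rigidity; the composite `p ↦ (p(q ^ n))` is injective because `p` has finitely many
roots. So the first map is bijective and counting is faithful.

For all open subgroups, each `U` has a least support `W` (`exists_isSupport`), and `G(W)` is normal
of finite index in `U`. Over `ℚ` these indices are invertible, so the measure of `U/V` is determined
by measures of sets `G(A)/G(B)` (`measure_mem_of_open`), and the same comparison gives `Θ(G) ⊗ ℚ ≅
ℚ[t]`. -/

/-! ## The two actions of the group and the pointwise stabilizers of graded subspaces

The side `s : Bool` of `𝐕` is the even one for `s = true` and the odd one for `s = false`. -/

namespace GLinf

variable {F : Type u} [Field F]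

/-- The underlying vector space of either homogeneous piece of `𝐕`. -/
abbrev Vec (F : Type u) [Field F] : Type u := ℕ →₀ F

/-- Pairs of subspaces of the homogeneous pieces of `𝐕`. -/
abbrev Pair (F : Type u) [Field F] : Type u := Bool → Submodule F (Vec F)

/-- The action of the group on one side of `𝐕`. -/
def act (s : Bool) (g : GLinf F) : Vec F ≃ₗ[F] Vec F :=
  match s with
  | true => g.1.1
  | false => g.1.2

theorem act_mul (s : Bool) (g h : GLinf F) (x : Vec F) : act s (g * h) x = act s g (act s h x) := by
  cases s <;> rfl

@[simp] theorem act_one (s : Bool) (x : Vec F) : act s 1 x = x := by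
  cases s <;> rfl

@[simp] theorem act_inv_act (s : Bool) (g : GLinf F) (x : Vec F) : act s g⁻¹ (act s g x) = x := by
  rw [← act_mul, inv_mul_cancel, act_one]

@[simp] theorem act_act_inv (s : Bool) (g : GLinf F) (x : Vec F) : act s g (act s g⁻¹ x) = x := by
  rw [← act_mul, mul_inv_cancel, act_one]

theorem infForm_single_right (n : ℕ) (x : Vec F) (c : F) :
    PairedSpace.infForm F x (Finsupp.single n c) = x n * c := by
  rw [← mul_one c, ← smul_eq_mul, ← Finsupp.smul_single, map_smul, form_single_right]
  simp [mul_comm]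

theorem infForm_comm (x y : Vec F) : PairedSpace.infForm F x y = PairedSpace.infForm F y x := by
  induction y using Finsupp.induction_linear with
  | zero => simp
  | add f g hf hg => simp [hf, hg]
  | single n c =>
    have : Finsupp.single n c = c • Finsupp.single n (1 : F) := by simp
    rw [infForm_single_right, this, map_smul, LinearMap.smul_apply, form_single_left]
    simp [mul_comm]

theorem form_act (s : Bool) (g : GLinf F) (x y : Vec F) :
    PairedSpace.infForm F (act s g x) (act (!s) g y) = PairedSpace.infForm F x y := by
  cases s
  · rw [infForm_comm, infForm_comm x]
    exact g.2 y x
  · exact g.2 x y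

theorem form_act_left (s : Bool) (g : GLinf F) (x y : Vec F) :
    PairedSpace.infForm F (act s g x) y = PairedSpace.infForm F x (act (!s) g⁻¹ y) := by
  rw [← form_act s g x, act_act_inv]

/-- The group element with given actions on both sides. -/
theorem exists_act (s : Bool) (p r : Vec F ≃ₗ[F] Vec F)
    (h : ∀ x y, PairedSpace.infForm F (p x) (r y) = PairedSpace.infForm F x y) :
    ∃ g : GLinf F, act s g = p ∧ act (!s) g = r := by
  cases s
  · refine ⟨⟨(r, p), fun x y => ?_⟩, rfl, rfl⟩
    exact (infForm_comm (r x) (p y)).trans ((h y x).trans (infForm_comm y x))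
  · exact ⟨⟨(p, r), h⟩, rfl, rfl⟩

/-- The pointwise stabilizer of a pair of subspaces. -/
def fix (W : Pair F) : Subgroup (GLinf F) where
  carrier := {g | ∀ s, ∀ x ∈ W s, act s g x = x}
  one_mem' := by simp
  mul_mem' {g h} hg hh s x hx := by rw [act_mul, hh s x hx, hg s x hx]
  inv_mem' {g} hg s x hx := by
    conv_lhs => rw [← hg s x hx]
    simp

theorem fix_anti {W W' : Pair F} (h : W ≤ W') : fix W' ≤ fix W :=
  fun _ hg s x hx => hg s x (h s hx)

@[simp] theorem fix_bot : fix (⊥ : Pair F) = ⊤ := by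
  refine top_le_iff.mp fun g _ s x hx => ?_
  rw [(Submodule.mem_bot F).mp hx, map_zero]

theorem fix_sup (W W' : Pair F) : fix (W ⊔ W') = fix W ⊓ fix W' := by
  refine le_antisymm (le_inf (fix_anti le_sup_left) (fix_anti le_sup_right)) fun g hg s x hx => ?_
  obtain ⟨y, hy, z, hz, rfl⟩ := Submodule.mem_sup.mp hx
  rw [map_add, hg.1 s y hy, hg.2 s z hz]

/-- The pair of subspaces spanned by one vector on the side `s`. -/
noncomputable def line (s : Bool) (x : Vec F) : Pair F := fun t => if t = s then Submodule.span F {x} else ⊥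

@[simp] theorem line_self (s : Bool) (x : Vec F) : line s x s = Submodule.span F {x} := by
  simp [line]

@[simp] theorem line_not (s : Bool) (x : Vec F) : line s x (!s) = ⊥ := by
  simp [line]

theorem line_le {s : Bool} {x : Vec F} {W : Pair F} : line s x ≤ W ↔ x ∈ W s := by
  constructor
  · intro h
    exact h s (by simp [Submodule.mem_span_singleton_self])
  · intro h t
    by_cases ht : t = s
    · subst ht
      simpa [line] using h
    · simp [line, ht]

theorem mem_fix_line {s : Bool} {x : Vec F} {g : GLinf F} : g ∈ fix (line s x) ↔ act s g x = x := by
  constructor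
  · intro h
    exact h s x (by simp [Submodule.mem_span_singleton_self])
  · intro h t y hy
    by_cases ht : t = s
    · subst ht
      rw [line_self] at hy
      obtain ⟨c, rfl⟩ := Submodule.mem_span_singleton.mp hy
      rw [map_smul, h]
    · simp only [line, ht, if_false, Submodule.mem_bot] at hy
      rw [hy, map_zero]

theorem mem_fix_sup_line {s : Bool} {x : Vec F} {g : GLinf F} {W : Pair F} :
    g ∈ fix (W ⊔ line s x) ↔ g ∈ fix W ∧ act s g x = x := by
  rw [fix_sup, Subgroup.mem_inf, mem_fix_line]

/-- The translate of a pair of subspaces. -/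
noncomputable def move (g : GLinf F) (W : Pair F) : Pair F := fun s => (W s).map (act s g).toLinearMap

theorem mem_move {g : GLinf F} {W : Pair F} {s : Bool} {x : Vec F} :
    x ∈ move g W s ↔ act s g⁻¹ x ∈ W s := by
  constructor
  · rintro ⟨y, hy, rfl⟩
    simpa using hy
  · intro h
    exact ⟨_, h, by simp⟩

theorem act_mem_move {g : GLinf F} {W : Pair F} {s : Bool} {x : Vec F} (h : x ∈ W s) :
    act s g x ∈ move g W s := ⟨x, h, rfl⟩

theorem move_le {g : GLinf F} {W W' : Pair F} :
    move g W ≤ W' ↔ ∀ s, ∀ x ∈ W s, act s g x ∈ W' s := by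
  constructor
  · exact fun h s x hx => h s (act_mem_move hx)
  · rintro h s _ ⟨x, hx, rfl⟩
    exact h s x hx

theorem move_le_iff {g : GLinf F} {W W' : Pair F} : move g W ≤ W' ↔ W ≤ move g⁻¹ W' := by
  rw [move_le]
  exact forall_congr' fun s => forall₂_congr fun x _ => by rw [mem_move, inv_inv]

theorem mem_fix_move {g h : GLinf F} {W : Pair F} : h ∈ fix (move g W) ↔ g⁻¹ * h * g ∈ fix W := by
  constructor
  · intro H s x hx
    rw [act_mul, act_mul, H s _ (act_mem_move hx), act_inv_act]
  · rintro H s _ ⟨x, hx, rfl⟩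
    have := congrArg (act s g) (H s x hx)
    rw [act_mul, act_mul, act_act_inv] at this
    exact this

/-- Both components are finitely generated. -/
def FG (W : Pair F) : Prop := ∀ s, (W s).FG

theorem FG.bot : FG (⊥ : Pair F) := fun _ => Submodule.fg_bot

theorem FG.sup {W W' : Pair F} (h : FG W) (h' : FG W') : FG (W ⊔ W') := fun s => (h s).sup (h' s)

theorem FG.line (s : Bool) (x : Vec F) : FG (line s x) := fun t => by
  by_cases ht : t = s
  · simpa [GLinf.line, ht] using Submodule.fg_span_singleton x
  · simpa [GLinf.line, ht] using Submodule.fg_bot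

theorem FG.move {W : Pair F} (h : FG W) (g : GLinf F) : FG (move g W) := fun s => (h s).map _

theorem FG.mono {W W' : Pair F} (h : FG W') (hle : W ≤ W') : FG W :=
  fun s => (h s).of_le (hle s)

theorem FG.finite [Finite F] {W : Pair F} (h : FG W) (s : Bool) : Finite (W s) := by
  have : Module.Finite F (W s) := Module.Finite.iff_fg.mpr (h s)
  exact Module.finite_of_finite F

/-- Induction on finitely generated pairs of subspaces, adding one vector at a time. -/
theorem FG.induction {P : Pair F → Prop} (bot : P ⊥)
    (sup : ∀ W s x, FG W → P W → P (W ⊔ GLinf.line s x)) (W : Pair F) (hW : FG W) : P W := by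
  classical
  have key (S : Finset (Bool × Vec F)) :
      FG (S.sup fun p => GLinf.line p.1 p.2) ∧ P (S.sup fun p => GLinf.line p.1 p.2) := by
    induction S using Finset.induction_on with
    | empty => simpa using ⟨FG.bot, bot⟩
    | insert p S hp ih =>
      rw [Finset.sup_insert, sup_comm]
      exact ⟨ih.1.sup (FG.line _ _), sup _ _ _ ih.1 ih.2⟩
  choose T hT using hW
  have e : W = (Finset.univ.sigma T |>.image fun p => (p.1, p.2)).sup
      fun p => GLinf.line p.1 p.2 := by
    refine le_antisymm (fun s => ?_) (Finset.sup_le fun p hp => ?_)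
    · rw [← hT s, Submodule.span_le]
      intro x hx
      refine line_le.mp ?_
      exact Finset.le_sup (f := fun p : Bool × Vec F => GLinf.line p.1 p.2) (b := (s, x)) (by
        simpa using hx)
    · rw [line_le, ← hT]
      refine Submodule.subset_span ?_
      obtain ⟨q, hq, rfl⟩ := Finset.mem_image.mp hp
      exact (Finset.mem_sigma.mp hq).2
  rw [e]
  exact (key _).2

/-! ### The standard finite-dimensional pieces -/

/-- The vectors supported on the first `n` coordinates. -/
def std (F : Type u) [Field F] (n : ℕ) : Submodule F (Vec F) where
  carrier := {x | ∀ k, n ≤ k → x k = 0}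
  zero_mem' := by simp
  add_mem' {x y} hx hy k hk := by simp [hx k hk, hy k hk]
  smul_mem' c x hx k hk := by simp [hx k hk]

theorem std_mono {m n : ℕ} (h : m ≤ n) : std F m ≤ std F n :=
  fun _ hx k hk => hx k (h.trans hk)

theorem exists_mem_std (x : Vec F) : ∃ n, x ∈ std F n := by
  classical
  refine ⟨x.support.sup id + 1, fun k hk => ?_⟩
  by_contra h
  have := Finset.le_sup (f := id) (Finsupp.mem_support_iff.mpr h)
  simp only [id] at this
  omega

theorem single_mem_std {n k : ℕ} (h : k < n) (c : F) : Finsupp.single k c ∈ std F n := by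
  intro j hj
  simp [show k ≠ j by omega]

/-- The pair of standard subspaces of dimension `n`. -/
def stdPair (F : Type u) [Field F] (n : ℕ) : Pair F := fun _ => std F n

theorem stdPair_mono {m n : ℕ} (h : m ≤ n) : stdPair F m ≤ stdPair F n := fun _ => std_mono h

theorem std_eq_span (n : ℕ) :
    std F n = Submodule.span F ((fun k => Finsupp.single k (1 : F)) '' (Finset.range n : Set ℕ)) := by
  refine le_antisymm (fun x hx => ?_) (Submodule.span_le.mpr ?_)
  · have h : x = ∑ k ∈ x.support, x k • Finsupp.single k (1 : F) := by
      conv_lhs => rw [← x.sum_single]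
      simp [Finsupp.sum]
    rw [h]
    refine Submodule.sum_mem _ fun k hk => Submodule.smul_mem _ _ (Submodule.subset_span ⟨k, ?_, rfl⟩)
    by_contra hc
    exact Finsupp.mem_support_iff.mp hk (hx k (by simpa using hc))
  · rintro _ ⟨k, hk, rfl⟩
    exact single_mem_std (by simpa using hk) 1

theorem FG.stdPair (n : ℕ) : FG (stdPair F n) := fun _ => by
  change (std F n).FG
  rw [std_eq_span]
  exact Submodule.fg_span ((Finset.finite_toSet _).image _)

theorem FG.exists_le_stdPair {W : Pair F} (hW : FG W) : ∃ n, W ≤ GLinf.stdPair F n := by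
  refine FG.induction (P := fun W => ∃ n, W ≤ GLinf.stdPair F n) ⟨0, bot_le⟩ ?_ W hW
  rintro W s x _ ⟨n, hn⟩
  obtain ⟨m, hm⟩ := exists_mem_std x
  exact ⟨max n m, sup_le (hn.trans (stdPair_mono (le_max_left _ _)))
    (line_le.mpr (std_mono (le_max_right _ _) hm))⟩

/-- The elements of the group that preserve all standard subspaces of dimension at least `n`. -/
def stab (F : Type u) [Field F] (n : ℕ) : Subgroup (GLinf F) where
  carrier := {g | ∀ m, n ≤ m → ∀ s x, act s g x ∈ std F m ↔ x ∈ std F m}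
  one_mem' := by simp
  mul_mem' {g h} hg hh m hm s x := by rw [act_mul, hg m hm, hh m hm]
  inv_mem' {g} hg m hm s x := by
    have := hg m hm s (act s g⁻¹ x)
    rw [act_act_inv] at this
    exact this.symm

theorem mem_stab {n : ℕ} {g : GLinf F} :
    g ∈ stab F n ↔ ∀ m, n ≤ m → ∀ s x, act s g x ∈ std F m ↔ x ∈ std F m := Iff.rfl

theorem move_stdPair {m n : ℕ} {g : GLinf F} (hg : g ∈ stab F n) (h : n ≤ m) :
    move g (stdPair F m) = stdPair F m := by
  funext s
  ext x
  rw [mem_move]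
  exact mem_stab.mp (inv_mem hg) m h s x

/-- Conjugation by an element preserving the standard subspaces preserves their stabilizers. -/
theorem conj_mem_fix_stdPair {m n : ℕ} {g h : GLinf F} (hg : g ∈ stab F n) (hm : n ≤ m) :
    g⁻¹ * h * g ∈ fix (stdPair F m) ↔ h ∈ fix (stdPair F m) := by
  rw [← mem_fix_move, move_stdPair hg hm]

/-! ### Extension of isometries -/

/-- Two vectors outside a subspace are detected by a common functional vanishing on it. -/
theorem exists_functional {V : Type*} [AddCommGroup V] [Module F V] (W : Submodule F V) (x x' : V)
    (hx : x ∉ W) (hx' : x' ∉ W) :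
    ∃ f : V →ₗ[F] F, (∀ w ∈ W, f w = 0) ∧ f x = 1 ∧ f x' ≠ 0 := by
  obtain ⟨f, hf, hfW⟩ := Submodule.exists_le_ker_of_notMem hx
  obtain ⟨f', hf', hfW'⟩ := Submodule.exists_le_ker_of_notMem hx'
  have : ∃ f : V →ₗ[F] F, (∀ w ∈ W, f w = 0) ∧ f x ≠ 0 ∧ f x' ≠ 0 := by
    by_cases h : f x' = 0
    · by_cases h' : f' x = 0
      · exact ⟨f + f', fun w hw => by simp [LinearMap.mem_ker.mp (hfW hw),
          LinearMap.mem_ker.mp (hfW' hw)], by simpa [h'] using hf, by simpa [h] using hf'⟩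
      · exact ⟨f', fun w hw => hfW' hw, h', hf'⟩
    · exact ⟨f, fun w hw => hfW hw, hf, h⟩
  obtain ⟨f, h1, h2, h3⟩ := this
  exact ⟨(f x)⁻¹ • f, fun w hw => by simp [h1 w hw], by simp [h2], by simp [h2, h3]⟩

/-- Functionals on a standard subspace are represented by the pairing. -/
theorem exists_representing (n : ℕ) (f : Vec F →ₗ[F] F) :
    ∃ δ ∈ std F n, ∀ x ∈ std F n, PairedSpace.infForm F x δ = f x := by
  refine ⟨∑ k ∈ Finset.range n, Finsupp.single k (f (Finsupp.single k 1)),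
    Submodule.sum_mem _ fun k hk => single_mem_std (by simpa using hk) _, fun x hx => ?_⟩
  rw [std_eq_span] at hx
  induction hx using Submodule.span_induction with
  | zero => simp
  | add x y _ _ hx hy => simp only [map_add, LinearMap.add_apply, hx, hy]
  | smul c x _ hx => simp only [map_smul, LinearMap.smul_apply, hx]
  | mem x hx =>
    obtain ⟨k, hk, rfl⟩ := hx
    rw [form_single_left, Finsupp.finsetSum_apply]
    simp only [Finsupp.single_apply]
    rw [Finset.sum_ite_eq']
    simp_all

/-- The transvection or dilatation `x ↦ x + ⟨x, δ⟩ d`. -/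
theorem exists_transvection (s : Bool) (d δ : Vec F) (h : 1 + PairedSpace.infForm F d δ ≠ 0) :
    ∃ g : GLinf F, (∀ x, act s g x = x + PairedSpace.infForm F x δ • d) ∧
      ∀ y, act (!s) g y =
        y + (-(1 + PairedSpace.infForm F d δ)⁻¹ * PairedSpace.infForm F d y) • δ := by
  set c := PairedSpace.infForm F d δ with hc
  -- With `φ d = c`, the map `x ↦ x + φ(x) d` scales `φ` by `1 + c`, so its inverse is `x ↦ x - (1 +
  -- c)⁻¹ φ(x) d`. The other side of `𝐕` carries the contragredient, which has this inverse form
  -- with `d` and `δ` exchanged.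
  have key (c : F) (hc : 1 + c ≠ 0) (r d : Vec F) (φ : Vec F →ₗ[F] F) (hφ : φ d = c) (x : Vec F) :
      (x + φ x • d) + (-(1 + c)⁻¹ * φ (x + φ x • d)) • d = x := by
    rw [map_add, map_smul, hφ, smul_eq_mul, show φ x + φ x * c = (1 + c) * φ x by ring,
      neg_mul, inv_mul_cancel_left₀ hc]
    module
  have key' (c : F) (hc : 1 + c ≠ 0) (r d : Vec F) (φ : Vec F →ₗ[F] F) (hφ : φ d = c) (x : Vec F) :
      (x + (-(1 + c)⁻¹ * φ x) • d) + φ (x + (-(1 + c)⁻¹ * φ x) • d) • d = x := by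
    rw [map_add, map_smul, hφ, smul_eq_mul, add_assoc, ← add_smul]
    have : (-(1 + c)⁻¹ * φ x) + (φ x + -(1 + c)⁻¹ * φ x * c) = 0 := by
      field_simp
      ring
    rw [this, zero_smul, add_zero]
  let B := PairedSpace.infForm F
  let T (φ : Vec F →ₗ[F] F) (d : Vec F) : Vec F →ₗ[F] Vec F := LinearMap.id + φ.smulRight d
  have hT (φ d x) : T φ d x = x + φ x • d := rfl
  let p : Vec F ≃ₗ[F] Vec F := LinearEquiv.ofLinearMap (T (B.flip δ) d) (T (-(1 + c)⁻¹ • B.flip δ) d)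
    (LinearMap.ext fun x => key' c h x d (B.flip δ) rfl x)
    (LinearMap.ext fun x => key c h x d (B.flip δ) rfl x)
  let r : Vec F ≃ₗ[F] Vec F := LinearEquiv.ofLinearMap (T (-(1 + c)⁻¹ • B d) δ) (T (B d) δ)
    (LinearMap.ext fun x => key c h x δ (B d) rfl x)
    (LinearMap.ext fun x => key' c h x δ (B d) rfl x)
  obtain ⟨g, hg, hg'⟩ := exists_act s p r fun x y => by
    change B (x + B x δ • d) (y + (-(1 + c)⁻¹ * B d y) • δ) = B x y
    have hBc : B d δ = c := rfl
    simp only [map_add, map_smul, LinearMap.add_apply, LinearMap.smul_apply, smul_eq_mul, hBc]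
    field_simp
    ring
  exact ⟨g, fun x => by rw [hg]; rfl, fun y => by rw [hg']; rfl⟩

/-- One step of Witt's extension theorem. -/
theorem exists_fix_act_eq {n : ℕ} {W : Pair F} (hW : W ≤ stdPair F n) {s : Bool} {x x' : Vec F}
    (hx : x ∈ std F n) (hx' : x' ∈ std F n) (hxW : x ∉ W s) (hxW' : x' ∉ W s)
    (h : ∀ y ∈ W (!s), PairedSpace.infForm F x y = PairedSpace.infForm F x' y) :
    ∃ g ∈ fix W, g ∈ stab F n ∧ act s g x = x' := by
  -- The map is `y ↦ y + f(y) (x' - x)`. It fixes `W s` because `f` vanishes there and sends `x` to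
  -- `x'` because `f x = 1`; it is invertible because `1 + f (x' - x) = f x'` is nonzero. On the
  -- other side it fixes what pairs to zero with `x' - x`, which is the hypothesis on pairings.
  obtain ⟨f, hf, hf1, hf'⟩ := exists_functional (W s) x x' hxW hxW'
  obtain ⟨δ, hδ, hδf⟩ := exists_representing n f
  have hd : x' - x ∈ std F n := sub_mem hx' hx
  obtain ⟨g, hg, hg'⟩ := exists_transvection s (x' - x) δ (by
    rw [hδf _ hd, map_sub, hf1]
    simpa using hf')
  have hs (t : Bool) : t = s ∨ t = !s := by cases t <;> cases s <;> simp
  refine ⟨g, fun t y hy => ?_, fun m hm t y => ?_, ?_⟩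
  · obtain rfl | rfl := hs t
    · rw [hg, hδf _ (hW _ hy), hf y hy, zero_smul, add_zero]
    · rw [hg', map_sub (PairedSpace.infForm F) x' x, LinearMap.sub_apply, LinearMap.sub_apply, h y hy]
      simp
  -- Both displacement vectors lie in `std F n`, so every larger standard subspace is preserved.
  · obtain rfl | rfl := hs t
    · rw [hg]
      exact Submodule.add_mem_iff_left _ (Submodule.smul_mem _ _ (std_mono hm hd))
    · rw [hg']
      exact Submodule.add_mem_iff_left _ (Submodule.smul_mem _ _ (std_mono hm hδ))
  · rw [hg, hδf x hx, hf1]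
    module

/-- Witt's extension theorem. -/
theorem exists_stab_eq {n : ℕ} (u : GLinf F) {W : Pair F} (hW : FG W) :
    W ≤ stdPair F n → move u W ≤ stdPair F n → ∃ h ∈ stab F n, h⁻¹ * u ∈ fix W := by
  refine FG.induction (P := fun W => W ≤ stdPair F n → move u W ≤ stdPair F n →
    ∃ h ∈ stab F n, h⁻¹ * u ∈ fix W) (fun _ _ => ⟨1, one_mem _, by simp⟩) ?_ W hW
  intro W s x _ ih h1 h2
  obtain ⟨h, hh, hu⟩ := ih (le_sup_left.trans h1)
    (move_le.mpr fun t y hy => move_le.mp h2 t y (le_sup_left (b := line s x) t hy))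
  have hxW : x ∈ (W ⊔ line s x) s := line_le.mp le_sup_right
  have hx : x ∈ std F n := h1 s hxW
  have hx' : act s (h⁻¹ * u) x ∈ std F n := by
    rw [act_mul]
    exact (mem_stab.mp (inv_mem hh) n le_rfl s _).mpr (move_le.mp h2 s x hxW)
  by_cases hm : x ∈ W s
  · exact ⟨h, hh, by rwa [sup_eq_left.mpr (line_le.mpr hm)]⟩
  -- The element `h` agrees with `u` on `W`. It is corrected by some `k` that fixes `W` and takes
  -- `x` to `h⁻¹ u x`; these two vectors pair alike with `W` because `h⁻¹ u` fixes `W`.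
  obtain ⟨k, hk, hk', hkx⟩ := exists_fix_act_eq (x' := act s (h⁻¹ * u) x)
    (le_sup_left.trans h1) hx hx' hm
    (fun hc => hm (by rwa [← (act_inv_act s _ x).symm.trans (inv_mem hu s _ hc)] at hc))
    (fun y hy => by rw [form_act_left, (inv_mem hu : _) _ y hy])
  refine ⟨h * k, mul_mem hh hk', ?_⟩
  rw [mem_fix_sup_line, mul_inv_rev, mul_assoc]
  exact ⟨mul_mem (inv_mem hk) hu, by rw [act_mul, ← hkx, act_inv_act]⟩

end GLinf

namespace GLinf

variable {F : Type u} [Field F]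

/-! ### Supports of open subgroups -/

theorem infForm_single_of_mem_std {n k : ℕ} (h : n ≤ k) {y : Vec F} (hy : y ∈ std F n) :
    PairedSpace.infForm F (Finsupp.single k 1) y = 0 := by
  rw [form_single_left, hy k h]

/-- Generic vectors are reached from a given one inside a pointwise stabilizer. -/
theorem exists_fix_act_eq_add_single {n k : ℕ} (hk : n ≤ k) {W : Pair F} (hW : W ≤ stdPair F n)
    {s : Bool} {x : Vec F} (hx : x ∈ std F n) (hxW : x ∉ W s) :
    ∃ g ∈ fix W, act s g x = x + Finsupp.single k 1 := by
  obtain ⟨g, hg, -, h⟩ := exists_fix_act_eq (n := k + 1) (x' := x + Finsupp.single k 1)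
    (hW.trans (stdPair_mono (by omega))) (std_mono (by omega) hx)
    (add_mem (std_mono (by omega) hx) (single_mem_std (by omega) 1)) hxW
    (fun hc => by
      have := hW s hc k hk
      simp [hx k hk] at this)
    (fun y hy => by
      rw [map_add, LinearMap.add_apply, infForm_single_of_mem_std hk (hW _ hy), add_zero])
  exact ⟨g, hg, h⟩

/-- A vector outside `W` is moved by some element of `fix W`, for instance by adding a basis vector
beyond all coordinates in use. So `W` can be recovered from `fix W`. -/
theorem le_of_fix_le {W W' : Pair F} (hW : FG W) (h : fix W ≤ fix W') : W' ≤ W := by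
  intro s x hx
  by_contra hc
  obtain ⟨n, hn⟩ := hW.exists_le_stdPair
  obtain ⟨m, hm⟩ := exists_mem_std x
  obtain ⟨g, hg, hgx⟩ := exists_fix_act_eq_add_single le_rfl
    (hn.trans (stdPair_mono (le_max_left n m))) (std_mono (le_max_right n m) hm) hc
  rw [h hg s x hx] at hgx
  simp at hgx

/-- If a subgroup contains the pointwise stabilizers of `W + ⟨x⟩` and of `W'`, where `x` is not
in `W + W'`, then it contains that of `W`. -/
theorem fix_le_of_fix_sup_line_le {U : Subgroup (GLinf F)} {W W' : Pair F} (hW : FG W)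
    (hW' : FG W') {s : Bool} {x : Vec F} (hx : x ∉ (W ⊔ W') s) (h : fix (W ⊔ line s x) ≤ U)
    (h' : fix W' ≤ U) : fix W ≤ U := by
  intro g hg
  obtain ⟨n, hn⟩ := ((hW.sup hW').sup ((FG.line s x).sup (FG.line s (act s g x)))).exists_le_stdPair
  have hWn : W ⊔ W' ≤ stdPair F n := le_sup_left.trans hn
  have hxn : x ∈ std F n := line_le.mp (le_sup_left.trans (le_sup_right.trans hn))
  have hzn : act s g x ∈ std F n := line_le.mp (le_sup_right.trans (le_sup_right.trans hn))
  have hxW : x ∉ W s := fun hc => hx (le_sup_left (b := W') s hc)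
  -- Two independent generic translates of `x` are reached by elements fixing `W + W'`, and these
  -- elements belong to `U` through `fix W'`.
  obtain ⟨k₁, hk₁, e₁⟩ := exists_fix_act_eq_add_single le_rfl hWn hxn hx
  obtain ⟨k₂, hk₂, e₂⟩ := exists_fix_act_eq_add_single (Nat.le_succ n) hWn hxn hx
  rw [fix_sup] at hk₁ hk₂
  set x₁ := x + Finsupp.single n 1 with hx₁
  set x₂ := x + Finsupp.single (n + 1) 1 with hx₂
  -- Conjugation by `k₂ ∈ U` replaces `x` by `x₂`.
  have hU₂ : fix (W ⊔ line s x₂) ≤ U := by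
    intro m hm
    rw [mem_fix_sup_line] at hm
    have : k₂⁻¹ * m * k₂ ∈ U := h (mem_fix_sup_line.mpr
      ⟨mul_mem (mul_mem (inv_mem hk₂.1) hm.1) hk₂.1, by
        rw [act_mul, act_mul, e₂, hm.2, ← e₂, act_inv_act]⟩)
    have := mul_mem (mul_mem (h' hk₂.2) this) (inv_mem (h' hk₂.2))
    simpa [mul_assoc] using this
  have hWs {w : Vec F} (hw : w ∈ W s) : w ∈ std F n := hWn s (le_sup_left (b := W') s hw)
  have hx₂n : x₂ ∈ std F (n + 2) :=
    add_mem (std_mono (by omega) hxn) (single_mem_std (by omega) 1)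
  have hx₁n : x₁ ∈ std F (n + 2) :=
    add_mem (std_mono (by omega) hxn) (single_mem_std (by omega) 1)
  have hz : act s g x ∉ W s := fun hc => hxW (by
    have := inv_mem hg s _ hc
    rw [act_inv_act] at this
    rwa [this])
  -- An element of `fix (W + ⟨x₂⟩) ≤ U` takes `x₁` to `g x`. Coordinate `n` shows that `x₁` is not
  -- in `W + ⟨x₂⟩`. Coordinate `n + 1` shows that if `g x` were in it, then `g x` would already be
  -- in `W`. Then `m k₁` and `g` agree on `W + ⟨x⟩`, which places `g` in `U`.
  obtain ⟨m, hm, -, e⟩ := exists_fix_act_eq (n := n + 2) (W := W ⊔ line s x₂) (s := s)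
    (x := x₁) (x' := act s g x)
    (sup_le ((le_sup_left.trans hWn).trans (stdPair_mono (by omega))) (line_le.mpr hx₂n))
    hx₁n (std_mono (by omega) hzn)
    (fun hc => by
      obtain ⟨w, hw, l, hl, hwl⟩ := Submodule.mem_sup.mp hc
      rw [line_self] at hl
      obtain ⟨c, rfl⟩ := Submodule.mem_span_singleton.mp hl
      have := DFunLike.congr_fun hwl n
      simp [hx₁, hx₂, hWs hw n le_rfl, hxn n le_rfl] at this)
    (fun hc => by
      obtain ⟨w, hw, l, hl, hwl⟩ := Submodule.mem_sup.mp hc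
      rw [line_self] at hl
      obtain ⟨c, rfl⟩ := Submodule.mem_span_singleton.mp hl
      have := DFunLike.congr_fun hwl (n + 1)
      have hc0 : c = 0 := by
        simpa [hx₂, hWs hw (n + 1) (by omega), hxn (n + 1) (by omega),
          hzn (n + 1) (by omega)] using this
      rw [hc0, zero_smul, add_zero] at hwl
      exact hz (hwl ▸ hw))
    (fun y hy => by
      have hy' : y ∈ W (!s) := by
        have : (W ⊔ line s x₂) (!s) = W (!s) ⊔ line s x₂ (!s) := rfl
        simpa [this] using hy
      rw [hx₁, map_add, LinearMap.add_apply,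
        infForm_single_of_mem_std le_rfl (hWn _ (le_sup_left (b := W') _ hy')), add_zero,
        form_act_left, inv_mem hg _ y hy'])
  have hmW := (mem_fix_sup_line.mp hm).1
  have : g⁻¹ * (m * k₁) ∈ U := h (mem_fix_sup_line.mpr
    ⟨mul_mem (inv_mem hg) (mul_mem hmW hk₁.1), by
      rw [act_mul, act_mul, e₁, e, act_inv_act]⟩)
  have := mul_mem (mul_mem (hU₂ hm) (h' hk₁.2)) (inv_mem this)
  simpa [mul_assoc] using this

/-- The group preserves the grading, so fixing a vector of `𝐕` amounts to fixing its two components,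
and fixing vectors amounts to fixing their span. -/
theorem fixingSubgroup_eq_fix (A : Finset (PairedSpace.inf F).total) :
    ∃ W : Pair F, FG W ∧ fixingSubgroup (GLinf F) (A : Set (PairedSpace.inf F).total) = fix W := by
  classical
  induction A using Finset.induction_on with
  | empty => exact ⟨⊥, FG.bot, by simp⟩
  | insert p A _ ih =>
    obtain ⟨W, hW, e⟩ := ih
    let x : Vec F := p.1
    let y : Vec F := p.2
    refine ⟨W ⊔ (line true x ⊔ line false y), hW.sup ((FG.line _ _).sup (FG.line _ _)), ?_⟩
    ext g
    have hp : g • p = p ↔ act true g x = x ∧ act false g y = y := Prod.ext_iff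
    rw [fix_sup, fix_sup, Subgroup.mem_inf, Subgroup.mem_inf, mem_fix_line, mem_fix_line, ← hp,
      ← e, mem_fixingSubgroup_iff, mem_fixingSubgroup_iff, Finset.coe_insert, Set.forall_mem_insert]
    exact and_comm

theorem fix_eq_fixingSubgroup {W : Pair F} (hW : FG W) :
    ∃ A : Finset (PairedSpace.inf F).total,
      fix W = fixingSubgroup (GLinf F) (A : Set (PairedSpace.inf F).total) := by
  classical
  refine FG.induction (P := fun W => ∃ A : Finset (PairedSpace.inf F).total,
      fix W = fixingSubgroup (GLinf F) (A : Set (PairedSpace.inf F).total))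
      ⟨∅, by simp⟩ ?_ W hW
  rintro W s x - ⟨A, hA⟩
  let p : (PairedSpace.inf F).total := match s with
    | true => (x, (0 : Vec F))
    | false => ((0 : Vec F), x)
  have hp (g : GLinf F) : g • p = p ↔ act s g x = x := by
    cases s
    · exact Prod.ext_iff.trans ⟨fun h => h.2, fun h => ⟨map_zero (act true g), h⟩⟩
    · exact Prod.ext_iff.trans ⟨fun h => h.1, fun h => ⟨h, map_zero (act false g)⟩⟩
  refine ⟨insert p A, ?_⟩
  ext g
  rw [mem_fix_sup_line, hA, ← hp, mem_fixingSubgroup_iff, mem_fixingSubgroup_iff,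
    Finset.coe_insert, Set.forall_mem_insert]
  exact and_comm

theorem mem_pointClass {U : Subgroup (GLinf F)} : U ∈ pointClass F ↔ ∃ W, FG W ∧ U = fix W := by
  constructor
  · rintro ⟨A, rfl⟩
    exact fixingSubgroup_eq_fix A
  · rintro ⟨W, hW, rfl⟩
    exact fix_eq_fixingSubgroup hW

theorem fix_mem_pointClass {W : Pair F} (hW : FG W) : fix W ∈ pointClass F :=
  mem_pointClass.mpr ⟨W, hW, rfl⟩

theorem mem_openClass {U : Subgroup (GLinf F)} : U ∈ openClass F ↔ ∃ W, FG W ∧ fix W ≤ U := by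
  constructor
  · rintro ⟨A, hA⟩
    obtain ⟨W, hW, e⟩ := fixingSubgroup_eq_fix A
    exact ⟨W, hW, e ▸ hA⟩
  · rintro ⟨W, hW, h⟩
    obtain ⟨A, hA⟩ := fix_eq_fixingSubgroup hW
    exact ⟨A, hA ▸ h⟩

/-- `W` is the least pair of finite-dimensional subspaces whose pointwise stabilizer is contained
in `U`. -/
structure IsSupport (U : Subgroup (GLinf F)) (W : Pair F) : Prop where
  fg : FG W
  fix_le : fix W ≤ U
  least : ∀ W', FG W' → fix W' ≤ U → W ≤ W'

/-- Take `W` of least total dimension with `fix W ≤ U`. If `fix W' ≤ U` but some `x` in `W` is not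
in `W'`, a functional that vanishes on `W'` and not at `x` cuts out a hyperplane `W₁` of `W` on the
side of `x`. Then `W = W₁ + ⟨x⟩` and `x` is not in `W₁ + W'`, so `fix_le_of_fix_sup_line_le` gives
`fix W₁ ≤ U`, against minimality. -/
theorem exists_isSupport {U : Subgroup (GLinf F)} (hU : U ∈ openClass F) : ∃ W, IsSupport U W := by
  classical
  let rk (W : Pair F) : ℕ := Module.finrank F (W true) + Module.finrank F (W false)
  have hex : ∃ n, ∃ W, FG W ∧ fix W ≤ U ∧ rk W = n := by
    obtain ⟨W, h1, h2⟩ := mem_openClass.mp hU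
    exact ⟨_, W, h1, h2, rfl⟩
  obtain ⟨W, h1, h2, h3⟩ := Nat.find_spec hex
  refine ⟨W, h1, h2, fun W' hW' h' => ?_⟩
  by_contra hc
  obtain ⟨s, hs⟩ : ∃ s, ¬ W s ≤ W' s := not_forall.mp hc
  obtain ⟨x, hx, hx'⟩ := SetLike.not_le_iff_exists.mp hs
  obtain ⟨f, hf, hfW'⟩ := Submodule.exists_le_ker_of_notMem hx'
  let W₁ : Pair F := Function.update W s (W s ⊓ f.ker)
  have hs₁ : W₁ s = W s ⊓ f.ker := by simp [W₁]
  have hns : W₁ (!s) = W (!s) := by simp [W₁]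
  have hle : W₁ ≤ W := by
    intro t
    by_cases ht : t = s
    · subst ht
      rw [hs₁]
      exact inf_le_left
    · simp [W₁, ht]
  have hW₁ : FG W₁ := h1.mono hle
  have hsup : W₁ ⊔ line s x = W := by
    refine le_antisymm (sup_le hle (line_le.mpr hx)) fun t v hv => ?_
    by_cases ht : t = s
    · subst ht
      refine Submodule.mem_sup.mpr ⟨v - (f v / f x) • x, ?_, (f v / f x) • x, ?_, by simp⟩
      · rw [hs₁]
        refine ⟨sub_mem hv (Submodule.smul_mem _ _ hx), ?_⟩
        change f _ = 0
        rw [map_sub, map_smul, smul_eq_mul, div_mul_cancel₀ _ hf, sub_self]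
      · rw [line_self]
        exact Submodule.smul_mem _ _ (Submodule.mem_span_singleton_self x)
    · refine le_sup_left (a := W₁) (b := line s x) t ?_
      simpa [W₁, ht] using hv
  have hfix : fix W₁ ≤ U := fix_le_of_fix_sup_line_le hW₁ hW' (s := s) (x := x)
    (fun hc => by
      have : (W₁ ⊔ W') s ≤ f.ker := sup_le (hs₁ ▸ inf_le_right) hfW'
      exact hf (this hc)) (by rwa [hsup]) h'
  have hlt : rk W₁ < rk W := by
    have : Module.Finite F (W s) := Module.Finite.iff_fg.mpr (h1 s)
    have hlt : Module.finrank F (W₁ s) < Module.finrank F (W s) := by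
      refine Submodule.finrank_lt_finrank_of_lt (lt_of_le_of_ne (hle s) fun he => ?_)
      rw [← he, hs₁] at hx
      exact hf hx.2
    have hns' := congrArg (fun V : Submodule F (Vec F) => Module.finrank F V) hns
    change Module.finrank F _ + Module.finrank F _ < Module.finrank F _ + Module.finrank F _
    cases s
    · exact Nat.add_lt_add_of_le_of_lt hns'.le hlt
    · exact Nat.add_lt_add_of_lt_of_le hlt hns'.le
  exact Nat.find_min hex (h3 ▸ hlt) ⟨W₁, hW₁, hfix, rfl⟩

theorem fix_move_le_iff {U : Subgroup (GLinf F)} {W : Pair F} {g : GLinf F} (hg : g ∈ U) :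
    fix (move g W) ≤ U ↔ fix W ≤ U := by
  constructor
  · intro h k hk
    have : g * k * g⁻¹ ∈ U := h (mem_fix_move.mpr (by simpa [mul_assoc] using hk))
    have := mul_mem (mul_mem (inv_mem hg) this) hg
    simpa [mul_assoc] using this
  · intro h k hk
    have := mul_mem (mul_mem hg (h (mem_fix_move.mp hk))) (inv_mem hg)
    simpa [mul_assoc] using this

/-- Conjugation by `g ∈ U` preserves `U`, so leastness gives `W ≤ g W`; the same for `g⁻¹` gives the
reverse inclusion. -/
theorem IsSupport.move_eq {U : Subgroup (GLinf F)} {W : Pair F} (h : IsSupport U W) {g : GLinf F}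
    (hg : g ∈ U) : move g W = W := by
  have key (k : GLinf F) (hk : k ∈ U) : W ≤ move k W :=
    h.least _ (h.fg.move k) ((fix_move_le_iff hk).mpr h.fix_le)
  refine le_antisymm ?_ (key g hg)
  exact move_le_iff.mpr (key g⁻¹ (inv_mem hg))

theorem IsSupport.conj_mem {U : Subgroup (GLinf F)} {W : Pair F} (h : IsSupport U W)
    {g k : GLinf F} (hg : g ∈ U) (hk : k ∈ fix W) : g⁻¹ * k * g ∈ fix W := by
  rwa [← mem_fix_move, h.move_eq hg]

/-- The pointwise stabilizer of the support has finite index. -/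
theorem IsSupport.finite_quotient [Finite F] {U : Subgroup (GLinf F)} {W : Pair F}
    (h : IsSupport U W) : Finite (U ⧸ (fix W).subgroupOf U) := by
  have (s : Bool) : Finite (W s) := h.fg.finite s
  -- `U` acts on the finite sets `W s`, and a coset of `fix W` is determined by its action there.
  refine Finite.of_injective (β := ∀ s, W s → W s)
    (fun c s w => ⟨act s (c.out : U) w, by
      have := act_mem_move (g := (c.out : U)) w.2
      rwa [h.move_eq (c.out : U).2] at this⟩) fun c c' hc => ?_
  rw [← c.out_eq, ← c'.out_eq]
  refine QuotientGroup.eq.mpr (Subgroup.mem_subgroupOf.mpr fun s x hx => ?_)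
  have : act s (c.out : U) x = act s (c'.out : U) x :=
    congrArg Subtype.val (congrFun (congrFun hc s) ⟨x, hx⟩)
  rw [Subgroup.coe_mul, Subgroup.coe_inv, act_mul, ← this, act_inv_act]

end GLinf

/-! ## Generalities on finitary sets and measures -/

namespace HatSet

variable {G : Type u} [Group G] {E : Set (Subgroup G)}

open Classical in
/-- The action of `g : G` on a `Ĝ`-set, extended by the identity outside its group of definition. -/
noncomputable def sm (X : HatSet E) (g : G) (x : X.carrier) : X.carrier :=
  if h : g ∈ X.grp then (⟨g, h⟩ : X.grp) • x else x

variable {X Y : HatSet E}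

theorem sm_of_mem {g : G} (h : g ∈ X.grp) (x : X.carrier) : X.sm g x = (⟨g, h⟩ : X.grp) • x :=
  dif_pos h

theorem sm_coe (g : X.grp) (x : X.carrier) : X.sm g x = g • x := sm_of_mem g.2 x

theorem sm_mul {g h : G} (hg : g ∈ X.grp) (hh : h ∈ X.grp) (x : X.carrier) :
    X.sm (g * h) x = X.sm g (X.sm h x) := by
  rw [sm_of_mem hg, sm_of_mem hh, sm_of_mem (mul_mem hg hh), smul_smul]
  rfl

@[simp] theorem sm_one (x : X.carrier) : X.sm 1 x = x := by
  rw [sm_of_mem (one_mem _)]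
  exact one_smul X.grp x

theorem sm_inv_sm {g : G} (hg : g ∈ X.grp) (x : X.carrier) : X.sm g⁻¹ (X.sm g x) = x := by
  rw [← sm_mul (inv_mem hg) hg, inv_mul_cancel, sm_one]

theorem sm_sm_inv {g : G} (hg : g ∈ X.grp) (x : X.carrier) : X.sm g (X.sm g⁻¹ x) = x := by
  rw [← sm_mul hg (inv_mem hg), mul_inv_cancel, sm_one]

theorem EquivariantOn.sm {W : Subgroup G} {f : X.carrier → Y.carrier}
    (h : EquivariantOn W f) {w : G} (hw : w ∈ W) (x : X.carrier) : f (X.sm w x) = Y.sm w (f x) := by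
  rw [sm_of_mem (h.1 hw), sm_of_mem (h.2.1 hw), h.2.2 w _ _ hw]

theorem equivariantOn_iff {W : Subgroup G} {f : X.carrier → Y.carrier} :
    EquivariantOn W f ↔ W ≤ X.grp ∧ W ≤ Y.grp ∧ ∀ w ∈ W, ∀ x, f (X.sm w x) = Y.sm w (f x) := by
  refine ⟨fun h => ⟨h.1, h.2.1, fun w hw x => h.sm hw x⟩, fun h => ⟨h.1, h.2.1, ?_⟩⟩
  intro w hX hY hw x
  rw [← sm_of_mem hX, ← sm_of_mem hY, h.2.2 w hw]

/-- The stabilizer of a point, as a subgroup of `G`. -/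
def stb (X : HatSet E) (x : X.carrier) : Subgroup G :=
  (MulAction.stabilizer X.grp x).map X.grp.subtype

theorem mem_stb {x : X.carrier} {g : G} : g ∈ X.stb x ↔ g ∈ X.grp ∧ X.sm g x = x := by
  constructor
  · rintro ⟨g, hg, rfl⟩
    exact ⟨g.2, (sm_coe g x).trans hg⟩
  · rintro ⟨h, hx⟩
    exact ⟨⟨g, h⟩, (sm_of_mem h x).symm.trans hx, rfl⟩

theorem stb_le (x : X.carrier) : X.stb x ≤ X.grp := fun _ h => (mem_stb.mp h).1

theorem stb_mem (x : X.carrier) : X.stb x ∈ E := X.smooth x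

theorem conj_mem_stb {x : X.carrier} {g h : G} (hg : g ∈ X.grp) :
    h ∈ X.stb (X.sm g x) ↔ g⁻¹ * h * g ∈ X.stb x := by
  have e : g⁻¹ * h * g ∈ X.grp ↔ h ∈ X.grp := by
    rw [Subgroup.mul_mem_cancel_right _ hg, Subgroup.mul_mem_cancel_left _ (inv_mem hg)]
  rw [mem_stb, mem_stb, e]
  refine and_congr_right fun hh => ?_
  rw [sm_mul (mul_mem (inv_mem hg) hh) hg, sm_mul (inv_mem hg) hh]
  constructor
  · intro H
    rw [H, sm_inv_sm hg]
  · intro H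
    conv_rhs => rw [← H]
    rw [sm_sm_inv hg]

theorem IsTransitive.exists_sm (h : X.IsTransitive) (x y : X.carrier) :
    ∃ g ∈ X.grp, X.sm g x = y := by
  obtain ⟨g, hg⟩ := h.2.exists_smul_eq x y
  exact ⟨g, g.2, (sm_coe g x).trans hg⟩

theorem isTransitive_of_exists (x : X.carrier) (h : ∀ y, ∃ g ∈ X.grp, X.sm g x = y) :
    X.IsTransitive := by
  refine ⟨⟨x⟩, MulAction.isPretransitive_iff_base x |>.mpr fun y => ?_⟩
  obtain ⟨g, hg, e⟩ := h y
  exact ⟨⟨g, hg⟩, (sm_of_mem hg x).symm.trans e⟩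

/-! ### Invariant subsets -/

/-- An invariant subset of a `Ĝ`-set. -/
def sub (X : HatSet E) (s : Set X.carrier) (hs : ∀ (g : X.grp), ∀ x ∈ s, g • x ∈ s) : HatSet E where
  grp := X.grp
  grp_mem := X.grp_mem
  carrier := s
  act :=
    { smul := fun g x => ⟨g • x.1, hs g x.1 x.2⟩
      one_smul := fun x => Subtype.ext (one_smul X.grp x.1)
      mul_smul := fun g h x => Subtype.ext (mul_smul g h x.1) }
  smooth x := by
    refine (congrArg (· ∈ E) (congrArg (Subgroup.map X.grp.subtype) ?_)).mp (X.smooth x.1)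
    ext g
    exact (Subtype.ext_iff (a1 := (⟨g • x.1, hs g x.1 x.2⟩ : s)) (a2 := x)).symm
  finitary := by
    let _ : MulAction X.grp s :=
      { smul := fun g x => ⟨g • x.1, hs g x.1 x.2⟩
        one_smul := fun x => Subtype.ext (one_smul X.grp x.1)
        mul_smul := fun g h x => Subtype.ext (mul_smul g h x.1) }
    have := X.finitary
    refine Finite.of_injective (β := MulAction.orbitRel.Quotient X.grp X.carrier)
      (fun c => Quotient.mk _ (Quotient.out c : s).1) fun c c' h => ?_
    rw [← c.out_eq, ← c'.out_eq]
    obtain ⟨g, hg⟩ := MulAction.orbitRel_apply.mp (Quotient.exact h)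
    exact Quotient.sound (MulAction.orbitRel_apply.mpr ⟨g, Subtype.ext hg⟩)

section sub

variable {s : Set X.carrier} {hs : ∀ (g : X.grp), ∀ x ∈ s, g • x ∈ s}

theorem sub_sm {g : G} (hg : g ∈ X.grp) (x : (X.sub s hs).carrier) :
    ((X.sub s hs).sm g x).1 = X.sm g x.1 := by
  rw [sm_of_mem hg, sm_of_mem (X := X.sub s hs) hg]
  rfl

theorem sub_stb (x : (X.sub s hs).carrier) : (X.sub s hs).stb x = X.stb x.1 := by
  ext g
  rw [mem_stb, mem_stb]
  refine and_congr_right fun hg => ?_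
  rw [← sub_sm (hs := hs) hg x]
  exact Subtype.ext_iff

variable {s' : Set X.carrier} {hs' : ∀ (g : X.grp), ∀ x ∈ s', g • x ∈ s'}

theorem isHatMap_of_val (f : (X.sub s hs).carrier → (X.sub s' hs').carrier)
    (hf : ∀ x, (f x).1 = x.1) : IsHatMap f := by
  refine ⟨X.grp, X.grp_mem, equivariantOn_iff.mpr ⟨le_rfl, le_rfl, fun w hw x => Subtype.ext ?_⟩⟩
  rw [hf, sub_sm hw, sub_sm hw, hf]

theorem iso_sub (hs' : ∀ x, x ∈ s) : X.Iso (X.sub s hs) := by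
  refine ⟨⟨fun x => ⟨x, hs' x⟩, fun x => x.1, fun _ => rfl, fun _ => rfl⟩, X.grp, X.grp_mem,
    equivariantOn_iff.mpr ⟨le_rfl, le_rfl, fun w hw x => Subtype.ext ?_⟩⟩
  rw [sub_sm hw]
  rfl

end sub

/-! ### Coset spaces -/

/-- A class of subgroups stable under conjugation. -/
def ConjStable (E : Set (Subgroup G)) : Prop :=
  ∀ U ∈ E, ∀ (g : G) (V : Subgroup G), (∀ h, h ∈ V ↔ g⁻¹ * h * g ∈ U) → V ∈ E

variable {U V W : Subgroup G}

/-- The transitive `Ĝ`-set `U / V`. -/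
def coset (hE : ConjStable E) (hU : U ∈ E) (hV : V ∈ E) (hVU : V ≤ U) : HatSet E where
  grp := U
  grp_mem := hU
  carrier := U ⧸ V.subgroupOf U
  smooth x := by
    obtain ⟨g, rfl⟩ := QuotientGroup.mk_surjective x
    -- The stabilizer of the coset `gV` is `gVg⁻¹`; this is where stability under conjugation
    -- enters.
    refine hE V hV g _ fun h => ?_
    constructor
    · rintro ⟨h, hh, rfl⟩
      have := QuotientGroup.eq.mp (Eq.symm hh)
      have : (g⁻¹ * (h * g) : U) ∈ V.subgroupOf U := this
      rw [Subgroup.mem_subgroupOf] at this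
      simpa [mul_assoc] using this
    · intro hh
      have hhU : h ∈ U := by
        have := mul_mem (mul_mem g.2 (hVU hh)) (inv_mem g.2)
        simpa [mul_assoc] using this
      refine ⟨⟨h, hhU⟩, Eq.symm (QuotientGroup.eq.mpr ?_), rfl⟩
      change (g⁻¹ * (⟨h, hhU⟩ * g) : U) ∈ V.subgroupOf U
      rw [Subgroup.mem_subgroupOf]
      simpa [mul_assoc] using hh
  finitary := by
    refine Finite.of_surjective (α := Unit) (fun _ => Quotient.mk _ (QuotientGroup.mk 1)) ?_
    intro c
    induction c using Quotient.inductionOn with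
    | h x =>
      obtain ⟨g, rfl⟩ := QuotientGroup.mk_surjective x
      refine ⟨(), Quotient.sound (MulAction.orbitRel_apply.mpr ⟨g⁻¹, ?_⟩)⟩
      exact congrArg QuotientGroup.mk (inv_mul_cancel g)

section coset

variable (hE : ConjStable E) (hU : U ∈ E) (hV : V ∈ E) (hVU : V ≤ U)

theorem coset_sm {g : G} (hg : g ∈ U) (h : U) :
    (coset hE hU hV hVU).sm g (QuotientGroup.mk h : U ⧸ V.subgroupOf U) =
      (QuotientGroup.mk ((⟨g, hg⟩ : U) * h) : U ⧸ V.subgroupOf U) :=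
  sm_of_mem (X := coset hE hU hV hVU) hg _

theorem coset_isTransitive : (coset hE hU hV hVU).IsTransitive := by
  refine isTransitive_of_exists (QuotientGroup.mk 1 : U ⧸ V.subgroupOf U) fun y => ?_
  obtain ⟨g, rfl⟩ := QuotientGroup.mk_surjective y
  exact ⟨g, g.2, (coset_sm hE hU hV hVU g.2 1).trans (congrArg _ (mul_one g))⟩

/-- The fiber of `U/W → U/V` over the base coset is `V/W`. The fiber axiom thereby becomes
multiplicativity along chains of subgroups. -/
theorem coset_isFiber (hW : W ∈ E) (hWV : W ≤ V) :
    (coset hE hV hW hWV).IsFiber (coset hE hU hW (hWV.trans hVU)) (coset hE hU hV hVU) := by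
  refine ⟨rfl, coset_isTransitive .., coset_isTransitive .., ?_⟩
  have hle : W.subgroupOf U ≤ V.subgroupOf U := fun x hx => hWV hx
  let f : U ⧸ W.subgroupOf U → U ⧸ V.subgroupOf U := Subgroup.quotientMapOfLE hle
  let j : V ⧸ W.subgroupOf V → U ⧸ W.subgroupOf U :=
    Quotient.map' (Subgroup.inclusion hVU) fun a b h => by
      rw [QuotientGroup.leftRel_apply] at h ⊢
      exact h
  refine ⟨f, equivariantOn_iff.mpr ⟨le_rfl, le_rfl, fun w hw x => ?_⟩,
    (QuotientGroup.mk 1 : U ⧸ V.subgroupOf U), j, ⟨V, hV, equivariantOn_iff.mpr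
      ⟨le_rfl, hVU, fun w hw x => ?_⟩⟩, ?_, ?_⟩
  · obtain ⟨g, rfl⟩ := QuotientGroup.mk_surjective x
    have h1 := coset_sm hE hU hW (hWV.trans hVU) hw g
    have h2 := coset_sm hE hU hV hVU hw g
    exact (congrArg f h1).trans h2.symm
  · obtain ⟨g, rfl⟩ := QuotientGroup.mk_surjective x
    have h1 := coset_sm hE hV hW hWV hw g
    have h2 := coset_sm hE hU hW (hWV.trans hVU) (hVU hw) (Subgroup.inclusion hVU g)
    exact (congrArg j h1).trans h2.symm
  · intro a b hab
    obtain ⟨a, rfl⟩ := QuotientGroup.mk_surjective a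
    obtain ⟨b, rfl⟩ := QuotientGroup.mk_surjective b
    exact QuotientGroup.eq.mpr (show (a⁻¹ * b : V) ∈ W.subgroupOf V from
      (QuotientGroup.eq.mp hab : _))
  · ext y
    obtain ⟨g, rfl⟩ := QuotientGroup.mk_surjective y
    constructor
    · rintro ⟨a, ha⟩
      obtain ⟨a, rfl⟩ := QuotientGroup.mk_surjective a
      have h1 := congrArg f ha
      refine h1.symm.trans (Eq.symm (QuotientGroup.eq.mpr ?_))
      rw [Subgroup.mem_subgroupOf]
      simp
    · intro h
      have h1 := QuotientGroup.eq.mp (Eq.symm h)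
      rw [Subgroup.mem_subgroupOf] at h1
      refine ⟨(QuotientGroup.mk (⟨g, by simpa using h1⟩ : V) : V ⧸ W.subgroupOf V), ?_⟩
      rfl

end coset

/-- A transitive `Ĝ`-set is the space of cosets of the stabilizer of a point. -/
theorem iso_coset (hE : ConjStable E) (hV : V ∈ E) (hVU : V ≤ X.grp) (h : X.IsTransitive)
    (x : X.carrier) (hx : X.stb x = V) : (coset hE X.grp_mem hV hVU).Iso X := by
  subst hx
  have key (a b : X.grp) :
      (a : X.grp) • x = b • x ↔ a⁻¹ * b ∈ (X.stb x).subgroupOf X.grp := by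
    rw [Subgroup.mem_subgroupOf, mem_stb, sm_coe, mul_smul, inv_smul_eq_iff]
    exact ⟨fun h => ⟨(a⁻¹ * b).2, h.symm⟩, fun h => h.2.symm⟩
  let f : X.grp ⧸ (X.stb x).subgroupOf X.grp → X.carrier :=
    Quotient.lift (fun g => g • x) fun a b hab =>
      (key a b).mpr (QuotientGroup.leftRel_apply.mp hab)
  have hf : Function.Bijective f := by
    constructor
    · intro a b hab
      obtain ⟨a, rfl⟩ := QuotientGroup.mk_surjective a
      obtain ⟨b, rfl⟩ := QuotientGroup.mk_surjective b
      exact QuotientGroup.eq.mpr ((key a b).mp hab)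
    · intro y
      obtain ⟨g, hg⟩ := h.2.exists_smul_eq x y
      exact ⟨QuotientGroup.mk g, hg⟩
  refine ⟨Equiv.ofBijective f hf, X.grp, X.grp_mem,
    equivariantOn_iff.mpr ⟨le_rfl, le_rfl, fun w hw y => ?_⟩⟩
  obtain ⟨g, rfl⟩ := QuotientGroup.mk_surjective y
  refine (congrArg f (coset_sm hE X.grp_mem hV hVU hw g)).trans ?_
  exact (mul_smul _ _ _).trans (sm_of_mem hw _).symm

/-- A finite set with the trivial action. -/
def triv (hU : U ∈ E) (α : Type u) [Finite α] : HatSet E where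
  grp := U
  grp_mem := hU
  carrier := α
  act :=
    { smul := fun _ x => x
      one_smul := fun _ => rfl
      mul_smul := fun _ _ _ => rfl }
  smooth x := by
    refine (congrArg (· ∈ E) ?_).mp hU
    ext g
    exact ⟨fun hg => ⟨⟨g, hg⟩, rfl, rfl⟩, by rintro ⟨g, -, rfl⟩; exact g.2⟩
  finitary := by
    let _ : MulAction U α :=
      { smul := fun _ x => x
        one_smul := fun _ => rfl
        mul_smul := fun _ _ _ => rfl }
    exact Quotient.finite _

end HatSet

namespace HatSet

variable {G : Type u} [Group G] {E E' : Set (Subgroup G)} {X Y : HatSet E}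

theorem IsHatMap.ofSubset (h : E ⊆ E') {f : X.carrier → Y.carrier} (hf : IsHatMap f) :
    IsHatMap (X := X.ofSubset h) (Y := Y.ofSubset h) f := by
  obtain ⟨W, hW, H⟩ := hf
  exact ⟨W, h hW, H⟩

end HatSet

/-! ### General properties of measures -/

namespace IsMeasure

open HatSet

variable {G : Type u} [Group G] {E E' : Set (Subgroup G)} {k : Type v} [CommRing k]
  {μ : HatSet E → k} {X : HatSet E}

theorem comp {k' : Type*} [CommRing k'] (hμ : IsMeasure μ) (f : k →+* k') :
    IsMeasure fun X => f (μ X) where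
  iso X Y h := by rw [hμ.iso X Y h]
  singleton X h := by rw [hμ.singleton X h, map_one]
  coprod Z X Y h := by rw [hμ.coprod Z X Y h, map_add]
  twist g X Y h := by rw [hμ.twist g X Y h]
  fiber A Y X h := by rw [hμ.fiber A Y X h, map_mul]

/-- Two measures with values in the same ring agree exactly where the pair lies in the diagonal
subring. Uniqueness statements are thus special cases of statements that all values lie in a given
subring. -/
theorem prod {k' : Type*} [CommRing k'] {μ' : HatSet E → k'} (hμ : IsMeasure μ)
    (hμ' : IsMeasure μ') : IsMeasure fun X => (μ X, μ' X) where
  iso X Y h := by rw [hμ.iso X Y h, hμ'.iso X Y h]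
  singleton X h := by rw [hμ.singleton X h, hμ'.singleton X h, Prod.mk_one_one]
  coprod Z X Y h := by rw [hμ.coprod Z X Y h, hμ'.coprod Z X Y h, Prod.mk_add_mk]
  twist g X Y h := by rw [hμ.twist g X Y h, hμ'.twist g X Y h]
  fiber A Y X h := by rw [hμ.fiber A Y X h, hμ'.fiber A Y X h, Prod.mk_mul_mk]

theorem ofSubset {μ : HatSet E' → k} (hμ : IsMeasure μ) (h : E ⊆ E') :
    IsMeasure fun X : HatSet E => μ (X.ofSubset h) where
  iso _ _ := fun ⟨f, hf⟩ => hμ.iso _ _ ⟨f, hf.ofSubset h⟩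
  singleton _ hX := hμ.singleton _ hX
  coprod _ _ _ := fun ⟨f, hf, hf'⟩ => hμ.coprod _ _ _ ⟨f, hf.ofSubset h, hf'.ofSubset h⟩
  twist g _ _ hX := hμ.twist g _ _ hX
  fiber _ _ _ := fun ⟨h1, h2, h3, f, hf, x, j, hj, hj'⟩ =>
    hμ.fiber _ _ _ ⟨h1, h2, h3, f, hf, x, j, hj.ofSubset h, hj'⟩

/-- An empty set is the disjoint union of two copies of itself. -/
theorem empty (hμ : IsMeasure μ) (hX : IsEmpty X.carrier) : μ X = 0 := by
  have := hμ.coprod X X X ⟨Equiv.equivOfIsEmpty _ _,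
    ⟨X.grp, X.grp_mem, equivariantOn_iff.mpr ⟨le_rfl, le_rfl, fun _ _ x => isEmptyElim x⟩⟩,
    ⟨X.grp, X.grp_mem, equivariantOn_iff.mpr ⟨le_rfl, le_rfl, fun _ _ x => isEmptyElim x⟩⟩⟩
  simpa using this

/-- A measure is additive over the fibers of an invariant function with finitely many values. -/
theorem eq_sum_sub (hμ : IsMeasure μ) {ι : Type*} [Fintype ι] (p : X.carrier → ι)
    (hp : ∀ (g : X.grp) x, p (g • x) = p x) :
    μ X = ∑ i, μ (X.sub (p ⁻¹' {i}) fun g x hx => (hp g x).trans hx) := by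
  classical
  -- The induction is over finite sets of values, splitting off one fiber at a time by the axiom for
  -- binary disjoint unions.
  have key (T : Finset ι) : μ (X.sub (p ⁻¹' T) fun g x hx => by
      rw [Set.mem_preimage, hp]
      exact hx) = ∑ i ∈ T, μ (X.sub (p ⁻¹' {i}) fun g x hx => (hp g x).trans hx) := by
    induction T using Finset.induction_on with
    | empty => exact hμ.empty ⟨fun x => by simpa using x.2⟩
    | insert i T hi ih =>
      rw [Finset.sum_insert hi, ← ih]
      refine hμ.coprod _ _ _ ⟨Equiv.ofBijective (Sum.elim
        (fun x => ⟨x.1, ?_⟩) (fun x => ⟨x.1, ?_⟩)) ⟨?_, ?_⟩,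
        isHatMap_of_val _ fun _ => rfl, isHatMap_of_val _ fun _ => rfl⟩
      · have : p x.1 = i := x.2
        simp [this]
      · have : p x.1 ∈ T := x.2
        simp [this]
      · rintro (⟨x, hx⟩ | ⟨x, hx⟩) (⟨y, hy⟩ | ⟨y, hy⟩) h
        · obtain rfl : x = y := Subtype.ext_iff.mp h
          rfl
        · obtain rfl : x = y := Subtype.ext_iff.mp h
          have h1 : p x = i := hx
          exact absurd (h1 ▸ hy : i ∈ T) hi
        · obtain rfl : x = y := Subtype.ext_iff.mp h
          have h1 : p x = i := hy
          exact absurd (h1 ▸ hx : i ∈ T) hi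
        · obtain rfl : x = y := Subtype.ext_iff.mp h
          rfl
      · rintro ⟨x, hx⟩
        rcases Finset.mem_insert.mp hx with h | h
        · exact ⟨Sum.inl ⟨x, h⟩, rfl⟩
        · exact ⟨Sum.inr ⟨x, h⟩, rfl⟩
  rw [← key Finset.univ]
  exact hμ.iso _ _ (iso_sub (by simp))

/-- Isomorphisms need only respect a small group of definition, so the set may be replaced by the
same set with the trivial action of `W`, which is a disjoint union of singletons. -/
theorem eq_card (hμ : IsMeasure μ) [Finite X.carrier] {W : Subgroup G} (hW : W ∈ E)
    (hle : W ≤ X.grp) (h : ∀ w ∈ W, ∀ x, X.sm w x = x) : μ X = Nat.card X.carrier := by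
  have e : μ X = μ (triv hW X.carrier) := hμ.iso _ _ ⟨Equiv.refl _, W, hW,
    equivariantOn_iff.mpr ⟨hle, le_rfl, fun w hw x =>
      (h w hw x).trans (sm_of_mem (X := triv hW X.carrier) hw _).symm⟩⟩
  have := Fintype.ofFinite X.carrier
  rw [e, hμ.eq_sum_sub (X := triv hW X.carrier) (ι := X.carrier) id fun _ _ => rfl,
    Nat.card_eq_fintype_card, ← Finset.card_univ, ← nsmul_one, ← Finset.sum_const]
  exact Finset.sum_congr rfl fun x _ => hμ.singleton _ ⟨⟨x, rfl⟩, fun y => Subtype.ext y.2⟩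

/-- If a subring contains the measures of transitive sets then it contains all measures. -/
theorem mem_of_isTransitive (hμ : IsMeasure μ) {S : Type*} [SetLike S k] [AddSubmonoidClass S k]
    (s : S) (h : ∀ Y : HatSet E, Y.IsTransitive → μ Y ∈ s) (X : HatSet E) : μ X ∈ s := by
  have := X.finitary
  have := Fintype.ofFinite (MulAction.orbitRel.Quotient X.grp X.carrier)
  rw [hμ.eq_sum_sub (X := X) (ι := MulAction.orbitRel.Quotient X.grp X.carrier)
    (fun x => Quotient.mk _ x)
    (fun g x => Quotient.sound (MulAction.orbitRel_apply.mpr ⟨g, rfl⟩))]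
  refine sum_mem fun c _ => h _ ?_
  induction c using Quotient.inductionOn with
  | h x =>
    refine isTransitive_of_exists ⟨x, rfl⟩ fun y => ?_
    obtain ⟨g, hg⟩ := MulAction.orbitRel_apply.mp (Quotient.exact y.2)
    exact ⟨g, g.2, Subtype.ext ((sub_sm g.2 _).trans ((sm_coe g x).trans hg))⟩

theorem coset_mul (hμ : IsMeasure μ) (hE : ConjStable E) {U V W : Subgroup G} (hU : U ∈ E)
    (hV : V ∈ E) (hW : W ∈ E) (hVU : V ≤ U) (hWV : W ≤ V) :
    μ (coset hE hU hW (hWV.trans hVU)) = μ (coset hE hU hV hVU) * μ (coset hE hV hW hWV) :=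
  hμ.fiber _ _ _ (coset_isFiber hE hU hV hVU hW hWV)

end IsMeasure

/-! ### The universal property of `Θ(G; E)` -/

namespace Theta

variable {G : Type u} [Group G] {E : Set (Subgroup G)} {k : Type*} [CommRing k]

theorem isMeasure_cls : IsMeasure (Theta.cls : HatSet E → Theta E) where
  iso X Y h := Ideal.Quotient.eq.mpr (Ideal.subset_span (.iso X Y h))
  singleton X h := Ideal.Quotient.eq.mpr (Ideal.subset_span (.singleton X h))
  coprod Z X Y h := Ideal.Quotient.eq.mpr (Ideal.subset_span (.coprod Z X Y h))
  twist g X Y h := Ideal.Quotient.eq.mpr (Ideal.subset_span (.twist g X Y h))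
  fiber A Y X h := Ideal.Quotient.eq.mpr (Ideal.subset_span (.fiber A Y X h))

/-- The ring homomorphism given by a measure. -/
noncomputable def lift {μ : HatSet E → k} (hμ : IsMeasure μ) : Theta E →+* k :=
  Ideal.Quotient.lift _ (MvPolynomial.eval₂Hom (Int.castRingHom k) μ) fun a ha => by
    refine (Ideal.span_le (I := RingHom.ker (MvPolynomial.eval₂Hom (Int.castRingHom k) μ))).mpr ?_ ha
    rintro _ (⟨X, Y, h⟩ | ⟨X, h⟩ | ⟨Z, X, Y, h⟩ | ⟨g, X, Y, h⟩ | ⟨A, Y, X, h⟩)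
    · simp [RingHom.mem_ker, hμ.iso X Y h]
    · simp [RingHom.mem_ker, hμ.singleton X h]
    · simp [RingHom.mem_ker, hμ.coprod Z X Y h]
    · simp [RingHom.mem_ker, hμ.twist g X Y h]
    · simp [RingHom.mem_ker, hμ.fiber A Y X h]

@[simp] theorem lift_cls {μ : HatSet E → k} (hμ : IsMeasure μ) (X : HatSet E) :
    lift hμ (cls X) = μ X :=
  (Ideal.Quotient.lift_mk _ _ _).trans (by simp)

/-- The classes generate `Θ(G; E)` as a ring. -/
theorem mem_of_cls_mem (S : Subring (Theta E)) (h : ∀ X, cls X ∈ S) (x : Theta E) : x ∈ S := by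
  obtain ⟨p, rfl⟩ := Ideal.Quotient.mk_surjective x
  induction p using MvPolynomial.induction_on with
  | C n =>
    have : Ideal.Quotient.mk (Ideal.span {r | MeasureRel E r}) (MvPolynomial.C n) = (n : Theta E) :=
      map_intCast ((Ideal.Quotient.mk (Ideal.span {r | MeasureRel E r})).comp MvPolynomial.C) n
    rw [this]
    exact intCast_mem S n
  | add p q hp hq =>
    rw [map_add]
    exact add_mem hp hq
  | mul_X p X hp =>
    rw [map_mul]
    exact mul_mem hp (h X)

theorem hom_ext {f g : Theta E →+* k} (h : ∀ X, f (cls X) = g (cls X)) : f = g :=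
  RingHom.ext fun x => mem_of_cls_mem (f.eqLocus g) h x

end Theta

/-! ## Generators for the measures relative to the pointwise stabilizers -/

namespace GLinf

open HatSet

variable {F : Type u} [Field F]

theorem conjStable_pointClass : ConjStable (pointClass F) := by
  intro U hU g V h
  obtain ⟨W, hW, rfl⟩ := mem_pointClass.mp hU
  refine mem_pointClass.mpr ⟨move g W, hW.move g, ?_⟩
  ext k
  rw [h, mem_fix_move]

theorem conjStable_openClass : ConjStable (openClass F) := by
  intro U hU g V h
  obtain ⟨W, hW, hle⟩ := mem_openClass.mp hU
  exact mem_openClass.mpr ⟨move g W, hW.move g, fun k hk => (h k).mpr (hle (mem_fix_move.mp hk))⟩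

/-- The transitive set `G(A) / G(B)`. -/
noncomputable def quot {A B : Pair F} (hA : FG A) (hB : FG B) (h : A ≤ B) : HatSet (pointClass F) :=
  coset conjStable_pointClass (fix_mem_pointClass hA) (fix_mem_pointClass hB) (fix_anti h)

theorem act_add_eq_iff {s : Bool} {g : GLinf F} {x y : Vec F} (hx : act s g x = x) :
    act s g (y + x) = act s g y + x := by
  rw [map_add, hx]

theorem form_act_of_mem {A : Pair F} {g : GLinf F} (hg : g ∈ fix A) {s : Bool} (x : Vec F) {y : Vec F}
    (hy : y ∈ A (!s)) :
    PairedSpace.infForm F (act s g x) y = PairedSpace.infForm F x y := by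
  rw [form_act_left, inv_mem hg _ y hy]

variable {k : Type v} [CommRing k] {μ : HatSet (pointClass F) → k}

theorem measure_quot_mul (hμ : IsMeasure μ) {A B C : Pair F} (hA : FG A) (hB : FG B) (hC : FG C)
    (h : A ≤ B) (h' : B ≤ C) :
    μ (quot hA hC (h.trans h')) = μ (quot hA hB h) * μ (quot hB hC h') :=
  hμ.coset_mul conjStable_pointClass _ _ _ _ _

theorem measure_quot_self (hμ : IsMeasure μ) {A B : Pair F} (hA : FG A) (hB : FG B) (h : A ≤ B)
    (h' : B ≤ A) : μ (quot hA hB h) = 1 := by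
  refine hμ.singleton _ ⟨(QuotientGroup.mk 1 : fix A ⧸ (fix B).subgroupOf (fix A)), fun y => ?_⟩
  obtain ⟨g, rfl⟩ := QuotientGroup.mk_surjective y
  exact QuotientGroup.eq.mpr (fix_anti h' (g⁻¹ * 1 : fix A).2)

/-- The vectors having the same pairing with `A` as `x`. -/
def alike (A : Pair F) (s : Bool) (x : Vec F) : Set (Vec F) :=
  {z | ∀ y ∈ A (!s), PairedSpace.infForm F z y = PairedSpace.infForm F x y}

theorem act_mem_alike {A : Pair F} {s : Bool} {x : Vec F} {g : GLinf F} (hg : g ∈ fix A) {z : Vec F}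
    (hz : z ∈ alike A s x) : act s g z ∈ alike A s x :=
  fun y hy => (form_act_of_mem hg z hy).trans (hz y hy)

/-! ### Measures of the sets `G(A)/G(B)` over a finite field -/

section finite

variable [Finite F]

/-- One side of `𝐕`, as a set with an action of `G(A)`. -/
noncomputable def side {A : Pair F} (hA : FG A) (s : Bool) : HatSet (pointClass F) where
  grp := fix A
  grp_mem := fix_mem_pointClass hA
  carrier := Vec F
  act :=
    { smul := fun g x => act s g x
      one_smul := fun x => act_one s x
      mul_smul := fun g h x => act_mul s g h x }
  smooth x := by
    refine mem_pointClass.mpr ⟨A ⊔ line s x, hA.sup (FG.line s x), ?_⟩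
    ext g
    rw [mem_fix_sup_line]
    constructor
    · rintro ⟨g, hg, rfl⟩
      exact ⟨g.2, hg⟩
    · rintro ⟨h1, h2⟩
      exact ⟨⟨g, h1⟩, h2, rfl⟩
  finitary := by
    classical
    let _ : MulAction (fix A) (Vec F) :=
      { smul := fun g x => act s g x
        one_smul := fun x => act_one s x
        mul_smul := fun g h x => act_mul s g h x }
    have (t : Bool) : Finite (A t) := hA.finite t
    -- The orbit of `x` under `G(A)` is determined by `x` itself if `x` is in `A`, and otherwise, by
    -- Witt's theorem, by the pairings of `x` with `A`. These invariants take finitely many values.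
    let inv (x : Vec F) : Option (A s) × (A (!s) → F) :=
      (if h : x ∈ A s then some ⟨x, h⟩ else none, fun y => PairedSpace.infForm F x y)
    refine Finite.of_injective (fun c : MulAction.orbitRel.Quotient (fix A) (Vec F) => inv c.out)
      fun c c' h => ?_
    rw [← c.out_eq, ← c'.out_eq]
    have h : inv (Quotient.out c) = inv (Quotient.out c') := h
    generalize (Quotient.out c : Vec F) = x at h
    generalize (Quotient.out c' : Vec F) = x' at h
    obtain ⟨h1, h2⟩ := Prod.mk.inj h
    refine Quotient.sound (MulAction.orbitRel_apply.mpr ?_)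
    by_cases hx : x ∈ A s
    · by_cases hx' : x' ∈ A s
      · rw [dif_pos hx, dif_pos hx'] at h1
        obtain rfl : x = x' := congrArg Subtype.val (Option.some.inj h1)
        exact ⟨1, act_one s x⟩
      · simp [hx, hx'] at h1
    · by_cases hx' : x' ∈ A s
      · simp [hx, hx'] at h1
      obtain ⟨n, hn⟩ := (hA.sup ((FG.line s x).sup (FG.line s x'))).exists_le_stdPair
      obtain ⟨g, hg, -, e⟩ := exists_fix_act_eq (le_sup_left.trans hn)
        (line_le.mp (le_sup_right.trans (le_sup_right.trans hn)))
        (line_le.mp (le_sup_left.trans (le_sup_right.trans hn))) hx' hx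
        fun y hy => (congrFun h2 ⟨y, hy⟩).symm
      exact ⟨⟨g, hg⟩, e⟩

theorem side_sm {A : Pair F} (hA : FG A) {s : Bool} {g : GLinf F} (hg : g ∈ fix A) (x : Vec F) :
    (side hA s).sm g x = act s g x :=
  sm_of_mem (X := side hA s) hg x

theorem side_stb {A : Pair F} (hA : FG A) {s : Bool} (x : Vec F) :
    (side hA s).stb x = fix (A ⊔ line s x) := by
  ext g
  rw [mem_fix_sup_line]
  refine (mem_stb (X := side hA s)).trans (and_congr_right fun hg => ?_)
  exact Eq.congr_left (side_sm hA hg x)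

/-- An invariant subset of one side of `𝐕`. -/
noncomputable def sideSub {A : Pair F} (hA : FG A) (s : Bool) (Z : Set (Vec F))
    (hZ : ∀ g ∈ fix A, ∀ z ∈ Z, act s g z ∈ Z) : HatSet (pointClass F) :=
  (side hA s).sub Z fun g z hz => hZ g g.2 z hz

theorem sideSub_sm {A : Pair F} (hA : FG A) {s : Bool} {Z : Set (Vec F)}
    (hZ : ∀ g ∈ fix A, ∀ z ∈ Z, act s g z ∈ Z) {g : GLinf F} (hg : g ∈ fix A) (z : Z) :
    Subtype.val (p := (· ∈ Z)) ((sideSub hA s Z hZ).sm g z) = act s g z :=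
  (sub_sm (X := side hA s) hg z).trans (side_sm hA hg _)

theorem isHatMap_sideSub {A : Pair F} (hA : FG A) {s : Bool} {Z Z' : Set (Vec F)}
    (hZ : ∀ g ∈ fix A, ∀ z ∈ Z, act s g z ∈ Z) (hZ' : ∀ g ∈ fix A, ∀ z ∈ Z', act s g z ∈ Z')
    (f : Z → Z') (hf : ∀ z, (f z : Vec F) = z) :
    IsHatMap (X := sideSub hA s Z hZ) (Y := sideSub hA s Z' hZ') f :=
  isHatMap_of_val _ hf

/-- The set `alike A s x` with its action of `G(A)`. -/
noncomputable def alikeSet {A : Pair F} (hA : FG A) (s : Bool) (x : Vec F) : HatSet (pointClass F) :=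
  sideSub hA s (alike A s x) fun _ hg _ hz => act_mem_alike hg hz

/-- The identity map is equivariant for `fix A`, so shrinking the group of definition does not
change the measure. -/
theorem measure_side (hμ : IsMeasure μ) {A : Pair F} (hA : FG A) (s : Bool) :
    μ (side hA s) = μ (side FG.bot s) :=
  hμ.iso _ _ ⟨Equiv.refl _, fix A, fix_mem_pointClass hA, equivariantOn_iff.mpr
    ⟨le_rfl, fix_anti bot_le, fun _ hw x => (side_sm hA hw x).trans
      (side_sm FG.bot (fix_anti bot_le hw) x).symm⟩⟩

/-- Translation by `x` carries the orthogonal complement of `A` to its coset. It need not commute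
with `fix A`, but it commutes with the smaller `fix (A + ⟨x⟩)`, and that is enough for an
isomorphism. -/
theorem measure_alikeSet (hμ : IsMeasure μ) {A : Pair F} (hA : FG A) (s : Bool) (x : Vec F) :
    μ (alikeSet hA s x) = μ (alikeSet hA s 0) := by
  have h0 (z : Vec F) : z ∈ alike A s 0 ↔ z + x ∈ alike A s x := by
    refine forall₂_congr fun y _ => ?_
    rw [map_add, map_zero, LinearMap.add_apply, LinearMap.zero_apply, add_eq_right]
  let f : alike A s 0 ≃ alike A s x := (Equiv.addRight x).subtypeEquiv h0
  symm
  refine hμ.iso _ _ ⟨f, fix (A ⊔ line s x),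
    fix_mem_pointClass (hA.sup (FG.line s x)), equivariantOn_iff.mpr ⟨fix_anti le_sup_left,
      fix_anti le_sup_left, fun w hw z => Subtype.ext ?_⟩⟩
  obtain ⟨h1, h2⟩ := mem_fix_sup_line.mp hw
  have e1 := sideSub_sm hA (s := s) (Z := alike A s 0) (fun _ hg _ hz => act_mem_alike hg hz) h1 z
  have e2 := sideSub_sm hA (s := s) (Z := alike A s x)
    (fun _ hg _ hz => act_mem_alike hg hz) h1 (f z)
  refine (congrArg (fun v : Vec F => v + x) e1).trans (Eq.trans ?_ e2.symm)
  exact (act_add_eq_iff h2).symm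

theorem card_dual (U : Type*) [AddCommGroup U] [Module F U] [Module.Finite F U] :
    Finite (Module.Dual F U) ∧
      Nat.card (Module.Dual F U) = Nat.card F ^ Module.finrank F U := by
  refine ⟨Module.finite_of_finite F, ?_⟩
  rw [Module.natCard_eq_pow_finrank (K := F), Subspace.dual_finrank_eq]

/-- The measure of the orthogonal complement of `A`. -/
theorem measure_alikeSet_zero (hμ : IsMeasure μ) {A : Pair F} (hA : FG A) {s t : Bool}
    (ht : t = !s) :
    (Nat.card F : k) ^ Module.finrank F (A t) * μ (alikeSet hA s 0) = μ (side FG.bot s) := by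
  subst ht
  have hfin : Module.Finite F (A (!s)) := Module.Finite.iff_fg.mpr (hA _)
  obtain ⟨hdual, hcard⟩ := card_dual (F := F) (A (!s))
  have := Fintype.ofFinite (Module.Dual F (A (!s)))
  -- Pairing with `A (!s)` maps the piece of side `s` to a finite dual space; its fibers are the
  -- cosets of the orthogonal complement of `A`.
  let p (z : Vec F) : Module.Dual F (A (!s)) := (PairedSpace.infForm F z).domRestrict (A (!s))
  have hp (g : GLinf F) (hg : g ∈ fix A) (z : Vec F) : p (act s g z) = p z :=
    LinearMap.ext fun y => form_act_of_mem hg z y.2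
  rw [← measure_side hμ hA, hμ.eq_sum_sub (X := side hA s) p fun g z => hp g g.2 z]
  have key (l : Module.Dual F (A (!s))) :
      μ (sideSub hA s (p ⁻¹' {l}) fun g hg z hz => (hp g hg z).trans hz) =
        μ (alikeSet hA s 0) := by
    -- Every functional on `A (!s)` is the pairing with some vector, so no fiber is empty and each
    -- has the form `alike A s x`.
    obtain ⟨f, hf⟩ := LinearMap.exists_extend l
    obtain ⟨n, hn⟩ := hA.exists_le_stdPair
    obtain ⟨x, -, hx⟩ := exists_representing n f
    have hpx : ∀ y : A (!s), PairedSpace.infForm F x y = l y := fun y => by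
      rw [infForm_comm, hx y (hn _ y.2), ← hf]
      rfl
    rw [← measure_alikeSet hμ hA s x]
    have hz (z : Vec F) : p z = l ↔ z ∈ alike A s x :=
      ⟨fun h y hy => (DFunLike.congr_fun h ⟨y, hy⟩).trans (hpx ⟨y, hy⟩).symm,
        fun h => LinearMap.ext fun y => (h y.1 y.2).trans (hpx y)⟩
    exact hμ.iso _ _ ⟨(Equiv.refl _).subtypeEquiv hz, isHatMap_sideSub hA _ _ _ fun _ => rfl⟩
  refine Eq.trans ?_ (Finset.sum_congr rfl fun l _ => key l).symm
  rw [Finset.sum_const, nsmul_eq_mul, Finset.card_univ, ← Nat.card_eq_fintype_card,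
    hcard, Nat.cast_pow]

/-- The measure of `G(A) / G(A + ⟨x⟩)`, for `x` not in `A`. -/
theorem measure_quot_line (hμ : IsMeasure μ) {A : Pair F} (hA : FG A) {s : Bool} {x : Vec F}
    (hx : x ∉ A s) :
    μ (quot hA (hA.sup (FG.line s x)) le_sup_left) + Nat.card {z : A s // z.1 ∈ alike A s x} =
      μ (alikeSet hA s 0) := by
  have : Finite (A s) := hA.finite s
  -- The vectors that pair with `A` as `x` does are of two kinds. Those outside `A` form one orbit
  -- of `fix A`, with the stabilizer of `x` equal to `fix (A + ⟨x⟩)`; those inside `A` are finitely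
  -- many and fixed.
  let Z₁ : Set (Vec F) := {z | z ∉ A s ∧ z ∈ alike A s x}
  let Z₂ : Set (Vec F) := {z | z ∈ A s ∧ z ∈ alike A s x}
  have hZ₁ (g) (hg : g ∈ fix A) (z) (hz : z ∈ Z₁) : act s g z ∈ Z₁ := by
    refine ⟨fun hc => hz.1 ?_, act_mem_alike hg hz.2⟩
    have := inv_mem hg s _ hc
    rw [act_inv_act] at this
    rwa [this]
  have hZ₂ (g) (hg : g ∈ fix A) (z) (hz : z ∈ Z₂) : act s g z ∈ Z₂ := by
    rwa [hg s z hz.1]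
  let x₁ : Z₁ := ⟨x, hx, fun _ _ => rfl⟩
  have h1 : μ (quot hA (hA.sup (FG.line s x)) le_sup_left) = μ (sideSub hA s Z₁ hZ₁) := by
    refine hμ.iso _ _ (iso_coset (X := sideSub hA s Z₁ hZ₁) conjStable_pointClass _ _
      (isTransitive_of_exists (X := sideSub hA s Z₁ hZ₁) x₁ fun z => ?_) x₁
      ((sub_stb (X := side hA s) x₁).trans (side_stb hA x)))
    let z' : Vec F := Subtype.val (p := (· ∈ Z₁)) z
    have hz' : z' ∈ Z₁ := Subtype.property (p := (· ∈ Z₁)) z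
    obtain ⟨n, hn⟩ := (hA.sup ((FG.line s x).sup (FG.line s z'))).exists_le_stdPair
    obtain ⟨g, hg, -, e⟩ := exists_fix_act_eq (le_sup_left.trans hn)
      (line_le.mp (le_sup_left.trans (le_sup_right.trans hn)))
      (line_le.mp (le_sup_right.trans (le_sup_right.trans hn))) hx hz'.1
      fun y hy => (hz'.2 y hy).symm
    exact ⟨g, hg, Subtype.ext ((sideSub_sm hA hZ₁ hg x₁).trans e)⟩
  let eq : Z₂ ≃ {z : A s // z.1 ∈ alike A s x} :=
    ⟨fun z => ⟨⟨z.1, z.2.1⟩, z.2.2⟩, fun z => ⟨z.1.1, z.1.2, z.2⟩, fun _ => rfl, fun _ => rfl⟩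
  have : Finite (sideSub hA s Z₂ hZ₂).carrier := Finite.of_equiv _ eq.symm
  have h2 : μ (sideSub hA s Z₂ hZ₂) = Nat.card {z : A s // z.1 ∈ alike A s x} := by
    rw [← Nat.card_congr eq]
    refine hμ.eq_card (X := sideSub hA s Z₂ hZ₂) (fix_mem_pointClass hA) le_rfl fun w hw z => ?_
    exact Subtype.ext ((sideSub_sm hA hZ₂ hw z).trans
      (hw s _ (Subtype.property (p := (· ∈ Z₂)) z).1))
  let f : Z₁ ⊕ Z₂ → alike A s x := Sum.elim (fun z => ⟨z.1, z.2.2⟩) (fun z => ⟨z.1, z.2.2⟩)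
  have hf : Function.Bijective f := by
    constructor
    · rintro (⟨z, hz⟩ | ⟨z, hz⟩) (⟨w, hw⟩ | ⟨w, hw⟩) h
      · obtain rfl : z = w := Subtype.ext_iff.mp h
        rfl
      · obtain rfl : z = w := Subtype.ext_iff.mp h
        exact absurd hw.1 hz.1
      · obtain rfl : z = w := Subtype.ext_iff.mp h
        exact absurd hz.1 hw.1
      · obtain rfl : z = w := Subtype.ext_iff.mp h
        rfl
    · rintro ⟨z, hz⟩
      by_cases h : z ∈ A s
      · exact ⟨Sum.inr ⟨z, h, hz⟩, rfl⟩
      · exact ⟨Sum.inl ⟨z, h, hz⟩, rfl⟩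
  rw [h1, ← h2, ← measure_alikeSet hμ hA s x]
  exact (hμ.coprod _ _ _ ⟨Equiv.ofBijective f hf, isHatMap_sideSub hA hZ₁ _ _ fun _ => rfl,
    isHatMap_sideSub hA hZ₂ _ _ fun _ => rfl⟩).symm

/-- The measure of the whole even piece is that of the whole odd piece. -/
theorem measure_side_eq (hμ : IsMeasure μ) (s t : Bool) :
    μ (side (F := F) FG.bot s) = μ (side (F := F) FG.bot t) := by
  let e : Vec F := Finsupp.single 0 1
  have he : PairedSpace.infForm F e e = 1 := by simp [e, form_single_left]
  have he0 : e ≠ 0 := by simp [e]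
  let C (s : Bool) : Pair F := line s e ⊔ line (!s) e
  have hC (s) : FG (C s) := (FG.line _ _).sup (FG.line _ _)
  -- A hyperbolic pair is built by choosing a nonzero vector on side `s`, then a vector on the other
  -- side pairing to `1` with it. If `α`, `β` are the measures of the two pieces, this gives `q μ =
  -- (α - 1) β`, and the opposite order gives `q μ = (β - 1) α` for the same set; hence `α = β`,
  -- with no division by `q`.
  have key (s : Bool) : (Nat.card F : k) * μ (quot FG.bot (hC s) bot_le) =
      (μ (side (F := F) FG.bot s) - 1) * μ (side (F := F) FG.bot (!s)) := by
    have h1 : μ (quot FG.bot (FG.line s e) bot_le) = μ (side (F := F) FG.bot s) - 1 := by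
      have a := measure_quot_line hμ FG.bot (s := s) (x := e) (by simpa using he0)
      have b := measure_alikeSet_zero hμ (FG.bot (F := F)) (s := s) rfl
      have : Unique {z : (⊥ : Pair F) s // z.1 ∈ alike ⊥ s e} :=
        { default := ⟨0, fun y hy => by simp [(Submodule.mem_bot F).mp hy]⟩
          uniq := fun z => Subtype.ext (Subtype.ext ((Submodule.mem_bot F).mp z.1.2)) }
      simp only [Pi.bot_apply, finrank_bot, pow_zero, one_mul, bot_sup_eq] at a b
      rw [← b, ← a, Nat.card_unique]
      simp
    have h2 : (Nat.card F : k) * μ (quot (FG.line s e) (hC s) le_sup_left) =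
        μ (side (F := F) FG.bot (!s)) := by
      have a := measure_quot_line hμ (FG.line s e) (s := !s) (x := e) (by simpa using he0)
      have b := measure_alikeSet_zero hμ (FG.line s e) (s := !s) (t := s) (by simp)
      -- On this side the line contributes only `0`, which does not pair to `1` with `e`; nothing is
      -- subtracted.
      have : IsEmpty {z : line s e (!s) // z.1 ∈ alike (line s e) (!s) e} := by
        refine ⟨fun z => ?_⟩
        have hz : z.1.1 = 0 := by simpa using z.1.2
        have := z.2 e (by
          rw [Bool.not_not, line_self]
          exact Submodule.mem_span_singleton_self e)
        rw [hz, he] at this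
        simp at this
      have hr : Module.finrank F (line s e s) = 1 :=
        (congrArg (fun W : Submodule F (Vec F) => Module.finrank F W) (line_self s e)).trans
          (finrank_span_singleton he0)
      rw [hr, pow_one] at b
      rw [Nat.card_of_isEmpty, Nat.cast_zero, add_zero] at a
      rw [← b, ← a]
    rw [measure_quot_mul hμ FG.bot (FG.line s e) (hC s) bot_le le_sup_left, ← h1, ← h2]
    ring
  have hCC : C true = C false := sup_comm _ _
  have h1 := key true
  have h2 := key false
  simp only [hCC] at h1
  rw [h1] at h2
  have : μ (side (F := F) FG.bot true) = μ (side (F := F) FG.bot false) := by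
    simp only [Bool.not_true, Bool.not_false] at h2
    linear_combination h2
  cases s <;> cases t <;> simp [this]

/-- The even piece of `𝐕` consists of `0` and the embeddings of a line. -/
theorem measure_side_eq_embSet (hμ : IsMeasure μ) (s : Bool) :
    μ (side (F := F) FG.bot s) = 1 + μ (embSet F 0 1 0) := by
  rw [measure_side_eq hμ s true]
  have h0 (g) (_ : g ∈ fix (⊥ : Pair F)) (z) (hz : z ∈ ({0} : Set (Vec F))) :
      act true g z ∈ ({0} : Set (Vec F)) := by
    rw [Set.mem_singleton_iff.mp hz, map_zero]
    rfl
  let X₀ := sideSub FG.bot true {0} h0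
  -- An embedding of `V_{0,1,0}` is recorded by the image of the generator `1` of its even line.
  let f : ({0} : Set (Vec F)) ⊕ (embSet F 0 1 0).carrier → Vec F :=
    Sum.elim (fun z => z.1) (fun i : PairedSpace.Emb (PairedSpace.std F 0 1 0) (PairedSpace.inf F) =>
      i.even (fun _ : Fin 0 ⊕ Fin 1 => (1 : F)))
  have hne : (fun _ : Fin 0 ⊕ Fin 1 => (1 : F)) ≠ 0 := fun h =>
    one_ne_zero (congrFun h (Sum.inr 0))
  have hf0 (i : PairedSpace.Emb (PairedSpace.std F 0 1 0) (PairedSpace.inf F)) :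
      f (Sum.inr i) ≠ 0 := fun h => hne (i.even_injective (h.trans (map_zero i.even).symm))
  have hf : Function.Bijective f := by
    constructor
    · rintro (⟨z, rfl⟩ | i) (⟨w, rfl⟩ | j) h
      · rfl
      · exact absurd h.symm (hf0 j)
      · exact absurd h (hf0 i)
      · refine congrArg Sum.inr (PairedSpace.Emb.ext (LinearMap.ext fun x => ?_)
          (LinearMap.ext fun x => ?_))
        · have hx : x = x (Sum.inr 0) • (fun _ : Fin 0 ⊕ Fin 1 => (1 : F)) := by
            funext a
            rcases a with a | a
            · exact a.elim0
            · rw [Subsingleton.elim a 0]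
              exact (mul_one _).symm
          rw [hx]
          exact (map_smul i.even _ _).trans ((congrArg _ h).trans (map_smul j.even _ _).symm)
        · have hx : x = (0 : Fin 0 ⊕ Fin 0 → F) := funext fun a => a.elim Fin.elim0 Fin.elim0
          rw [hx]
          exact (map_zero i.odd).trans (map_zero j.odd).symm
    · intro x
      by_cases hx : x = 0
      · exact ⟨Sum.inl ⟨0, rfl⟩, hx.symm⟩
      · refine ⟨Sum.inr
          { even := (LinearMap.proj (Sum.inr 0) : (Fin 0 ⊕ Fin 1 → F) →ₗ[F] F).smulRight x
            odd := 0
            even_injective := ?_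
            odd_injective := ?_
            form_eq := ?_ }, ?_⟩
        · intro a b hab
          have hab' : (a (Sum.inr 0)) • x = (b (Sum.inr 0)) • x := hab
          funext c
          rcases c with c | c
          · exact c.elim0
          · rw [Subsingleton.elim c 0]
            exact smul_left_injective F hx hab'
        · intro a b _
          exact funext fun c => c.elim Fin.elim0 Fin.elim0
        · intro a b
          refine (map_zero ((PairedSpace.inf F).form _)).trans ?_
          simp only [PairedSpace.std, Finset.univ_eq_empty, Finset.sum_empty]
          rfl
        · exact one_smul F x
  have h := hμ.coprod (side FG.bot true) X₀ (embSet F 0 1 0) ⟨Equiv.ofBijective f hf,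
    ⟨fix ⊥, fix_mem_pointClass FG.bot, equivariantOn_iff.mpr ⟨le_rfl, le_rfl, fun w hw x =>
      (sideSub_sm FG.bot h0 hw x).trans (side_sm FG.bot hw _).symm⟩⟩,
    ⟨fix ⊥, fix_mem_pointClass FG.bot, equivariantOn_iff.mpr ⟨le_top, le_rfl, fun w hw x => ?_⟩⟩⟩
  · rw [h, hμ.singleton X₀ ⟨(⟨0, rfl⟩ : ({0} : Set (Vec F))), fun y =>
      Subtype.ext (Subtype.property (p := (· ∈ ({0} : Set (Vec F)))) y)⟩]
  · refine (congrArg (fun i => f (Sum.inr i)) (sm_of_mem (X := embSet F 0 1 0) trivial x)).trans ?_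
    exact (side_sm FG.bot (s := true) hw (f (Sum.inr x))).symm

/-- A subring that contains `1 / q` and the measure of `X_{0,1,0}` contains all measures. -/
theorem measure_quot_mem (hμ : IsMeasure μ) (S : Subring k)
    (hq : ∃ r ∈ S, r * (Nat.card F : k) = 1) (h : μ (embSet F 0 1 0) ∈ S) {A B : Pair F}
    (hA : FG A) (hB : FG B) (hAB : A ≤ B) : μ (quot hA hB hAB) ∈ S := by
  obtain ⟨r, hr, hr1⟩ := hq
  -- For `x` outside `A` the measure is `r ^ d * (1 + μ(X_{0,1,0}))` minus a natural number, where
  -- `r` is the inverse of `q` and `d` is the dimension of `A` on the other side.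
  have hline {A : Pair F} (hA : FG A) (s : Bool) (x : Vec F) :
      μ (quot hA (hA.sup (FG.line s x)) le_sup_left) ∈ S := by
    by_cases hx : x ∈ A s
    · rw [measure_quot_self hμ hA _ _ (sup_le le_rfl (line_le.mpr hx))]
      exact one_mem S
    · rw [eq_sub_of_add_eq (measure_quot_line hμ hA hx)]
      refine sub_mem ?_ (natCast_mem S _)
      have := measure_alikeSet_zero hμ hA (s := s) rfl
      have e : μ (alikeSet hA s 0) =
          r ^ Module.finrank F (A (!s)) * μ (side (F := F) FG.bot s) := by
        rw [← this, ← mul_assoc, ← mul_pow, hr1, one_pow, one_mul]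
      rw [e, measure_side_eq_embSet hμ]
      exact mul_mem (pow_mem hr _) (add_mem (one_mem S) h)
  -- The upper subspace is a variable `C` with `C = A ⊔ B`, so that the induction on `B` can proceed
  -- although `quot` depends on proofs about `C`.
  have key : ∀ B (_ : FG B), ∀ C (hC : FG C) (hAC : A ≤ C), C = A ⊔ B → μ (quot hA hC hAC) ∈ S := by
    refine FG.induction ?_ fun B s x hB ih => ?_
    · rintro C hC hAC rfl
      rw [measure_quot_self hμ hA hC hAC (by simp)]
      exact one_mem S
    · rintro C hC hAC rfl
      simp only [← sup_assoc]
      rw [measure_quot_mul hμ hA (hA.sup hB) ((hA.sup hB).sup (FG.line s x)) le_sup_left le_sup_left]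
      exact mul_mem (ih _ (hA.sup hB) _ rfl) (hline _ s x)
  exact key B hB B hB hAB (sup_eq_right.mpr hAB).symm

/-- A transitive set is `G(A)/G(B)`, where `G(B)` is the stabilizer of a point; the inclusion of
groups forces `A ≤ B`, so `measure_quot_mem` applies to it. -/
theorem measure_mem (hμ : IsMeasure μ) (S : Subring k)
    (hq : ∃ r ∈ S, r * (Nat.card F : k) = 1) (h : μ (embSet F 0 1 0) ∈ S)
    (X : HatSet (pointClass F)) : μ X ∈ S := by
  refine hμ.mem_of_isTransitive S (fun X hX => ?_) X
  obtain ⟨x⟩ := hX.1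
  obtain ⟨A, hA, eA⟩ := mem_pointClass.mp X.grp_mem
  obtain ⟨B, hB, eB⟩ := mem_pointClass.mp (X.stb_mem x)
  have hAB : A ≤ B := le_of_fix_le hB (eA ▸ eB ▸ X.stb_le x)
  rw [← hμ.iso _ _ (iso_coset conjStable_pointClass (X.stb_mem x) (X.stb_le x) hX x rfl)]
  have key (U V : Subgroup (GLinf F)) (hU hV hVU) (eU : U = fix A) (eV : V = fix B) :
      μ (coset conjStable_pointClass (U := U) (V := V) hU hV hVU) ∈ S := by
    subst eU eV
    exact measure_quot_mem hμ S hq h hA hB hAB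
  exact key _ _ _ _ _ eA eB

/-- Two measures with the same value at `X_{0,1,0}` agree if `q` is invertible. -/
theorem measure_ext {μ' : HatSet (pointClass F) → k} (hμ : IsMeasure μ) (hμ' : IsMeasure μ')
    (hq : IsUnit (Nat.card F : k)) (h : μ (embSet F 0 1 0) = μ' (embSet F 0 1 0))
    (X : HatSet (pointClass F)) : μ X = μ' X := by
  obtain ⟨r, hr⟩ := hq.exists_left_inv
  exact measure_mem (hμ.prod hμ') ((RingHom.fst k k).eqLocus (RingHom.snd k k))
    ⟨(r, r), rfl, Prod.ext hr hr⟩ h X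

end finite

end GLinf

/-! ## The counting measure -/

namespace GLinf

open HatSet Filter

variable {F : Type u} [Field F]

theorem eventually_fix_stdPair_le {U : Subgroup (GLinf F)} (hU : U ∈ openClass F) :
    ∀ᶠ n in atTop, fix (stdPair F n) ≤ U := by
  obtain ⟨W, hW, h⟩ := mem_openClass.mp hU
  obtain ⟨N, hN⟩ := hW.exists_le_stdPair
  exact eventually_atTop.mpr ⟨N, fun n hn => (fix_anti (hN.trans (stdPair_mono hn))).trans h⟩

/-- Two points of an orbit that are fixed by the stabilizer of a large standard subspace are
related by an element normalizing that stabilizer. -/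
theorem eventually_exists_stab {U : Subgroup (GLinf F)} (hU : U ∈ openClass F) :
    ∀ᶠ n in atTop, ∀ u ∈ U, ∀ W, FG W → W ≤ stdPair F n → move u W ≤ stdPair F n →
      ∃ h ∈ stab F n, h ∈ U ∧ h⁻¹ * u ∈ fix W := by
  obtain ⟨A, hA⟩ := exists_isSupport hU
  obtain ⟨N, hN⟩ := hA.fg.exists_le_stdPair
  refine eventually_atTop.mpr ⟨N, fun n hn u hu W hW h1 h2 => ?_⟩
  have hAn := hN.trans (stdPair_mono (F := F) hn)
  -- Witt's theorem is applied to `W` enlarged by the support `A` of `U`, which `u` preserves.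
  -- Agreement with `u` on `A` puts `h⁻¹ u` in `fix A ≤ U`, hence `h` in `U`.
  obtain ⟨h, hh, hhu⟩ := exists_stab_eq u (hW.sup hA.fg) (sup_le h1 hAn)
    (move_le_iff.mpr (sup_le (move_le_iff.mp h2)
      (move_le_iff.mp ((hA.move_eq hu).le.trans hAn))))
  rw [fix_sup] at hhu
  refine ⟨h, hh, ?_, hhu.1⟩
  have := mul_mem hu (inv_mem (hA.fix_le hhu.2))
  simpa using this

variable (X Y : HatSet (openClass F))

/-- The points fixed by the stabilizer of a standard subspace. -/
def fixedSet (n : ℕ) : Set X.carrier := {x | ∀ g ∈ fix (stdPair F n), X.sm g x = x}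

variable {X Y}

/-- Since `h` normalizes `fix (stdPair F n)`, it permutes the fixed points of that group. -/
theorem sm_mem_fixedSet {n : ℕ} (hn : fix (stdPair F n) ≤ X.grp) {h : GLinf F} (hh : h ∈ stab F n)
    (hX : h ∈ X.grp) {x : X.carrier} : X.sm h x ∈ fixedSet X n ↔ x ∈ fixedSet X n := by
  have key {h : GLinf F} (hh : h ∈ stab F n) (hX : h ∈ X.grp) {x : X.carrier}
      (hx : x ∈ fixedSet X n) : X.sm h x ∈ fixedSet X n := by
    intro g hg
    have hg' : h⁻¹ * g * h ∈ fix (stdPair F n) := (conj_mem_fix_stdPair hh le_rfl).mpr hg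
    exact (mem_stb.mp ((conj_mem_stb hX).mpr (mem_stb.mpr ⟨hn hg', hx _ hg'⟩))).2
  refine ⟨fun hx => ?_, key hh hX⟩
  have := key (inv_mem hh) (inv_mem hX) hx
  rwa [sm_inv_sm hX] at this

/-- If `fix (stdPair F n)` fixes `u x`, then its conjugate by `u⁻¹` fixes `x`, and so the
corresponding translate of `stdPair F n` contains the least support `W`. -/
theorem move_le_of_sm_mem_fixedSet {n : ℕ} (hn : fix (stdPair F n) ≤ X.grp) {x : X.carrier}
    {W : Pair F} (hW : IsSupport (X.stb x) W) {u : GLinf F} (hu : u ∈ X.grp)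
    (h : X.sm u x ∈ fixedSet X n) : move u W ≤ stdPair F n := by
  refine move_le_iff.mpr (hW.least _ ((FG.stdPair n).move _) fun g hg => ?_)
  have hg' := mem_fix_move.mp hg
  have := (conj_mem_stb hu).mp (mem_stb.mpr ⟨hn hg', h _ hg'⟩)
  simpa [mul_assoc] using this

/-- A fixed point `u x` in the orbit of `x` is determined by the restriction of `u` to the support
of the stabilizer of `x`, and this restriction maps a finite set into the finite set `std F n`.
There are finitely many orbits. -/
theorem finite_fixedSet [Finite F] {n : ℕ} (hn : fix (stdPair F n) ≤ X.grp) : Finite (fixedSet X n) := by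
  have key (x : X.carrier) : {y | y ∈ fixedSet X n ∧ ∃ u ∈ X.grp, X.sm u x = y}.Finite := by
    obtain ⟨W, hW⟩ := exists_isSupport (X.stb_mem x)
    have (s : Bool) : Finite (W s) := hW.fg.finite s
    have : Finite (std F n) := (FG.stdPair n).finite true
    refine Set.finite_coe_iff.mp ?_
    choose u hu hux using fun y : {y | y ∈ fixedSet X n ∧ ∃ u ∈ X.grp, X.sm u x = y} => y.2.2
    refine Finite.of_injective (β := ∀ s, W s → std F n) (fun y s w => ⟨act s (u y) w,
      move_le.mp (move_le_of_sm_mem_fixedSet hn hW (hu y) ((hux y).symm ▸ y.2.1)) s w w.2⟩) ?_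
    intro y z hyz
    have : (u y)⁻¹ * u z ∈ X.stb x := hW.fix_le fun s w hw => by
      have : act s (u y) w = act s (u z) w :=
        congrArg Subtype.val (congrFun (congrFun hyz s) ⟨w, hw⟩)
      rw [act_mul, ← this, act_inv_act]
    have := (mem_stb.mp this).2
    rw [sm_mul (inv_mem (hu y)) (hu z), hux] at this
    refine Subtype.ext ?_
    rw [← hux y, ← sm_sm_inv (hu y) z.1, this]
  have := X.finitary
  refine Set.Finite.subset (Set.finite_iUnion fun c : MulAction.orbitRel.Quotient X.grp X.carrier =>
    key c.out) fun y hy => Set.mem_iUnion.mpr ⟨Quotient.mk _ y, hy, ?_⟩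
  obtain ⟨g, hg⟩ := MulAction.orbitRel_apply.mp
    (Quotient.exact (Quotient.out_eq (Quotient.mk (MulAction.orbitRel X.grp X.carrier) y)).symm)
  exact ⟨g, g.2, (sm_coe g _).trans hg⟩

/-- For large `n`, the elements of the group of definition that lie in `stab F n` act transitively
on the fixed points of `X`. As they also permute the fixed points of `Y`, all fibers of the map on
fixed points have as many elements as the one over `x₀`, which is the fixed set of `A`. -/
theorem eventually_card_fiber {A : HatSet (openClass F)} (h : A.IsFiber Y X) :
    ∀ᶠ n in atTop, Nat.card (fixedSet Y n) = Nat.card (fixedSet X n) * Nat.card (fixedSet A n) := by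
  obtain ⟨hgrp, -, hX, f, hf, x₀, j, ⟨V, hV, hj⟩, hinj, hrange⟩ := h
  have hYX {g : GLinf F} (hg : g ∈ X.grp) : g ∈ Y.grp := hgrp ▸ hg
  filter_upwards [eventually_exists_stab X.grp_mem, eventually_fix_stdPair_le X.grp_mem,
    eventually_fix_stdPair_le hV, eventually_fix_stdPair_le (X.stb_mem x₀)] with n h1 h2 h3 h4
  obtain ⟨W, hW⟩ := exists_isSupport (X.stb_mem x₀)
  have hWn : W ≤ stdPair F n := hW.least _ (FG.stdPair n) h4
  have key (x : fixedSet X n) : ∃ h ∈ stab F n, h ∈ X.grp ∧ X.sm h x₀ = x := by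
    obtain ⟨u, hu, hux⟩ := hX.exists_sm x₀ x
    obtain ⟨h, hh, hhX, hhu⟩ := h1 u hu W hW.fg hWn
      (move_le_of_sm_mem_fixedSet h2 hW hu (hux.symm ▸ x.2))
    refine ⟨h, hh, hhX, ?_⟩
    have := (mem_stb.mp (hW.fix_le hhu)).2
    rw [sm_mul (inv_mem hhX) hu, hux] at this
    rw [← this, sm_sm_inv hhX]
  choose h hh hhX hhx using key
  have hY2 : fix (stdPair F n) ≤ Y.grp := fun g hg => hYX (h2 hg)
  have hjf (z : A.carrier) : f (j z) = x₀ := by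
    have : j z ∈ f ⁻¹' {x₀} := hrange ▸ ⟨z, rfl⟩
    exact this
  have hjfix (z : A.carrier) : j z ∈ fixedSet Y n ↔ z ∈ fixedSet A n := by
    refine forall₂_congr fun g hg => ?_
    rw [← hj.sm (h3 hg)]
    exact hinj.eq_iff
  rw [← Nat.card_prod]
  symm
  -- The point `(x, z)` goes to `h x` applied to `j z`, where `h x` is the chosen normalizing
  -- element that takes `x₀` to `x`.
  refine Nat.card_congr (Equiv.ofBijective (fun p : fixedSet X n × fixedSet A n =>
    (⟨Y.sm (h p.1) (j p.2), (sm_mem_fixedSet hY2 (hh p.1) (hYX (hhX p.1))).mpr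
      ((hjfix _).mpr p.2.2)⟩ : fixedSet Y n)) ⟨?_, ?_⟩)
  · rintro ⟨x, z⟩ ⟨x', z'⟩ e
    have e : Y.sm (h x) (j z) = Y.sm (h x') (j z') := congrArg Subtype.val e
    have hx : x = x' := by
      have := congrArg f e
      rw [hf.sm (hhX x), hf.sm (hhX x'), hjf, hjf, hhx, hhx] at this
      exact Subtype.ext this
    subst hx
    have := congrArg (Y.sm (h x)⁻¹) e
    rw [sm_inv_sm (hYX (hhX x)), sm_inv_sm (hYX (hhX x))] at this
    exact Prod.ext rfl (Subtype.ext (hinj this))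
  · rintro ⟨y, hy⟩
    let x : fixedSet X n := ⟨f y, fun g hg => by rw [← hf.sm (h2 hg), hy g hg]⟩
    have : Y.sm (h x)⁻¹ y ∈ Set.range j := by
      rw [hrange, Set.mem_preimage, hf.sm (inv_mem (hhX x)), Set.mem_singleton_iff]
      rw [show f y = X.sm (h x) x₀ from (hhx x).symm, sm_inv_sm (hhX x)]
    obtain ⟨z, hz⟩ := this
    have hzn : z ∈ fixedSet A n := by
      rw [← hjfix, hz]
      exact (sm_mem_fixedSet hY2 (inv_mem (hh x)) (inv_mem (hYX (hhX x)))).mpr hy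
    exact ⟨(x, ⟨z, hzn⟩), Subtype.ext (by simp only [hz, sm_sm_inv (hYX (hhX x))])⟩

/-- Witt's theorem gives `h` that preserves all large standard subspaces and agrees with `g` on the
support of the group of definition. Twisting by `h` preserves the count because `h` normalizes the
groups involved, and twisting by `h⁻¹ g`, which is in the group of definition, gives an isomorphic
set. The bijection `f z ↦ h⁻¹ g z` combines the two. -/
theorem eventually_card_twist {g : GLinf F} (h : X.IsTwist g Y) :
    ∀ᶠ n in atTop, Nat.card (fixedSet Y n) = Nat.card (fixedSet X n) := by
  obtain ⟨hgrp, f, hf⟩ := h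
  obtain ⟨A, hA⟩ := exists_isSupport X.grp_mem
  obtain ⟨N, hN⟩ := (hA.fg.sup (hA.fg.move g)).exists_le_stdPair
  obtain ⟨h, hh, hhg⟩ := exists_stab_eq g hA.fg (le_sup_left.trans hN) (le_sup_right.trans hN)
  have hu : h⁻¹ * g ∈ X.grp := hA.fix_le hhg
  filter_upwards [eventually_ge_atTop N, eventually_fix_stdPair_le X.grp_mem] with n hn h2
  refine Nat.card_congr ((f.symm.trans
    (MulAction.toPerm (⟨h⁻¹ * g, hu⟩ : X.grp))).subtypeEquiv fun y => ?_)
  obtain ⟨z, rfl⟩ := f.surjective y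
  rw [Equiv.trans_apply, f.symm_apply_apply, MulAction.toPerm_apply, ← sm_of_mem hu]
  constructor
  · intro H k hk
    have hk' : h * k * h⁻¹ ∈ fix (stdPair F n) := by
      have := (conj_mem_fix_stdPair (h := k) (inv_mem hh) hn).mpr hk
      rwa [inv_inv] at this
    have e : (h⁻¹ * g)⁻¹ * k * (h⁻¹ * g) = g⁻¹ * (h * k * h⁻¹) * g := by group
    refine (mem_stb.mp ((conj_mem_stb hu).mpr ?_)).2
    have hm : (h⁻¹ * g)⁻¹ * k * (h⁻¹ * g) ∈ X.grp := mul_mem (mul_mem (inv_mem hu) (h2 hk)) hu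
    refine mem_stb.mpr ⟨hm, ?_⟩
    have hmY := (hgrp _).mp hm
    have e' : g * ((h⁻¹ * g)⁻¹ * k * (h⁻¹ * g)) * g⁻¹ = h * k * h⁻¹ := by group
    apply f.injective
    rw [sm_of_mem hm, hf _ hm hmY, ← sm_of_mem hmY, e', H _ hk']
  · intro H k hk
    have hk' : h⁻¹ * k * h ∈ fix (stdPair F n) := (conj_mem_fix_stdPair hh hn).mpr hk
    have e : (h⁻¹ * g)⁻¹ * (h⁻¹ * k * h) * (h⁻¹ * g) = g⁻¹ * k * g := by group
    have hm := (conj_mem_stb hu).mp (mem_stb.mpr ⟨h2 hk', H _ hk'⟩)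
    rw [e, mem_stb] at hm
    have hmY := (hgrp _).mp hm.1
    have e' : g * (g⁻¹ * k * g) * g⁻¹ = k := by group
    have := hf _ hm.1 hmY z
    rw [← sm_of_mem hm.1, ← sm_of_mem hmY, hm.2, e'] at this
    exact this.symm

theorem eventually_card_iso (h : X.Iso Y) :
    ∀ᶠ n in atTop, Nat.card (fixedSet X n) = Nat.card (fixedSet Y n) := by
  obtain ⟨f, W, hW, hf⟩ := h
  filter_upwards [eventually_fix_stdPair_le hW] with n hn
  refine Nat.card_congr (f.subtypeEquiv fun x => forall₂_congr fun g hg => ?_)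
  rw [← hf.sm (hn hg)]
  exact f.injective.eq_iff.symm

theorem eventually_card_coprod [Finite F] {Z : HatSet (openClass F)} (h : Z.IsCoprod X Y) :
    ∀ᶠ n in atTop,
      Nat.card (fixedSet Z n) = Nat.card (fixedSet X n) + Nat.card (fixedSet Y n) := by
  obtain ⟨f, ⟨V, hV, hf⟩, ⟨W, hW, hf'⟩⟩ := h
  filter_upwards [eventually_fix_stdPair_le hV, eventually_fix_stdPair_le hW] with n h1 h2
  have := finite_fixedSet (h1.trans hf.1)
  have := finite_fixedSet (h2.trans hf'.1)
  have e1 (x) : f (Sum.inl x) ∈ fixedSet Z n ↔ x ∈ fixedSet X n := forall₂_congr fun g hg => by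
    rw [← hf.sm (h1 hg)]
    exact f.injective.eq_iff.trans Sum.inl_injective.eq_iff
  have e2 (y) : f (Sum.inr y) ∈ fixedSet Z n ↔ y ∈ fixedSet Y n := forall₂_congr fun g hg => by
    rw [← hf'.sm (h2 hg)]
    exact f.injective.eq_iff.trans Sum.inr_injective.eq_iff
  rw [← Nat.card_sum]
  symm
  refine Nat.card_congr (Equiv.ofBijective (Sum.elim
    (fun x : fixedSet X n => (⟨f (Sum.inl x.1), (e1 _).mpr x.2⟩ : fixedSet Z n))
    (fun y : fixedSet Y n => (⟨f (Sum.inr y.1), (e2 _).mpr y.2⟩ : fixedSet Z n))) ⟨?_, ?_⟩)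
  · rintro (x | x) (y | y) h
    · exact congrArg _ (Subtype.ext (Sum.inl_injective (f.injective (congrArg Subtype.val h))))
    · exact absurd (f.injective (congrArg Subtype.val h)) (by simp)
    · exact absurd (f.injective (congrArg Subtype.val h)) (by simp)
    · exact congrArg _ (Subtype.ext (Sum.inr_injective (f.injective (congrArg Subtype.val h))))
  · rintro ⟨z, hz⟩
    obtain ⟨x | y, rfl⟩ := f.surjective z
    · exact ⟨Sum.inl ⟨x, (e1 x).mp hz⟩, rfl⟩
    · exact ⟨Sum.inr ⟨y, (e2 y).mp hz⟩, rfl⟩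

/-- The germ at infinity of the function counting the points fixed by the stabilizers of the
standard subspaces. -/
noncomputable def counting (X : HatSet (openClass F)) : Germ (atTop : Filter ℕ) ℚ :=
  ((fun n => (Nat.card (fixedSet X n) : ℚ) : ℕ → ℚ) : Germ (atTop : Filter ℕ) ℚ)

/-- The isomorphism, disjoint union, twist and fiber identities are established only for `n` large,
with a bound depending on the sets and maps involved; this is why the values are germs. -/
theorem isMeasure_counting [Finite F] : IsMeasure (counting (F := F)) where
  iso X Y h := Germ.coe_eq.mpr ((eventually_card_iso h).mono fun n hn => by simp only [hn])
  singleton X h := by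
    obtain ⟨x, hx⟩ := h
    refine Germ.coe_eq.mpr (Eventually.of_forall fun n => ?_)
    have : Unique (fixedSet X n) :=
      { default := ⟨x, fun g _ => hx _⟩
        uniq := fun y => Subtype.ext (hx y) }
    simp
  coprod Z X Y h := Germ.coe_eq.mpr ((eventually_card_coprod h).mono fun n hn => by simp [hn])
  twist g X Y h := Germ.coe_eq.mpr ((eventually_card_twist h).mono fun n hn => by simp only [hn])
  fiber A Y X h := Germ.coe_eq.mpr ((eventually_card_fiber h).mono fun n hn => by simp [hn])

end GLinf

namespace GLinf

open HatSet

variable {F : Type u} [Field F]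

/-! ## Counting embeddings -/

/-- A nonzero functional that kills the image would have coefficients `f_i` with `∑ f_i u_i` in the
left kernel of `B`, which is zero, against independence. -/
theorem surjective_of_linearIndependent {V V' ι : Type*} [AddCommGroup V] [Module F V]
    [AddCommGroup V'] [Module F V'] [Fintype ι] (B : V →ₗ[F] V' →ₗ[F] F)
    (hB : Function.Injective B) {u : ι → V} (hu : LinearIndependent F u) :
    Function.Surjective (LinearMap.pi fun i => B (u i)) := by
  classical
  rw [← LinearMap.range_eq_top]
  by_contra hne
  obtain ⟨f, hf, hle⟩ := Submodule.exists_le_ker_of_lt_top _ (lt_top_iff_ne_top.mpr hne)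
  have h0 : ∑ i, f (Pi.single i 1) • u i = 0 := by
    apply hB
    rw [map_zero]
    ext y
    have h1 : f (LinearMap.pi (fun i => B (u i)) y) = 0 := hle ⟨y, rfl⟩
    rw [LinearMap.pi_apply_eq_sum_univ] at h1
    have hs (i : ι) : (fun j => if i = j then (1 : F) else 0) = Pi.single i 1 := by
      ext j
      simp [Pi.single_apply, eq_comm]
    simpa [mul_comm, hs] using h1
  have h1 := Fintype.linearIndependent_iff.mp hu _ h0
  apply hf
  refine LinearMap.pi_ext' fun i => LinearMap.ext_ring ?_
  simpa using h1 i

/-- Since `φ` kills the right family and keeps the left one independent, the two spans meet only in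
`0`. -/
theorem linearIndependent_sum_iff {V U α β : Type*} [AddCommGroup V] [Module F V]
    [AddCommGroup U] [Module F U] [Fintype α] (φ : V →ₗ[F] U) {v : α ⊕ β → V}
    (h1 : LinearIndependent F (φ ∘ v ∘ Sum.inl)) (h2 : ∀ j, φ (v (Sum.inr j)) = 0) :
    LinearIndependent F v ↔ LinearIndependent F (v ∘ Sum.inr) := by
  rw [linearIndependent_sum]
  refine ⟨fun h => h.2.1, fun h => ⟨h1.of_comp φ, h, ?_⟩⟩
  rw [Submodule.disjoint_def]
  intro x hx hx'
  obtain ⟨c, rfl⟩ := (Submodule.mem_span_range_iff_exists_fun F).mp hx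
  have h0 : φ (∑ i, c i • (v ∘ Sum.inl) i) = 0 := by
    have : Submodule.span F (Set.range (v ∘ Sum.inr)) ≤ LinearMap.ker φ := by
      rw [Submodule.span_le]
      rintro _ ⟨j, rfl⟩
      exact h2 j
    exact this hx'
  rw [map_sum] at h0
  have := Fintype.linearIndependent_iff.mp h1 c (by simpa using h0)
  simp [this]

variable [Finite F]

/-- Subtraction takes place in `ℚ`, and the formula needs no bound on the length: for a family
longer than the dimension, one factor of the product vanishes. -/
theorem card_linearIndependent_eq (V : Type*) [AddCommGroup V] [Module F V] [Module.Finite F V]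
    (ι : Type*) [Fintype ι] :
    (Nat.card {v : ι → V // LinearIndependent F v} : ℚ) =
      ∏ i ∈ Finset.range (Fintype.card ι),
        ((Nat.card F : ℚ) ^ Module.finrank F V - (Nat.card F : ℚ) ^ i) := by
  have := Fintype.ofFinite F
  let e := Fintype.equivFin ι
  have h1 : Nat.card {v : ι → V // LinearIndependent F v} =
      Nat.card {v : Fin (Fintype.card ι) → V // LinearIndependent F v} :=
    Nat.card_congr ((e.arrowCongr (Equiv.refl V)).subtypeEquiv fun v =>
      (linearIndependent_equiv e.symm (f := v)).symm)
  have := Module.finite_of_finite F (M := V)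
  rw [h1]
  by_cases h : Fintype.card ι ≤ Module.finrank F V
  · rw [card_linearIndependent h, Nat.cast_prod, ← Fin.prod_univ_eq_prod_range]
    refine Finset.prod_congr rfl fun i _ => ?_
    rw [Nat.cast_sub (Nat.pow_le_pow_right Fintype.card_pos (i.2.le.trans h))]
    simp [Nat.card_eq_fintype_card]
  · rw [Finset.prod_eq_zero (i := Module.finrank F V) (by simpa using h) (sub_self _)]
    have : IsEmpty {v : Fin (Fintype.card ι) → V // LinearIndependent F v} :=
      ⟨fun v => h (by simpa using v.2.fintype_card_le_finrank)⟩
    simp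

/-- The number of linearly independent families extending, along a surjection, a linearly
independent family by zeros. -/
theorem card_lift_linearIndependent {V U α β : Type*} [AddCommGroup V] [Module F V]
    [Module.Finite F V] [AddCommGroup U] [Module F U] [Fintype α] [Fintype β] (φ : V →ₗ[F] U)
    (hφ : Function.Surjective φ) {g : α → U} (hg : LinearIndependent F g) :
    (Nat.card {v : α ⊕ β → V // LinearIndependent F v ∧ (∀ i, φ (v (Sum.inl i)) = g i) ∧
      ∀ j, φ (v (Sum.inr j)) = 0} : ℚ) =
      ((Nat.card F : ℚ) ^ (Module.finrank F V - Module.finrank F U)) ^ Fintype.card α *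
        ∏ i ∈ Finset.range (Fintype.card β),
          ((Nat.card F : ℚ) ^ (Module.finrank F V - Module.finrank F U) - (Nat.card F : ℚ) ^ i) := by
  have hk : Module.finrank F (LinearMap.ker φ) = Module.finrank F V - Module.finrank F U := by
    have := φ.finrank_range_add_finrank_ker
    rw [LinearMap.range_eq_top.mpr hφ, finrank_top] at this
    omega
  choose y hy using fun i => hφ (g i)
  let K := LinearMap.ker φ
  have hind {v : α ⊕ β → V} (h1 : ∀ i, φ (v (Sum.inl i)) = g i) (h2 : ∀ j, φ (v (Sum.inr j)) = 0) :
      LinearIndependent F v ↔ LinearIndependent F (v ∘ Sum.inr) :=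
    linearIndependent_sum_iff φ ((funext h1 : φ ∘ v ∘ Sum.inl = g) ▸ hg) h2
  have hK {w : β → K} : LinearIndependent F w ↔ LinearIndependent F (fun j => (w j : V)) :=
    (LinearMap.linearIndependent_iff K.subtype K.ker_subtype).symm
  -- Subtracting a fixed lift `y` of `g` makes the left vectors arbitrary elements of the kernel,
  -- while the right vectors form any independent family in the kernel.
  let e : {v : α ⊕ β → V // LinearIndependent F v ∧ (∀ i, φ (v (Sum.inl i)) = g i) ∧
      ∀ j, φ (v (Sum.inr j)) = 0} ≃ (α → K) × {w : β → K // LinearIndependent F w} :=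
    { toFun := fun v => (fun i => ⟨v.1 (Sum.inl i) - y i, by
          simp [K, v.2.2.1 i, hy]⟩, ⟨fun j => ⟨v.1 (Sum.inr j), v.2.2.2 j⟩,
            hK.mpr ((hind v.2.2.1 v.2.2.2).mp v.2.1)⟩)
      invFun := fun p => ⟨Sum.elim (fun i => (p.1 i : V) + y i) (fun j => (p.2.1 j : V)), by
        have h1 : ∀ i, φ ((p.1 i : V) + y i) = g i := fun i => by
          rw [map_add, hy, LinearMap.mem_ker.mp (p.1 i).2, zero_add]
        have h2 : ∀ j, φ (p.2.1 j : V) = 0 := fun j => (p.2.1 j).2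
        exact ⟨(hind (v := Sum.elim _ _) h1 h2).mpr (hK.mp p.2.2), h1, h2⟩⟩
      left_inv := fun v => Subtype.ext (funext fun i => by cases i <;> simp)
      right_inv := fun p => Prod.ext (funext fun i => Subtype.ext (by simp))
        (Subtype.ext (funext fun j => rfl)) }
  rw [Nat.card_congr e, Nat.card_prod, Nat.cast_mul, card_linearIndependent_eq, hk, Nat.card_fun,
    Module.natCard_eq_pow_finrank (K := F) (V := K), hk, Nat.card_eq_fintype_card (α := α)]
  push_cast
  rfl

/-! ## Measures relative to all open subgroups -/

/-- Let `A` and `B` be the supports of `U` and `V ≤ U`. Computing the measure of `U / fix B` through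
`V` and through `fix A` gives `μ(U/V) [V : fix B] = [U : fix A] μ(fix A / fix B)`. The last factor
is covered by `measure_mem`, and the index on the left is invertible in `S`. -/
theorem measure_mem_of_open {k : Type v} [CommRing k] {μ : HatSet (openClass F) → k}
    (hμ : IsMeasure μ) (S : Subring k) (hS : ∀ n : ℕ, n ≠ 0 → ∃ r ∈ S, r * (n : k) = 1)
    (h : μ ((embSet F 0 1 0).ofSubset (pointClass_subset_openClass F)) ∈ S)
    (X : HatSet (openClass F)) : μ X ∈ S := by
  have hE := conjStable_openClass (F := F)
  have hfix {W : Pair F} (hW : FG W) : fix W ∈ openClass F :=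
    pointClass_subset_openClass F (fix_mem_pointClass hW)
  have index {V : Subgroup (GLinf F)} (hV : V ∈ openClass F) {B : Pair F} (hB : IsSupport V B) :
      ∃ n : ℕ, n ≠ 0 ∧ μ (coset hE hV (hfix hB.fg) hB.fix_le) = n := by
    have hfin : Finite (V ⧸ (fix B).subgroupOf V) := hB.finite_quotient
    have : Finite (coset hE hV (hfix hB.fg) hB.fix_le).carrier := hfin
    refine ⟨Nat.card (V ⧸ (fix B).subgroupOf V), Nat.card_pos.ne', ?_⟩
    -- The group `fix B` is normal in `V`, so it acts trivially on the finite set `V / fix B`.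
    refine hμ.eq_card (X := coset hE hV (hfix hB.fg) hB.fix_le) (hfix hB.fg) hB.fix_le
      fun w hw x => ?_
    obtain ⟨g, rfl⟩ := QuotientGroup.mk_surjective x
    refine (coset_sm hE hV (hfix hB.fg) hB.fix_le (hB.fix_le hw) g).trans (Eq.symm
      (QuotientGroup.eq.mpr ?_))
    rw [Subgroup.mem_subgroupOf]
    simpa [mul_assoc] using hB.conj_mem g.2 hw
  refine hμ.mem_of_isTransitive S (fun X hX => ?_) X
  obtain ⟨x⟩ := hX.1
  obtain ⟨A, hA⟩ := exists_isSupport X.grp_mem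
  obtain ⟨B, hB⟩ := exists_isSupport (X.stb_mem x)
  have hAB : A ≤ B := hA.least B hB.fg (hB.fix_le.trans (X.stb_le x))
  obtain ⟨n, hn, en⟩ := index (X.stb_mem x) hB
  obtain ⟨m, -, em⟩ := index X.grp_mem hA
  have e1 := hμ.coset_mul hE X.grp_mem (X.stb_mem x) (hfix hB.fg) (X.stb_le x) hB.fix_le
  have e2 := hμ.coset_mul hE X.grp_mem (hfix hA.fg) (hfix hB.fg) hA.fix_le (fix_anti hAB)
  have e3 := hμ.iso _ _ (iso_coset hE (X.stb_mem x) (X.stb_le x) hX x rfl)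
  have e4 : μ (coset hE (hfix hA.fg) (hfix hB.fg) (fix_anti hAB)) ∈ S :=
    measure_mem (hμ.ofSubset (pointClass_subset_openClass F)) S
      (hS _ Nat.card_pos.ne') h (quot hA.fg hB.fg hAB)
  obtain ⟨r, hr, hrn⟩ := hS n hn
  rw [en, e3] at e1
  rw [em] at e2
  have : μ X = r * (m * μ (coset hE (hfix hA.fg) (hfix hB.fg) (fix_anti hAB))) := by
    rw [← e2, e1]
    linear_combination -(μ X) * hrn
  rw [this]
  exact mul_mem hr (mul_mem (natCast_mem S m) e4)

end GLinf

/-! ### The number of embeddings of `V_{a,b,c}` in `V_{l,0,0}` -/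

namespace PairedSpace

variable {F : Type u} [Field F]

/-- The form of `V_{a,b,c}`. -/
noncomputable def stdForm (F : Type u) [Field F] (a b c : ℕ) :
    (Fin a ⊕ Fin b → F) →ₗ[F] (Fin a ⊕ Fin c → F) →ₗ[F] F := (std F a b c).form

theorem stdForm_apply (a b c : ℕ) (x : Fin a ⊕ Fin b → F) (y : Fin a ⊕ Fin c → F) :
    stdForm F a b c x y = ∑ i : Fin a, x (Sum.inl i) * y (Sum.inl i) := by
  have : stdForm F a b c = ∑ i : Fin a, (LinearMap.mul F F).compl₁₂
    (LinearMap.proj (Sum.inl i)) (LinearMap.proj (Sum.inl i)) := rfl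
  rw [this, LinearMap.sum_apply, LinearMap.sum_apply]
  rfl

/-- The form of `V_{a,b,c}` between standard basis vectors. -/
noncomputable def gram (F : Type u) [Field F] (a b c : ℕ) (i : Fin a ⊕ Fin b)
    (j : Fin a ⊕ Fin c) : F :=
  stdForm F a b c (Pi.single i 1) (Pi.single j 1)

theorem gram_inl_inl (a b c : ℕ) (i j : Fin a) :
    gram F a b c (Sum.inl i) (Sum.inl j) = if i = j then 1 else 0 := by
  rw [gram, stdForm_apply]
  simp [Pi.single_apply, eq_comm]

theorem gram_inr_left (a b c : ℕ) (i : Fin b) (j : Fin a ⊕ Fin c) :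
    gram F a b c (Sum.inr i) j = 0 := by
  rw [gram, stdForm_apply]
  simp

theorem gram_inr_right (a b c : ℕ) (i : Fin a ⊕ Fin b) (j : Fin c) :
    gram F a b c i (Sum.inr j) = 0 := by
  rw [gram, stdForm_apply]
  simp

theorem linearMap_eq_linearCombination {ι V : Type*} [Fintype ι] [DecidableEq ι] [AddCommGroup V]
    [Module F V] (f : (ι → F) →ₗ[F] V) :
    Fintype.linearCombination F (fun i => f (Pi.single i 1)) = f :=
  LinearMap.pi_ext' fun i => LinearMap.ext_ring (by simp [Fintype.linearCombination_apply_single])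

/-- Embeddings of `V_{a,b,c}` are pairs of linearly independent families with prescribed
pairings. -/
noncomputable def embEquiv (a b c : ℕ) (W : PairedSpace F) :
    Emb (std F a b c) W ≃ {p : (Fin a ⊕ Fin b → W.even) × (Fin a ⊕ Fin c → W.odd) //
      LinearIndependent F p.1 ∧ LinearIndependent F p.2 ∧
        ∀ i j, W.form (p.1 i) (p.2 j) = gram F a b c i j} where
  toFun f := ⟨(fun i => f.even (Pi.single i (1 : F) : Fin a ⊕ Fin b → F),
      fun j => f.odd (Pi.single j (1 : F) : Fin a ⊕ Fin c → F)), by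
    refine ⟨linearIndependent_iff_injective_fintypeLinearCombination.mpr ?_,
      linearIndependent_iff_injective_fintypeLinearCombination.mpr ?_, fun i j => f.form_eq _ _⟩
    · exact (linearMap_eq_linearCombination f.even).symm ▸ f.even_injective
    · exact (linearMap_eq_linearCombination f.odd).symm ▸ f.odd_injective⟩
  invFun p :=
    { even := Fintype.linearCombination F p.1.1
      odd := Fintype.linearCombination F p.1.2
      even_injective := linearIndependent_iff_injective_fintypeLinearCombination.mp p.2.1
      odd_injective := linearIndependent_iff_injective_fintypeLinearCombination.mp p.2.2.1
      form_eq := by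
        have h : W.form.compl₁₂ (Fintype.linearCombination F p.1.1)
            (Fintype.linearCombination F p.1.2) = (std F a b c).form := by
          refine LinearMap.pi_ext' fun i => LinearMap.ext_ring ?_
          refine LinearMap.pi_ext' fun j => LinearMap.ext_ring ?_
          refine Eq.trans ?_ (p.2.2.2 i j)
          simp [Fintype.linearCombination_apply_single]
        exact fun x y => LinearMap.congr_fun (LinearMap.congr_fun h x) y }
  left_inv f := Emb.ext (linearMap_eq_linearCombination f.even)
    (linearMap_eq_linearCombination f.odd)
  right_inv p := by
    refine Subtype.ext (Prod.ext (funext fun i => ?_) (funext fun i => ?_))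
    · exact (Fintype.linearCombination_apply_single F p.1.1 i 1).trans (one_smul F _)
    · exact (Fintype.linearCombination_apply_single F p.1.2 i 1).trans (one_smul F _)

theorem stdForm_injective (l : ℕ) : Function.Injective (stdForm F l 0 0) := by
  rw [injective_iff_map_eq_zero]
  intro x hx
  funext i
  rcases i with i | i
  · have := LinearMap.congr_fun hx (Pi.single (Sum.inl i) (1 : F))
    rw [stdForm_apply] at this
    simpa [Pi.single_apply] using this
  · exact i.elim0

/-- Choose the `a + b` even vectors first, as any independent family. Pairing with them is then a
surjection onto `F ^ (a + b)`, and the odd vectors are `a` lifts of unit vectors followed by `c`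
independent vectors of its kernel, which has dimension `l - (a + b)`. The power of `q` on the left
clears the denominators. -/
theorem card_emb_std [Finite F] (a b c l : ℕ) :
    (Nat.card (Emb (std F a b c) (std F l 0 0)) : ℚ) * (Nat.card F : ℚ) ^ ((a + b) * (a + c)) =
      ((Nat.card F : ℚ) ^ l) ^ a *
        ∏ i ∈ Finset.range (a + b + c), ((Nat.card F : ℚ) ^ l - (Nat.card F : ℚ) ^ i) := by
  classical
  let V := Fin l ⊕ Fin 0 → F
  set q : ℚ := (Nat.card F : ℚ) with hq
  have hV : Module.finrank F V = l := by simp [V]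
  let φ (u : Fin a ⊕ Fin b → V) : V →ₗ[F] (Fin a ⊕ Fin b → F) :=
    LinearMap.pi fun i => stdForm F l 0 0 (u i)
  let g (i : Fin a) : Fin a ⊕ Fin b → F := Pi.single (Sum.inl i) 1
  have hg : LinearIndependent F g := by
    have : g = Pi.basisFun F (Fin a ⊕ Fin b) ∘ Sum.inl :=
      funext fun i => (Pi.basisFun_apply F _ _).symm
    rw [this]
    exact (Pi.basisFun F (Fin a ⊕ Fin b)).linearIndependent.comp Sum.inl Sum.inl_injective
  let P (u : Fin a ⊕ Fin b → V) (v : Fin a ⊕ Fin c → V) : Prop := LinearIndependent F v ∧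
    (∀ i, φ u (v (Sum.inl i)) = g i) ∧ ∀ j, φ u (v (Sum.inr j)) = 0
  have hP (u v) : (LinearIndependent F v ∧ ∀ i j, stdForm F l 0 0 (u i) (v j) = gram F a b c i j) ↔
      P u v := by
    refine and_congr_right fun _ => ⟨fun h => ⟨fun j => funext fun i => ?_,
      fun j => funext fun i => ?_⟩, fun h i j => ?_⟩
    · refine (h i (Sum.inl j)).trans ?_
      rcases i with i | i
      · simp [gram_inl_inl, g, Pi.single_apply]
      · simp [gram_inr_left, g]
    · exact (h i (Sum.inr j)).trans (gram_inr_right a b c i j)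
    · rcases j with j | j
      · refine (congrFun (h.1 j) i).trans ?_
        rcases i with i | i
        · simp [gram_inl_inl, g, Pi.single_apply]
        · simp [gram_inr_left, g]
      · exact (congrFun (h.2 j) i).trans (gram_inr_right a b c i j).symm
  let e : Emb (std F a b c) (std F l 0 0) ≃
      Σ u : {u : Fin a ⊕ Fin b → V // LinearIndependent F u}, {v : Fin a ⊕ Fin c → V // P u v} :=
    (embEquiv a b c (std F l 0 0)).trans
      { toFun := fun p => ⟨⟨p.1.1, p.2.1⟩, ⟨p.1.2, (hP _ _).mp p.2.2⟩⟩
        invFun := fun p => ⟨(p.1.1, p.2.1), p.1.2, (hP _ _).mpr p.2.2⟩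
        left_inv := fun _ => rfl
        right_inv := fun _ => rfl }
  have : Finite V := Module.finite_of_finite F
  have := Fintype.ofFinite {u : Fin a ⊕ Fin b → V // LinearIndependent F u}
  have hcard := GLinf.card_linearIndependent_eq (F := F) V (Fin a ⊕ Fin b)
  have hm : Fintype.card (Fin a ⊕ Fin b) = a + b := by simp
  rw [hm, hV, ← hq] at hcard
  have key (u : {u : Fin a ⊕ Fin b → V // LinearIndependent F u}) :
      (Nat.card {v : Fin a ⊕ Fin c → V // P u v} : ℚ) =
        (q ^ (l - (a + b))) ^ a * ∏ i ∈ Finset.range c, (q ^ (l - (a + b)) - q ^ i) := by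
    have hs : Function.Surjective (φ u.1) :=
      GLinf.surjective_of_linearIndependent (V := V) (V' := V) (stdForm F l 0 0)
        (stdForm_injective l) u.2
    have := GLinf.card_lift_linearIndependent (β := Fin c) (φ u.1) hs hg
    rw [hV, Module.finrank_fintype_fun_eq_card, hm, Fintype.card_fin, Fintype.card_fin] at this
    exact this
  rw [Nat.card_congr e, Nat.card_sigma, Nat.cast_sum, Finset.sum_congr rfl fun u _ => key u,
    Finset.sum_const, nsmul_eq_mul, Finset.card_univ, ← Nat.card_eq_fintype_card, hcard,
    Finset.prod_range_add (fun i => q ^ l - q ^ i) (a + b) c]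
  -- The factor `q ^ (a + b)` turns `q ^ d - q ^ i` into `q ^ l - q ^ (a + b + i)`. If `l < a + b`,
  -- the truncated exponent is meaningless, but the factor with index `l` vanishes on both sides.
  by_cases h : a + b ≤ l
  · obtain ⟨d, rfl⟩ := Nat.exists_eq_add_of_le h
    have h1 : ∀ i, q ^ (a + b + d) - q ^ (a + b + i) = q ^ (a + b) * (q ^ d - q ^ i) := fun i => by
      ring
    simp only [h1, Finset.prod_mul_distrib, Finset.prod_const, Finset.card_range,
      Nat.add_sub_cancel_left]
    ring
  · rw [Finset.prod_eq_zero (i := l) (Finset.mem_range.mpr (by omega)) (sub_self _)]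
    simp

end PairedSpace

/-! ### The fixed points of `X_{a,b,c}` -/

namespace GLinf

open HatSet Filter

variable {F : Type u} [Field F]

/-- The inclusion of a piece of `V_{n,0,0}` in `𝐕`. -/
noncomputable def incl (F : Type u) [Field F] (n : ℕ) : (Fin n ⊕ Fin 0 → F) →ₗ[F] Vec F :=
  ∑ i : Fin n, (Finsupp.lsingle (i : ℕ)).comp (LinearMap.proj (Sum.inl i))

/-- The restriction to the first `n` coordinates. -/
noncomputable def restr (F : Type u) [Field F] (n : ℕ) : Vec F →ₗ[F] (Fin n ⊕ Fin 0 → F) :=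
  LinearMap.pi fun i => Finsupp.lapply (Sum.elim (fun i : Fin n => (i : ℕ)) Fin.elim0 i)

theorem incl_apply (n : ℕ) (x : Fin n ⊕ Fin 0 → F) :
    incl F n x = ∑ i : Fin n, Finsupp.single (i : ℕ) (x (Sum.inl i)) := by
  simp [incl]

theorem incl_mem (n : ℕ) (x : Fin n ⊕ Fin 0 → F) : incl F n x ∈ std F n := by
  rw [incl_apply]
  exact Submodule.sum_mem _ fun i _ => single_mem_std i.2 _

theorem restr_incl (n : ℕ) (x : Fin n ⊕ Fin 0 → F) : restr F n (incl F n x) = x := by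
  funext i
  rcases i with i | i
  · simp [restr, incl_apply, Finsupp.single_apply, Fin.val_inj]
  · exact i.elim0

theorem incl_restr (n : ℕ) {x : Vec F} (hx : x ∈ std F n) : incl F n (restr F n x) = x := by
  ext k
  rw [incl_apply, Finsupp.finsetSum_apply]
  by_cases hk : k < n
  · rw [Finset.sum_eq_single ⟨k, hk⟩]
    · simp [restr]
    · intro i _ hi
      exact Finsupp.single_eq_of_ne fun h => hi (Fin.ext h.symm)
    · simp
  · rw [hx k (by omega)]
    exact Finset.sum_eq_zero fun i _ => Finsupp.single_eq_of_ne (by omega)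

theorem form_incl (n : ℕ) (x y : Fin n ⊕ Fin 0 → F) :
    PairedSpace.infForm F (incl F n x) (incl F n y) = PairedSpace.stdForm F n 0 0 x y := by
  have h (i : Fin n) : incl F n y (i : ℕ) = y (Sum.inl i) :=
    congrFun (restr_incl n y) (Sum.inl i)
  rw [PairedSpace.stdForm_apply, incl_apply, map_sum, LinearMap.sum_apply]
  refine Finset.sum_congr rfl fun i _ => ?_
  rw [infForm_comm, infForm_single_right, h, mul_comm]

theorem mem_std_of_forall_act {n : ℕ} {s : Bool} {x : Vec F}
    (h : ∀ g ∈ fix (stdPair F n), act s g x = x) : x ∈ std F n :=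
  line_le.mp (le_of_fix_le (FG.stdPair n) fun g hg => mem_fix_line.mpr (h g hg))

/-- An embedding is fixed by `fix (stdPair F n)` exactly when its image lies in the standard
subspaces, because `mem_std_of_forall_act` shows that this group fixes no other vector. The
inclusion `incl` identifies these subspaces, with their pairing, with `V_{n,0,0}`. -/
theorem card_fixedSet_embSet [Finite F] (a b c n : ℕ) :
    Nat.card (fixedSet ((embSet F a b c).ofSubset (pointClass_subset_openClass F)) n) =
      Nat.card (PairedSpace.Emb (PairedSpace.std F a b c) (PairedSpace.std F n 0 0)) := by
  let A := PairedSpace.std F a b c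
  let X := (embSet F a b c).ofSubset (pointClass_subset_openClass F)
  have hinj : Function.Injective (incl F n) := Function.LeftInverse.injective (restr_incl n)
  let f (i : PairedSpace.Emb A (PairedSpace.std F n 0 0)) :
      PairedSpace.Emb A (PairedSpace.inf F) :=
    { even := (incl F n) ∘ₗ i.even
      odd := (incl F n) ∘ₗ i.odd
      even_injective := hinj.comp i.even_injective
      odd_injective := hinj.comp i.odd_injective
      form_eq := fun x y => (form_incl n _ _).trans (i.form_eq x y) }
  have hsm (g : GLinf F) (i : PairedSpace.Emb A (PairedSpace.inf F)) : X.sm g i = g • i :=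
    sm_of_mem (X := X) trivial i
  have hf (i) : f i ∈ fixedSet X n := fun g hg => (hsm g _).trans
    (PairedSpace.Emb.ext (LinearMap.ext fun x => hg true _ (incl_mem n _))
      (LinearMap.ext fun x => hg false _ (incl_mem n _)))
  symm
  refine Nat.card_congr (Equiv.ofBijective (fun i => (⟨f i, hf i⟩ : fixedSet X n)) ⟨?_, ?_⟩)
  · intro i j hij
    have h : f i = f j := congrArg Subtype.val hij
    exact PairedSpace.Emb.ext
      (LinearMap.ext fun x => hinj (LinearMap.congr_fun (congrArg PairedSpace.Emb.even h) x))
      (LinearMap.ext fun x => hinj (LinearMap.congr_fun (congrArg PairedSpace.Emb.odd h) x))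
  · rintro ⟨i, hi⟩
    let j : PairedSpace.Emb A (PairedSpace.inf F) := i
    have he (x) : j.even x ∈ std F n := mem_std_of_forall_act (s := true) fun g hg =>
      LinearMap.congr_fun (congrArg PairedSpace.Emb.even ((hsm g j).symm.trans (hi g hg))) x
    have ho (x) : j.odd x ∈ std F n := mem_std_of_forall_act (s := false) fun g hg =>
      LinearMap.congr_fun (congrArg PairedSpace.Emb.odd ((hsm g j).symm.trans (hi g hg))) x
    let r : Vec F →ₗ[F] (Fin n ⊕ Fin 0 → F) := restr F n
    refine ⟨
      { even := r ∘ₗ j.even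
        odd := r ∘ₗ j.odd
        even_injective := fun x y h => j.even_injective
          ((incl_restr n (he x)).symm.trans ((congrArg (incl F n) h).trans (incl_restr n (he y))))
        odd_injective := fun x y h => j.odd_injective
          ((incl_restr n (ho x)).symm.trans ((congrArg (incl F n) h).trans (incl_restr n (ho y))))
        form_eq := fun x y => ?_ }, ?_⟩
    · refine Eq.trans ?_ (j.form_eq x y)
      refine (form_incl n _ _).symm.trans ?_
      exact congrArg₂ (fun v w => PairedSpace.infForm F v w) (incl_restr n (he x))
        (incl_restr n (ho y))
    · refine Subtype.ext (PairedSpace.Emb.ext (LinearMap.ext fun x => ?_)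
        (LinearMap.ext fun x => ?_))
      · exact incl_restr n (he x)
      · exact incl_restr n (ho x)

end GLinf

/-! ## Comparison of the rings -/

namespace ZInv

variable {q : ℕ}

theorem inv_mul (q : ℕ) : ZInv.inv q * (q : ZInv q) = 1 := by
  have := IsLocalization.Away.mul_invSelf (S := ZInv q) (q : ℤ)
  rw [mul_comm]
  simpa [ZInv.inv] using this

theorem ringHom_ext {K : Type*} [CommRing K] {f g : ZInv q →+* K} : f = g :=
  IsLocalization.ringHom_ext (Submonoid.powers (q : ℤ)) (Subsingleton.elim _ _)

theorem toRat_injective (hq : q ≠ 0) : Function.Injective (toRat q hq) := by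
  rw [injective_iff_map_eq_zero]
  intro x hx
  obtain ⟨n, a, h⟩ := IsLocalization.Away.surj (q : ℤ) x
  have h1 := congrArg (toRat q hq) h
  have h2 : toRat q hq (algebraMap ℤ (ZInv q) a) = (a : ℚ) := by simp
  rw [map_mul, hx, zero_mul, h2] at h1
  have ha : a = 0 := by exact_mod_cast h1.symm
  rw [ha, map_zero] at h
  have h3 : x * (algebraMap ℤ (ZInv q) q) ^ n * ZInv.inv q ^ n = x := by
    rw [mul_assoc, ← mul_pow, mul_comm _ (ZInv.inv q)]
    simp [inv_mul]
  rw [← h3, h, zero_mul]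

end ZInv

/-- With denominators cleared, the formula matches the counts both in `ℚ` and in the ring of germs.
-/
theorem eval₂_countPoly {q : ℕ} {K : Type*} [CommRing K] (f : ZInv q →+* K) (x : K) (a b c : ℕ) :
    (countPoly q a b c).eval₂ f x * (q : K) ^ ((a + b) * (a + c)) =
      x ^ a * ∏ i ∈ Finset.range (a + b + c), (x - (q : K) ^ i) := by
  have h : f (ZInv.inv q) * (q : K) = 1 := by
    have := congrArg f (ZInv.inv_mul q)
    simpa using this
  simp only [countPoly, Polynomial.eval₂_mul, Polynomial.eval₂_C, Polynomial.eval₂_pow,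
    Polynomial.eval₂_X, Polynomial.eval₂_finsetProd, Polynomial.eval₂_sub, map_pow, map_natCast,
    Polynomial.eval₂_natCast]
  have h' : f (ZInv.inv q) ^ ((a + b) * (a + c)) * (q : K) ^ ((a + b) * (a + c)) = 1 := by
    rw [← mul_pow, h, one_pow]
  linear_combination (x ^ a * ∏ i ∈ Finset.range (a + b + c), (x - (q : K) ^ i)) * h'

/-! ### Polynomials in the germ of `q ^ n` -/

namespace GLinf

open HatSet Filter

/-- Germs at infinity of rational sequences. -/
abbrev SeqGerm : Type := Germ (atTop : Filter ℕ) ℚ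

/-- The germs of constant sequences. -/
noncomputable def constGerm : ℚ →+* SeqGerm := (Germ.coeRingHom atTop).comp (algebraMap ℚ (ℕ → ℚ))

/-- The germ of the sequence `q ^ n`. -/
noncomputable def powGerm (q : ℕ) : SeqGerm := Germ.coeRingHom atTop fun n => (q : ℚ) ^ n

theorem eval₂_powGerm (q : ℕ) (p : ℚ[X]) :
    p.eval₂ constGerm (powGerm q) = Germ.coeRingHom atTop fun n => p.eval ((q : ℚ) ^ n) := by
  rw [constGerm, powGerm, ← Polynomial.hom_eval₂]
  refine congrArg _ (funext fun n => ?_)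
  refine (Polynomial.hom_eval₂ p (algebraMap ℚ (ℕ → ℚ)) (Pi.evalRingHom (fun _ => ℚ) n) _).trans ?_
  exact congrArg (fun f => Polynomial.eval₂ f _ p) (Subsingleton.elim _ _)

/-- A polynomial that vanishes at `q ^ n` for all large `n` has infinitely many roots. -/
theorem eval₂_powGerm_injective {q : ℕ} (hq : 1 < q) :
    Function.Injective (Polynomial.eval₂RingHom constGerm (powGerm q)) := by
  rw [injective_iff_map_eq_zero]
  intro p hp
  rw [Polynomial.coe_eval₂RingHom, eval₂_powGerm] at hp
  obtain ⟨N, hN⟩ := eventually_atTop.mp (Germ.coe_eq.mp hp)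
  refine Polynomial.eq_zero_of_infinite_isRoot p ?_
  refine Set.infinite_of_injective_forall_mem (f := fun n : ℕ => (q : ℚ) ^ (N + n)) ?_
    fun n => hN (N + n) (Nat.le_add_right _ _)
  intro m n h
  have h : (q : ℚ) ^ (N + m) = (q : ℚ) ^ (N + n) := h
  have := Nat.pow_right_injective hq (show q ^ (N + m) = q ^ (N + n) by exact_mod_cast h)
  omega

theorem isUnit_natCast_seqGerm {n : ℕ} (hn : n ≠ 0) : IsUnit (n : SeqGerm) := by
  have : IsUnit (n : ℚ) := by simpa using hn
  simpa using this.map constGerm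

variable (F : Type u) [Field F] [Finite F]

/-- The `G`-set `X_{a,b,c}` as a smooth set for the class of open subgroups. -/
noncomputable abbrev embOpen (a b c : ℕ) : HatSet (openClass F) :=
  (embSet F a b c).ofSubset (pointClass_subset_openClass F)

variable {F}

theorem counting_embOpen (a b c : ℕ) :
    counting (embOpen F a b c) * (Nat.card F : SeqGerm) ^ ((a + b) * (a + c)) =
      powGerm (Nat.card F) ^ a *
        ∏ i ∈ Finset.range (a + b + c), (powGerm (Nat.card F) - (Nat.card F : SeqGerm) ^ i) := by
  have h1 : counting (embOpen F a b c) = Germ.coeRingHom atTop fun n =>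
      (Nat.card (fixedSet (embOpen F a b c) n) : ℚ) := rfl
  rw [h1, powGerm, ← map_natCast (Germ.coeRingHom atTop)]
  simp only [← map_pow, ← map_sub, ← map_prod, ← map_mul]
  refine congrArg _ (funext fun n => ?_)
  simp only [Pi.mul_apply, Pi.pow_apply, Pi.natCast_apply, Finset.prod_apply, Pi.sub_apply]
  rw [card_fixedSet_embSet]
  exact PairedSpace.card_emb_std a b c n

theorem counting_embOpen_line : counting (embOpen F 0 1 0) = powGerm (Nat.card F) - 1 := by
  simpa using counting_embOpen (F := F) 0 1 0

theorem measure_ext_of_open {k : Type v} [CommRing k] {μ μ' : HatSet (openClass F) → k}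
    (hμ : IsMeasure μ) (hμ' : IsMeasure μ') (hk : ∀ n : ℕ, n ≠ 0 → IsUnit (n : k))
    (h : μ (embOpen F 0 1 0) = μ' (embOpen F 0 1 0)) (X : HatSet (openClass F)) : μ X = μ' X := by
  refine measure_mem_of_open (hμ.prod hμ') ((RingHom.fst k k).eqLocus (RingHom.snd k k))
    (fun n hn => ?_) h X
  obtain ⟨r, hr⟩ := (hk n hn).exists_left_inv
  exact ⟨(r, r), rfl, Prod.ext hr hr⟩

/-! ### The isomorphism for `Θ(G; 𝐕)[1/q]` -/

section point

variable (F) (L : Type*) [CommRing L] [Algebra (Theta (pointClass F)) L]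
  [IsLocalization.Away ((Nat.card F : ℕ) : Theta (pointClass F)) L]

/-- The map from `ℤ[1/q][t]` with `t ↦ 1 + [X_{0,1,0}]`. -/
noncomputable def polyToThetaLoc : (ZInv (Nat.card F))[X] →+* L :=
  Polynomial.eval₂RingHom
    (IsLocalization.Away.lift (g := Int.castRingHom L) (Nat.card F : ℤ)
      (by
        have := IsLocalization.Away.algebraMap_isUnit (S := L)
          ((Nat.card F : ℕ) : Theta (pointClass F))
        simpa using this))
    (1 + algebraMap _ L (Theta.cls (embSet F 0 1 0)))

theorem polyToThetaLoc_X :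
    polyToThetaLoc F L Polynomial.X = 1 + algebraMap _ L (Theta.cls (embSet F 0 1 0)) :=
  Polynomial.eval₂_X _ _

theorem polyToThetaLoc_X_sub_one :
    polyToThetaLoc F L (Polynomial.X - 1) = algebraMap _ L (Theta.cls (embSet F 0 1 0)) := by
  rw [RingHom.map_sub (α := (ZInv (Nat.card F))[X]), polyToThetaLoc_X, map_one,
    add_sub_cancel_left]

/-- The range is a subring that contains `1/q` and the class of `X_{0,1,0}`, hence all classes by
`measure_mem`; an element of the localization is such an element divided by a power of `q`. -/
theorem polyToThetaLoc_surjective : Function.Surjective (polyToThetaLoc F L) := by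
  have hr : polyToThetaLoc F L (Polynomial.C (ZInv.inv (Nat.card F))) *
      ((Nat.card F : ℕ) : L) = 1 := by
    have := congrArg (fun x => polyToThetaLoc F L (Polynomial.C x)) (ZInv.inv_mul (Nat.card F))
    simpa using this
  let S : Subring L := RingHom.range (R := (ZInv (Nat.card F))[X]) (polyToThetaLoc F L)
  have h1 (x : Theta (pointClass F)) : algebraMap _ L x ∈ S := by
    refine Theta.mem_of_cls_mem
      (Subring.comap (R := Theta (pointClass F)) (algebraMap (Theta (pointClass F)) L) S)
      (fun X => ?_) x
    exact measure_mem (Theta.isMeasure_cls.comp (algebraMap (Theta (pointClass F)) L)) S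
      ⟨_, ⟨_, rfl⟩, hr⟩ ⟨_, polyToThetaLoc_X_sub_one F L⟩ X
  intro y
  obtain ⟨n, a, h⟩ := IsLocalization.Away.surj ((Nat.card F : ℕ) : Theta (pointClass F)) y
  obtain ⟨p, hp⟩ := h1 a
  refine ⟨p * Polynomial.C (ZInv.inv (Nat.card F)) ^ n, ?_⟩
  rw [map_mul, map_pow, hp, ← h, mul_assoc, ← mul_pow, map_natCast, mul_comm _ (polyToThetaLoc F L _),
    hr, one_pow, mul_one]

/-- The counting measure on the localization of `Θ(G; 𝐕)`. -/
noncomputable def thetaLocToGerm : L →+* SeqGerm :=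
  IsLocalization.Away.lift
    (g := Theta.lift (isMeasure_counting.ofSubset (pointClass_subset_openClass F)))
    ((Nat.card F : ℕ) : Theta (pointClass F))
    (by
      rw [map_natCast]
      exact isUnit_natCast_seqGerm Nat.card_pos.ne')

theorem thetaLocToGerm_cls (X : HatSet (pointClass F)) :
    thetaLocToGerm F L (algebraMap _ L (Theta.cls X)) =
      counting (X.ofSubset (pointClass_subset_openClass F)) := by
  rw [thetaLocToGerm, IsLocalization.Away.lift_eq, Theta.lift_cls]

/-- Counting gives `X_{0,1,0}` the germ `q ^ n - 1`, so `t` goes to the germ of `q ^ n`. -/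
theorem thetaLocToGerm_comp :
    (thetaLocToGerm F L).comp (polyToThetaLoc F L) = (Polynomial.eval₂RingHom constGerm
      (powGerm (Nat.card F))).comp (Polynomial.mapRingHom (ZInv.toRat (Nat.card F)
        Nat.card_pos.ne')) := by
  refine Polynomial.ringHom_ext' ZInv.ringHom_ext ?_
  have := thetaLocToGerm_cls F L (embSet F 0 1 0)
  rw [counting_embOpen_line] at this
  simp [polyToThetaLoc_X, this]

theorem thetaLocToGerm_comp_injective :
    Function.Injective ((thetaLocToGerm F L).comp (polyToThetaLoc F L)) := by
  rw [thetaLocToGerm_comp, RingHom.coe_comp]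
  exact (eval₂_powGerm_injective Finite.one_lt_card).comp
    (Polynomial.map_injective _ (ZInv.toRat_injective _))

theorem polyToThetaLoc_bijective : Function.Bijective (polyToThetaLoc F L) :=
  ⟨Function.Injective.of_comp (f := thetaLocToGerm F L) (RingHom.coe_comp _ _ ▸
    thetaLocToGerm_comp_injective F L), polyToThetaLoc_surjective F L⟩

/-- Counting is faithful: an identity in `Θ(G; 𝐕)[1/q]` may be checked on numbers of fixed points.
-/
theorem thetaLocToGerm_injective : Function.Injective (thetaLocToGerm F L) := by
  intro x y h
  obtain ⟨p, rfl⟩ := polyToThetaLoc_surjective F L x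
  obtain ⟨r, rfl⟩ := polyToThetaLoc_surjective F L y
  exact congrArg _ (thetaLocToGerm_comp_injective F L h)

theorem polyToThetaLoc_countPoly (a b c : ℕ) :
    polyToThetaLoc F L (countPoly (Nat.card F) a b c) =
      algebraMap _ L (Theta.cls (embSet F a b c)) := by
  apply thetaLocToGerm_injective F L
  rw [thetaLocToGerm_cls]
  apply ((isUnit_natCast_seqGerm (n := Nat.card F) Nat.card_pos.ne').pow
    ((a + b) * (a + c))).mul_left_injective
  refine Eq.trans ?_ (counting_embOpen a b c).symm
  rw [← eval₂_countPoly (constGerm.comp (ZInv.toRat (Nat.card F) Nat.card_pos.ne'))]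
  have := RingHom.congr_fun (thetaLocToGerm_comp F L) (countPoly (Nat.card F) a b c)
  simp only [RingHom.comp_apply, Polynomial.coe_mapRingHom, Polynomial.coe_eval₂RingHom,
    Polynomial.eval₂_map] at this
  simp only [this]

end point

/-! ### The isomorphism for `Θ(G) ⊗ ℚ` -/

section rational

/-- The map from `ℚ[t]` with `t ↦ 1 + [X_{0,1,0}]`. -/
noncomputable def polyToTheta (F : Type u) [Field F] [Finite F] :
    ℚ[X] →ₐ[ℚ] ℚ ⊗[ℤ] Theta (openClass F) :=
  Polynomial.aeval (1 + 1 ⊗ₜ Theta.cls (embOpen F 0 1 0))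

theorem polyToTheta_X :
    polyToTheta F Polynomial.X = 1 + 1 ⊗ₜ Theta.cls (embOpen F 0 1 0) :=
  Polynomial.aeval_X _

theorem polyToTheta_X_sub_one :
    polyToTheta F (Polynomial.X - 1) = 1 ⊗ₜ Theta.cls (embOpen F 0 1 0) := by
  rw [map_sub (polyToTheta F), polyToTheta_X]
  exact (congrArg _ (map_one (polyToTheta F).toRingHom)).trans (add_sub_cancel_left _ _)

/-- The inclusion of `Θ(G)` in `ℚ ⊗ Θ(G)`. -/
noncomputable def inclTheta (F : Type u) [Field F] :
    Theta (openClass F) →+* ℚ ⊗[ℤ] Theta (openClass F) :=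
  (Algebra.TensorProduct.includeRight :
    Theta (openClass F) →ₐ[ℤ] ℚ ⊗[ℤ] Theta (openClass F)).toRingHom

/-- The range contains the inverses of all positive integers and the class of `X_{0,1,0}`, hence all
classes by `measure_mem_of_open`. -/
theorem polyToTheta_surjective : Function.Surjective (polyToTheta F) := by
  let A := ℚ ⊗[ℤ] Theta (openClass F)
  let S : Subring A := RingHom.range (S := A) (polyToTheta F).toRingHom
  have h1 (x : Theta (openClass F)) : inclTheta F x ∈ S := by
    refine Theta.mem_of_cls_mem
      (Subring.comap (R := Theta (openClass F)) (S := A) (inclTheta F) S) (fun X => ?_) x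
    refine measure_mem_of_open (k := A) (Theta.isMeasure_cls.comp (inclTheta F)) S
      (fun n hn => ?_) ⟨_, polyToTheta_X_sub_one⟩ X
    refine ⟨polyToTheta F (Polynomial.C (n : ℚ)⁻¹), ⟨_, rfl⟩, ?_⟩
    have h : (Polynomial.C (n : ℚ)⁻¹) * (n : ℚ[X]) = 1 := by
      rw [← Polynomial.C_eq_natCast, ← Polynomial.C_mul, inv_mul_cancel₀ (by exact_mod_cast hn),
        Polynomial.C_1]
    have := congrArg (polyToTheta F).toRingHom h
    rw [map_mul, map_natCast, map_one] at this
    exact this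
  intro y
  induction y using TensorProduct.induction_on with
  | zero => exact ⟨0, map_zero _⟩
  | add x y hx hy =>
    obtain ⟨p, rfl⟩ := hx
    obtain ⟨r, rfl⟩ := hy
    exact ⟨p + r, map_add _ _ _⟩
  | tmul a x =>
    obtain ⟨p, hp⟩ := h1 x
    refine ⟨a • p, ?_⟩
    have hp : polyToTheta F p = 1 ⊗ₜ x := hp
    rw [map_smul, hp, TensorProduct.smul_tmul', smul_eq_mul, mul_one]

/-- The counting measure on `ℚ ⊗ Θ(G)`. -/
noncomputable def thetaToGerm (F : Type u) [Field F] [Finite F] :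
    ℚ ⊗[ℤ] Theta (openClass F) →+* SeqGerm :=
  (Algebra.TensorProduct.productMap constGerm.toIntAlgHom
    (Theta.lift (isMeasure_counting (F := F))).toIntAlgHom).toRingHom

theorem thetaToGerm_tmul (a : ℚ) (X : HatSet (openClass F)) :
    thetaToGerm F (a ⊗ₜ Theta.cls X) = constGerm a * counting X := by
  refine (Algebra.TensorProduct.productMap_apply_tmul _ _ _ _).trans ?_
  exact congrArg (constGerm a * ·) (Theta.lift_cls isMeasure_counting X)

/-- Followed by the counting measure, the map becomes evaluation at the germ of `q ^ n`. -/
theorem polyToTheta_injective : Function.Injective (polyToTheta F) := by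
  have : (thetaToGerm F).comp (polyToTheta F).toRingHom =
      Polynomial.eval₂RingHom constGerm (powGerm (Nat.card F)) := by
    refine Polynomial.ringHom_ext' (Subsingleton.elim _ _) ?_
    have h := thetaToGerm_tmul 1 (embOpen F 0 1 0)
    rw [counting_embOpen_line, map_one, one_mul] at h
    refine (congrArg (thetaToGerm F) polyToTheta_X).trans ?_
    rw [map_add, map_one, h]
    simp
  refine Function.Injective.of_comp (f := thetaToGerm F) ?_
  have h := eval₂_powGerm_injective (q := Nat.card F) Finite.one_lt_card
  rw [← this] at h
  exact h

/-- The isomorphism `ℚ ⊗ Θ(G) ≅ ℚ[t]`. -/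
noncomputable def thetaEquiv (F : Type u) [Field F] [Finite F] :
    ℚ ⊗[ℤ] Theta (openClass F) ≃ₐ[ℚ] ℚ[X] :=
  (AlgEquiv.ofBijective (polyToTheta F) ⟨polyToTheta_injective, polyToTheta_surjective⟩).symm

theorem thetaEquiv_embOpen :
    thetaEquiv F (1 ⊗ₜ Theta.cls (embOpen F 0 1 0)) = Polynomial.X - 1 := by
  rw [← polyToTheta_X_sub_one]
  exact AlgEquiv.symm_apply_apply _ _

theorem isMeasure_thetaEquiv {k : Type*} [CommRing k] (f : ℚ[X] →+* k) :
    IsMeasure fun X : HatSet (openClass F) => f (thetaEquiv F (1 ⊗ₜ Theta.cls X)) :=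
  Theta.isMeasure_cls.comp (f.comp ((thetaEquiv F : _ →+* ℚ[X]).comp (inclTheta F)))

end rational

theorem eval_countPoly (a b c l : ℕ) :
    (countPoly (Nat.card F) a b c).eval ((Nat.card F : ZInv (Nat.card F)) ^ l) =
      (Nat.card (PairedSpace.Emb (PairedSpace.std F a b c) (PairedSpace.std F l 0 0)) :
        ZInv (Nat.card F)) := by
  have hq : Nat.card F ≠ 0 := Nat.card_pos.ne'
  apply ZInv.toRat_injective hq
  have h : ((Nat.card F : ℚ) ^ ((a + b) * (a + c))) ≠ 0 := pow_ne_zero _ (by exact_mod_cast hq)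
  apply mul_right_cancel₀ h
  have := eval₂_countPoly (ZInv.toRat (Nat.card F) hq) ((Nat.card F : ℚ) ^ l) a b c
  rw [map_natCast, PairedSpace.card_emb_std, ← this, ← Polynomial.eval₂_at_apply, map_pow,
    map_natCast]

end GLinf

/-! ### The homomorphism `φ`, the measures `μ_t` and the theorem -/

namespace GLinf

variable {F : Type u} [Field F] [Finite F]

theorem isMeasure_aeval_thetaEquiv {k : Type v} [Field k] [CharZero k] (t : k) :
    IsMeasure fun X : HatSet (openClass F) =>
      Polynomial.aeval t (thetaEquiv F (1 ⊗ₜ Theta.cls X)) :=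
  isMeasure_thetaEquiv (Polynomial.aeval t).toRingHom

theorem aeval_thetaEquiv_embOpen {k : Type v} [Field k] [CharZero k] (t : k) :
    Polynomial.aeval t (thetaEquiv F (1 ⊗ₜ Theta.cls (embOpen F 0 1 0))) = t - 1 := by
  rw [thetaEquiv_embOpen, map_sub, Polynomial.aeval_X, map_one]

theorem eq_aeval_thetaEquiv_iff {k : Type v} [Field k] [CharZero k] {μ : HatSet (openClass F) → k}
    (hμ : IsMeasure μ) (t : k) :
    (∀ X, μ X = Polynomial.aeval t (thetaEquiv F (1 ⊗ₜ Theta.cls X))) ↔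
      μ (embOpen F 0 1 0) = t - 1 := by
  refine ⟨fun h => (h _).trans (aeval_thetaEquiv_embOpen t), fun h X => ?_⟩
  refine measure_ext_of_open hμ (isMeasure_aeval_thetaEquiv t) (fun n hn => ?_) ?_ X
  · exact isUnit_iff_ne_zero.mpr (Nat.cast_ne_zero.mpr hn)
  · exact h.trans (aeval_thetaEquiv_embOpen t).symm

variable (F)

/-- The isomorphism `Θ(G; 𝐕)[1/q] ≅ ℤ[1/q][t]`. -/
noncomputable def thetaLocEquiv (L : Type*) [CommRing L] [Algebra (Theta (pointClass F)) L]
    [IsLocalization.Away ((Nat.card F : ℕ) : Theta (pointClass F)) L] :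
    L ≃+* (ZInv (Nat.card F))[X] :=
  (RingEquiv.ofBijective (polyToThetaLoc F L) (polyToThetaLoc_bijective F L)).symm

/-- The ring homomorphism `Θ(G; 𝐕) → ℤ[1/q][t]`. -/
noncomputable def thetaToPoly (L : Type*) [CommRing L] [Algebra (Theta (pointClass F)) L]
    [IsLocalization.Away ((Nat.card F : ℕ) : Theta (pointClass F)) L] :
    Theta (pointClass F) →+* (ZInv (Nat.card F))[X] :=
  (thetaLocEquiv F L).toRingHom.comp (algebraMap (Theta (pointClass F)) L)

variable (L : Type*) [CommRing L] [Algebra (Theta (pointClass F)) L]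
    [IsLocalization.Away ((Nat.card F : ℕ) : Theta (pointClass F)) L]

theorem thetaToPoly_embSet (a b c : ℕ) :
    thetaToPoly F L (Theta.cls (embSet F a b c)) = countPoly (Nat.card F) a b c :=
  (congrArg (thetaLocEquiv F L) (polyToThetaLoc_countPoly F L a b c).symm).trans
    ((RingEquiv.ofBijective (polyToThetaLoc F L)
      (polyToThetaLoc_bijective F L)).symm_apply_apply _)

theorem thetaToPoly_line :
    thetaToPoly F L (Theta.cls (embSet F 0 1 0)) = Polynomial.X - 1 :=
  (congrArg (thetaLocEquiv F L) (polyToThetaLoc_X_sub_one F L).symm).trans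
    ((RingEquiv.ofBijective (polyToThetaLoc F L)
      (polyToThetaLoc_bijective F L)).symm_apply_apply _)

variable {F L}

/-- Composing with the classes gives two measures in a ring where `q` is a unit, so their agreement
at `X_{0,1,0}` suffices. -/
theorem hom_eq_thetaToPoly {ψ : Theta (pointClass F) →+* (ZInv (Nat.card F))[X]}
    (h : ∀ a b c, ψ (Theta.cls (embSet F a b c)) = countPoly (Nat.card F) a b c) :
    ψ = thetaToPoly F L := by
  have hq : IsUnit ((Nat.card F : ℕ) : (ZInv (Nat.card F))[X]) := by
    refine IsUnit.of_mul_eq_one_right (Polynomial.C (ZInv.inv (Nat.card F))) ?_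
    rw [← Polynomial.C_eq_natCast, ← Polynomial.C_mul, ZInv.inv_mul, Polynomial.C_1]
  refine Theta.hom_ext (k := (ZInv (Nat.card F))[X]) fun X => ?_
  exact measure_ext (Theta.isMeasure_cls.comp (k' := (ZInv (Nat.card F))[X]) ψ)
    (Theta.isMeasure_cls.comp (k' := (ZInv (Nat.card F))[X]) (thetaToPoly F L)) hq
    ((h 0 1 0).trans (thetaToPoly_embSet F L 0 1 0).symm) X

/-- Both sides are measures relative to `𝓔(𝐕)` with values in `ℚ[t]`, and both take the value `t -
1` at `X_{0,1,0}`. -/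
theorem thetaEquiv_ofSubset_of_line {f : Theta (pointClass F) →+* ℚ[X]}
    (hf : f (Theta.cls (embSet F 0 1 0)) = Polynomial.X - 1) (X : HatSet (pointClass F)) :
    thetaEquiv F (1 ⊗ₜ Theta.cls (X.ofSubset (pointClass_subset_openClass F))) =
      f (Theta.cls X) := by
  have hq : IsUnit ((Nat.card F : ℕ) : ℚ[X]) := by
    refine IsUnit.of_mul_eq_one_right (Polynomial.C (Nat.card F : ℚ)⁻¹) ?_
    rw [← Polynomial.C_eq_natCast, ← Polynomial.C_mul,
      inv_mul_cancel₀ (Nat.cast_ne_zero.mpr Nat.card_pos.ne'), Polynomial.C_1]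
  exact measure_ext
    ((isMeasure_thetaEquiv (RingHom.id ℚ[X])).ofSubset (pointClass_subset_openClass F))
    (Theta.isMeasure_cls.comp f) hq (thetaEquiv_embOpen.trans hf.symm) X

theorem thetaEquiv_ofSubset (X : HatSet (pointClass F)) :
    thetaEquiv F (1 ⊗ₜ Theta.cls (X.ofSubset (pointClass_subset_openClass F))) =
      (thetaToPoly F L (Theta.cls X)).map (ZInv.toRat (Nat.card F) Nat.card_pos.ne') := by
  refine thetaEquiv_ofSubset_of_line (f := (Polynomial.mapRingHom
    (ZInv.toRat (Nat.card F) Nat.card_pos.ne')).comp (thetaToPoly F L)) ?_ X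
  rw [RingHom.comp_apply, thetaToPoly_line, RingHom.map_sub (α := (ZInv (Nat.card F))[X]), map_one,
    Polynomial.coe_mapRingHom, Polynomial.map_X]

end GLinf

theorem mainTheorem3 (F : Type u) [Field F] [Finite F] :
    -- the value of `P_{a,b,c}` at `q ^ l` is the number of embeddings of `V_{a,b,c}` in `V_{l,0,0}`
    (∀ a b c l : ℕ,
      (countPoly (Nat.card F) a b c).eval ((Nat.card F : ZInv (Nat.card F)) ^ l) =
        (Nat.card (PairedSpace.Emb (PairedSpace.std F a b c) (PairedSpace.std F l 0 0)) :
          ZInv (Nat.card F))) ∧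
    -- the counting measure `φ` on `Θ(G; 𝐕)`
    ∃ φ : Theta (GLinf.pointClass F) →+* (ZInv (Nat.card F))[X],
      (∀ a b c : ℕ, φ (Theta.cls (GLinf.embSet F a b c)) = countPoly (Nat.card F) a b c) ∧
      (∀ ψ : Theta (GLinf.pointClass F) →+* (ZInv (Nat.card F))[X],
        (∀ a b c : ℕ, ψ (Theta.cls (GLinf.embSet F a b c)) = countPoly (Nat.card F) a b c) →
          ψ = φ) ∧
      -- it becomes an isomorphism after inverting `q`
      (∃ e : Localization.Away ((Nat.card F : ℕ) : Theta (GLinf.pointClass F)) ≃+*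
          (ZInv (Nat.card F))[X],
        ∀ x : Theta (GLinf.pointClass F), e (algebraMap _ _ x) = φ x) ∧
      -- it induces an isomorphism `Θ(G) ⊗ ℚ ≅ ℚ[t]`
      ∃ e : ℚ ⊗[ℤ] Theta (GLinf.openClass F) ≃ₐ[ℚ] ℚ[X],
        (∀ X : HatSet (GLinf.pointClass F),
          e (1 ⊗ₜ Theta.cls (X.ofSubset (GLinf.pointClass_subset_openClass F))) =
            (φ (Theta.cls X)).map (ZInv.toRat (Nat.card F) Nat.card_pos.ne')) ∧
        -- the measures valued in a field of characteristic zero are the `μ_t`, one for each `t`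
        ∀ (k : Type v) [Field k] [CharZero k],
          (∀ t : k, IsMeasure fun X : HatSet (GLinf.openClass F) =>
            Polynomial.aeval t (e (1 ⊗ₜ Theta.cls X))) ∧
          (∀ μ : HatSet (GLinf.openClass F) → k, IsMeasure μ →
            ∃! t : k, ∀ X, μ X = Polynomial.aeval t (e (1 ⊗ₜ Theta.cls X))) ∧
          (∀ (μ : HatSet (GLinf.openClass F) → k) (t : k), IsMeasure μ →
            ((∀ X, μ X = Polynomial.aeval t (e (1 ⊗ₜ Theta.cls X))) ↔
              μ ((GLinf.embSet F 0 1 0).ofSubset (GLinf.pointClass_subset_openClass F)) =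
                t - 1)) := by
  let L := Localization.Away ((Nat.card F : ℕ) : Theta (GLinf.pointClass F))
  refine ⟨GLinf.eval_countPoly, GLinf.thetaToPoly F L, GLinf.thetaToPoly_embSet F L,
    fun ψ h => GLinf.hom_eq_thetaToPoly h, ⟨GLinf.thetaLocEquiv F L, fun x => rfl⟩,
    GLinf.thetaEquiv F, GLinf.thetaEquiv_ofSubset, fun k _ _ =>
      ⟨GLinf.isMeasure_aeval_thetaEquiv, fun μ hμ => ?_,
        fun μ t hμ => GLinf.eq_aeval_thetaEquiv_iff hμ t⟩⟩
  -- The parameter is forced by the value `t - 1` of `μ_t` at `X_{0,1,0}`.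
  refine ⟨1 + μ (GLinf.embOpen F 0 1 0), (GLinf.eq_aeval_thetaEquiv_iff hμ _).mpr
    (add_sub_cancel_left _ _).symm, fun t ht => ?_⟩
  rw [(GLinf.eq_aeval_thetaEquiv_iff hμ t).mp ht, add_sub_cancel]
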